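/- Let $N\ge 1$, $\mu\in\mathbb C$, $u=(u_1,\dots,u_N)\in\mathbb C^N$, $Q(x^2)=x^{2N}-\sum_{j=1}^N u_jx^{2N-2j}$, and * for $SO(2N+1)$: $W=x^{-1}Q(x^2)$, $f=Q(x^2)^2-4\mu^2x^2$, $z=(Q(x^2)+y)/2x$, $\sigma'(x,y)=(-x,-y)$, $d=2N-1$; * for $Sp(2N)$: $W=x^2Q(x^2)+2\mu$, $f=Q(x^2)(x^2Q(x^2)+4\mu)$, $z=(2\mu+x^2Q(x^2)+xy)/2$, $\sigma'(x,y)=(-x,y)$, $d=2N+2$. Let $C_u$ be the compact hyperelliptic curve $y^2=f(x)$, i.e. $z+\mu^2/z=W(x)$, for those $u$ for which it is nonsingular ($f$ squarefree). For $n\ge1$ let $R_n=(W^{(2n-1)/d})_+$, the polynomial part of the Laurent series $W^{(2n-1)/d}=x^{2n-1}+\cdots$ at $x=\infty$, and let $d\hat\Omega_n=R_n(x)\,dz/z$. Then: 1. $R_n$ is an odd polynomial and $R_1=x$. 2. If $C_u$ is nonsingular, then the derivatives $\partial d\hat\Omega_n/\partial u_j|_{z=\mathrm{const}}$ ($n\ge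 1$, $1\le j\le N$) are holomorphic, $\sigma'$-invariant differentials on $C_u$. 3. Let $U\subset\mathbb C^N$ be an open set of $u$ with $C_u$ nonsingular, and let $A_j,B_j$ ($1\le j\le N$) be closed $C^1$ curves on $C_u$ ($u\in U$) that avoid the branch points, depend continuously on $u$ and have a fixed projection to the $x$-plane. With $\sigma_2(x,y)=(-x,y)$, suppose for each $u\in U$: for $Sp(2N)$, the $4N$ cycles $A_j,-\sigma_2(A_j),B_j,-\sigma_2(B_j)$ form a symplectic basis of $H_1(C_u,\mathbb Z)$; for $SO(2N+1)$, the cycles $A_j,-\sigma_2(A_j),B_j,-\sigma_2(B_j)$ ($j<N$) and $A_N,B_N$ form such a basis, and the homology classes of $A_N,B_N$ are odd under $\sigma_2$. Then for every $u\in U$ there are unique $\sigma'$-invariant holomorphic differentials $d\omega_1,\dots,d\omega_N$ on $C_u$ with $\oint_{A_j}d\omega_k=\delta_{jk}$. Put $c^{(n)}_j=\oint_{A_j}d\hat\Omega_n$ and $d\Omega_n=d\hat\Omega_n-\sum_{j=1}^Nc^{(n)}_jd\omega_j$. For any finite number $M\ge1$ of variables $T=(T_1,\dots,T_M)$ let $dS=\sum_{n=1}^MT_n\,d\hat\Omega_n$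 and $a_j(u,T)=\oint_{A_j}dS$. Then: * Every $u_0\in U$ and the point $(1,0,\dots,0)$ have open neighbourhoods $V\subset U$ and $S\subset\mathbb C^M$ such that $(u,T)\mapsto(a(u,T),T)$ is a biholomorphic map of $V\times S$ onto an open set. * Let $u(a,T)\in U$ be any holomorphic function on an open set of $\mathbb C^N\times\mathbb C^M$ with $a(u(a,T),T)=a$. Then on the curve $C_{u(a,T)}$: $\oint_{A_j}d\Omega_n=0$ for all $j,n$; $dS=\sum_{n}T_n\,d\Omega_n+\sum_{j=1}^Na_j\,d\omega_j$; and, with $u=u(a,T)$, the Whitham equations hold: $$\left.\frac{\partial}{\partial a_j}dS\right|_{z=\mathrm{const}}=d\omega_j,\qquad \left.\frac{\partial}{\partial T_n}dS\right|_{z=\mathrm{const}}=d\Omega_n .$$ Here, for a differential $R(x)\,dz/z$ whose polynomial $R$ and whose curve $C_u$ depend on a parameter $s$, the derivative at $z=\mathrm{const}$ is $r\,dz/z$, where $r$ is the derivative of $R(x)$ with respect to $s$ along the points of the curves on which the function $z$ has a fixed value. -/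

import Mathlib

noncomputable section

open Polynomial LaurentPolynomial MeasureTheory Filter Topology

namespace SeibergWitten

/-- The two gauge groups: `SOodd` is `SO(2N+1)` and `Sp` is `Sp(2N)`. -/
inductive GaugeGroup
  | SOodd
  | Sp

/-! ### The curves -/

/-- The polynomial `Q(x²) = x^{2N} - ∑_{j=1}^N u_j x^{2N-2j}` as a polynomial in `x`
(`j : Fin N` stands for the index `j + 1`). -/
def charPoly {N : ℕ} (u : Fin N → ℂ) : ℂ[X] :=
  X ^ (2 * N) - ∑ j : Fin N, Polynomial.C (u j) * X ^ (2 * N - 2 * (j.val + 1))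

/-- The superpotential: `W = x⁻¹ Q(x²)` for `SO(2N+1)`, `W = x² Q(x²) + 2μ` for `Sp(2N)`. -/
def superpotential (G : GaugeGroup) {N : ℕ} (μ : ℂ) (u : Fin N → ℂ) : ℂ[T;T⁻¹] :=
  match G with
  | .SOodd => T (-1) * toLaurent (charPoly u)
  | .Sp => T 2 * toLaurent (charPoly u) + LaurentPolynomial.C (2 * μ)

/-- The degree of the superpotential. -/
def wDegree (G : GaugeGroup) (N : ℕ) : ℕ :=
  match G with
  | .SOodd => 2 * N - 1
  | .Sp => 2 * N + 2

/-- The hyperelliptic polynomial `f` of the curve `C : y² = f(x)`: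
`Q(x²)² - 4μ²x²` for `SO(2N+1)`, `Q(x²)(x²Q(x²) + 4μ)` for `Sp(2N)`.
The curve is nonsingular (of genus `2N - 1`, resp. `2N`) when `f` is squarefree. -/
def curvePoly (G : GaugeGroup) {N : ℕ} (μ : ℂ) (u : Fin N → ℂ) : ℂ[X] :=
  match G with
  | .SOodd => charPoly u ^ 2 - Polynomial.C (4 * μ ^ 2) * X ^ 2
  | .Sp => charPoly u * (X ^ 2 * charPoly u + Polynomial.C (4 * μ))

/-- The function `z` on the curve: `z = (Q(x²) + y)/2x`, resp. `z = (2μ + x²Q(x²) + xy)/2`. -/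
def zFun (G : GaugeGroup) {N : ℕ} (μ : ℂ) (u : Fin N → ℂ) (x y : ℂ) : ℂ :=
  match G with
  | .SOodd => ((charPoly u).eval x + y) / (2 * x)
  | .Sp => (2 * μ + x ^ 2 * (charPoly u).eval x + x * y) / 2

/-- In the coordinates `(x, z)` the curve is `z + μ²/z = W(x)`. -/
theorem zFun_add_div (G : GaugeGroup) {N : ℕ} (μ : ℂ) (hμ : μ ≠ 0) (u : Fin N → ℂ) (x y : ℂ)
    (hx : x ≠ 0) (h : y ^ 2 = (curvePoly G μ u).eval x) :
    zFun G μ u x y + μ ^ 2 / zFun G μ u x y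
      = LaurentPolynomial.eval₂ (RingHom.id ℂ) (Units.mk0 x hx) (superpotential G μ u) := by
  cases G with
  | SOodd =>
    have h' : y ^ 2 = (charPoly u).eval x ^ 2 - 4 * μ ^ 2 * x ^ 2 := by
      simpa [curvePoly] using h
    have hz : (charPoly u).eval x + y ≠ 0 := by
      intro h0
      have h1 : (4 * μ ^ 2 * x ^ 2) = 0 := by
        linear_combination ((charPoly u).eval x - y) * h0 + h'
      simp [hμ, hx] at h1
    have hW : LaurentPolynomial.eval₂ (RingHom.id ℂ) (Units.mk0 x hx) (superpotential .SOodd μ u)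
        = x⁻¹ * (charPoly u).eval x := by
      rw [superpotential, map_mul, eval₂_T, eval₂_toLaurent, Polynomial.eval₂_id]
      simp
    rw [hW]
    simp only [zFun]
    field_simp
    linear_combination h'
  | Sp =>
    have h' : y ^ 2 = (charPoly u).eval x * (x ^ 2 * (charPoly u).eval x + 4 * μ) := by
      simpa [curvePoly] using h
    have hz : 2 * μ + x ^ 2 * (charPoly u).eval x + x * y ≠ 0 := by
      intro h0
      have h1 : 4 * μ ^ 2 = 0 := by
        linear_combination (2 * μ + x ^ 2 * (charPoly u).eval x - x * y) * h0 + x ^ 2 * h'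
      simp [hμ] at h1
    have hW : LaurentPolynomial.eval₂ (RingHom.id ℂ) (Units.mk0 x hx) (superpotential .Sp μ u)
        = x ^ 2 * (charPoly u).eval x + 2 * μ := by
      rw [superpotential, map_add, map_mul, eval₂_T, eval₂_toLaurent, LaurentPolynomial.eval₂_C,
        Polynomial.eval₂_id, RingHom.id_apply]
      norm_cast
    rw [hW]
    simp only [zFun]
    field_simp
    linear_combination x ^ 2 * h'

/-! ### Fractional powers of the superpotential -/

/-- For a Laurent polynomial `W(x) = x^d (1 + h(1/x))`, monic of degree `d`, the power series
`(1 + h(s))^{m/d}` in `s = 1/x`, so that `W(x)^{m/d} = x^m (1 + h(1/x))^{m/d}` is the Laurent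
series at `x = ∞` of the form `x^m + ⋯`. -/
def fracPowSeries (W : ℂ[T;T⁻¹]) (d m : ℕ) : PowerSeries ℂ :=
  (PowerSeries.binomialSeries ℂ ((m : ℂ) / (d : ℂ))).subst
    (PowerSeries.mk (fun i : ℕ => W.coeff ((d : ℤ) - (i : ℤ))) - 1)

/-- The `d`-th power of `W^{m/d}` is `W^m`. -/
theorem fracPowSeries_pow (W : ℂ[T;T⁻¹]) (d m : ℕ) (hd : d ≠ 0) (hW : W.coeff d = 1) :
    fracPowSeries W d m ^ d = PowerSeries.mk (fun i : ℕ => W.coeff ((d : ℤ) - (i : ℤ))) ^ m := by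
  have hs : PowerSeries.HasSubst
      (PowerSeries.mk (fun i : ℕ => W.coeff ((d : ℤ) - (i : ℤ))) - 1 : PowerSeries ℂ) := by
    apply PowerSeries.HasSubst.of_constantCoeff_zero'
    simp [hW]
  have hpow : ∀ k : ℕ, PowerSeries.binomialSeries ℂ ((m : ℂ) / (d : ℂ)) ^ k
      = PowerSeries.binomialSeries ℂ ((k : ℂ) * ((m : ℂ) / (d : ℂ))) := by
    intro k
    induction k with
    | zero => simp
    | succ k ih =>
      rw [pow_succ, ih, ← PowerSeries.binomialSeries_add]
      congr 1
      push_cast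
      ring
  have hd' : (d : ℂ) ≠ 0 := by exact_mod_cast hd
  rw [fracPowSeries, ← PowerSeries.subst_pow hs, hpow, mul_div_cancel₀ _ hd',
    PowerSeries.binomialSeries_nat, PowerSeries.subst_pow hs, PowerSeries.subst_add hs,
    PowerSeries.subst_X hs]
  have h1 : PowerSeries.subst
      (PowerSeries.mk (fun i : ℕ => W.coeff ((d : ℤ) - (i : ℤ))) - 1 : PowerSeries ℂ)
      (1 : PowerSeries ℂ) = 1 := by
    rw [← PowerSeries.coe_substAlgHom hs, map_one]
  rw [h1]
  ring

/-- The polynomial part `(W^{m/d})_+` of the Laurent series `W(x)^{m/d} = x^m + ⋯`. -/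
def fracPowPolyPart (W : ℂ[T;T⁻¹]) (d m : ℕ) : ℂ[X] :=
  ∑ i ∈ Finset.range (m + 1), monomial (m - i) (PowerSeries.coeff i (fracPowSeries W d m))

/-- `R_n = (W^{(2n-1)/(2N-1)})_+` for `SO(2N+1)` and `R_n = (W^{(2n-1)/(2N+2)})_+` for `Sp(2N)`
(for `n ≥ 1`). -/
def whithamPoly (G : GaugeGroup) {N : ℕ} (μ : ℂ) (u : Fin N → ℂ) (n : ℕ) : ℂ[X] :=
  fracPowPolyPart (superpotential G μ u) (wDegree G N) (2 * n - 1)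

/-! ### Meromorphic differentials -/

/-- Meromorphic differentials on the compact hyperelliptic curve `y² = f(x)`.
The pair `(a, b)` stands for `(a(x) + b(x)/y) dx`; every meromorphic differential has a unique
such representation. -/
abbrev MerDiff : Type := RatFunc ℂ × RatFunc ℂ

/-- The coefficient function `φ(x, y)` of the differential `φ dx`. -/
def MerDiff.fn (ω : MerDiff) (x y : ℂ) : ℂ :=
  ω.1.eval (RingHom.id ℂ) x + ω.2.eval (RingHom.id ℂ) x / y

/-- A differential on the compact Riemann surface of `y² = f(x)` is holomorphic if its pull-back
along every holomorphic map `t ↦ (X(t), Y(t))` from a neighbourhood of `0` to the surface (a pair of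
meromorphic functions that satisfies the equation of the curve) is holomorphic at `t = 0`.
These maps include the charts at all points: at the branch points and at the two points
at infinity as well. -/
def IsHolomorphic (f : ℂ[X]) (ω : MerDiff) : Prop :=
  ∀ X Y : ℂ → ℂ, MeromorphicAt X 0 → MeromorphicAt Y 0 →
    (∀ᶠ t in 𝓝[≠] (0 : ℂ), Y t ^ 2 = f.eval (X t)) →
    0 ≤ meromorphicOrderAt (fun t => ω.fn (X t) (Y t) * deriv X t) 0

/-- Invariance under the involution `σ'`, which is `(x, y) ↦ (-x, -y)` for `SO(2N+1)` and
`(x, y) ↦ (-x, y)` for `Sp(2N)`. In both cases `dx` is pulled back to `-dx`. -/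
def IsSigmaInvariant (G : GaugeGroup) (f : ℂ[X]) (ω : MerDiff) : Prop :=
  ∀ x y : ℂ, y ^ 2 = f.eval x →
    match G with
    | .SOodd => -ω.fn (-x) (-y) = ω.fn x y
    | .Sp => -ω.fn (-x) y = ω.fn x y

/-- The differential `R(x) dz/z` for a polynomial `R`. By differentiation of `z + μ²/z = W(x)`,
`dz/z = W'(x) dx / (z - μ²/z)`. With `q(x) = Q(x²)` this is `(x q' - q)/x · dx/y` for `SO(2N+1)`,
where `z - μ²/z = y/x`, and `(x q' + 2 q) dx/y` for `Sp(2N)`, where `z - μ²/z = xy`. -/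
def mulDLogZ (G : GaugeGroup) {N : ℕ} (u : Fin N → ℂ) (R : ℂ[X]) : MerDiff :=
  (0, algebraMap ℂ[X] (RatFunc ℂ) R *
    match G with
    | .SOodd =>
        algebraMap ℂ[X] (RatFunc ℂ) (X * derivative (charPoly u) - charPoly u) / RatFunc.X
    | .Sp => algebraMap ℂ[X] (RatFunc ℂ) (X * derivative (charPoly u) + 2 * charPoly u))

theorem mulDLogZ_one_fn_SOodd {N : ℕ} (u : Fin N → ℂ) (x y : ℂ) (hx : x ≠ 0) :
    (mulDLogZ .SOodd u 1).fn x y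
      = (x * (derivative (charPoly u)).eval x - (charPoly u).eval x) / x / y := by
  have h : ((mulDLogZ .SOodd u 1).2).eval (RingHom.id ℂ) x
      = (x * (derivative (charPoly u)).eval x - (charPoly u).eval x) / x := by
    rw [eq_div_iff hx]
    have h1 : (mulDLogZ .SOodd u 1).2 * RatFunc.X
        = algebraMap ℂ[X] (RatFunc ℂ) (X * derivative (charPoly u) - charPoly u) := by
      simp only [mulDLogZ, map_one, one_mul]
      exact div_mul_cancel₀ _ RatFunc.X_ne_zero
    have hd : (mulDLogZ .SOodd u 1).2.denom.eval₂ (RingHom.id ℂ) x ≠ 0 := by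
      intro h0
      have hdvd : (mulDLogZ .SOodd u 1).2.denom ∣ X := by
        have h2 := RatFunc.denom_div_dvd (K := ℂ) (X * derivative (charPoly u) - charPoly u) X
        simpa [mulDLogZ] using h2
      have := Polynomial.eval₂_eq_zero_of_dvd_of_eval₂_eq_zero (RingHom.id ℂ) x hdvd h0
      simp [hx] at this
    have h3 := RatFunc.eval_mul (RingHom.id ℂ) x hd (y := RatFunc.X) (by simp)
    rw [RatFunc.eval_X] at h3
    rw [← h3, h1, RatFunc.eval_algebraMap]
    simp [Polynomial.eval₂_id]
  rw [MerDiff.fn, h]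
  simp [mulDLogZ]

theorem mulDLogZ_one_fn_Sp {N : ℕ} (u : Fin N → ℂ) (x y : ℂ) :
    (mulDLogZ .Sp u 1).fn x y
      = (x * (derivative (charPoly u)).eval x + 2 * (charPoly u).eval x) / y := by
  have h : ((mulDLogZ .Sp u 1).2)
      = algebraMap ℂ[X] (RatFunc ℂ) (X * derivative (charPoly u) + 2 * charPoly u) := by
    simp [mulDLogZ]
  rw [MerDiff.fn, h, RatFunc.eval_algebraMap]
  simp [mulDLogZ, Polynomial.eval₂_id]

/-- `mulDLogZ G u 1` is `dz/z`: along every parametrization of the curve, `z' = z · (dz/z)`. -/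
theorem hasDerivAt_zFun (G : GaugeGroup) {N : ℕ} (μ : ℂ) (u : Fin N → ℂ) (p q : ℂ → ℂ)
    (t p' q' : ℂ) (hp : HasDerivAt p p' t) (hq : HasDerivAt q q' t) (hp0 : p t ≠ 0)
    (hq0 : q t ≠ 0) (hc : ∀ᶠ s in 𝓝 t, q s ^ 2 = (curvePoly G μ u).eval (p s)) :
    HasDerivAt (fun s => zFun G μ u (p s) (q s))
      (zFun G μ u (p t) (q t) * ((mulDLogZ G u 1).fn (p t) (q t) * p')) t := by
  have hQ : HasDerivAt (fun s => (charPoly u).eval (p s))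
      ((derivative (charPoly u)).eval (p t) * p') t :=
    ((charPoly u).hasDerivAt (p t)).comp t hp
  have hf : HasDerivAt (fun s => (curvePoly G μ u).eval (p s))
      ((derivative (curvePoly G μ u)).eval (p t) * p') t :=
    ((curvePoly G μ u).hasDerivAt (p t)).comp t hp
  have heq := (hq.pow 2).unique (hf.congr_of_eventuallyEq hc)
  have hct := hc.self_of_nhds
  cases G with
  | SOodd =>
    rw [mulDLogZ_one_fn_SOodd u _ _ hp0]
    have h1 := (hQ.add hq).div (hp.const_mul 2) (mul_ne_zero two_ne_zero hp0)
    refine h1.congr_deriv ?_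
    simp [curvePoly, derivative_pow] at heq hct
    simp only [zFun, Pi.add_apply]
    field_simp
    linear_combination (p t) / 2 * heq - p' * hct
  | Sp =>
    rw [mulDLogZ_one_fn_Sp u]
    have h1 := ((((hp.pow 2).mul hQ).const_add (2 * μ)).add (hp.mul hq)).div_const 2
    refine (h1.congr_deriv ?_).congr_of_eventuallyEq ?_
    · simp [curvePoly, derivative_pow] at heq hct
      simp only [zFun, Pi.pow_apply]
      field_simp
      linear_combination (p t) / 2 * heq + p' * hct
    · filter_upwards with s
      simp [zFun]

/-- `dΩ̂_n = R_n(x) dz/z`. -/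
def dOmegaHat (G : GaugeGroup) {N : ℕ} (μ : ℂ) (u : Fin N → ℂ) (n : ℕ) : MerDiff :=
  mulDLogZ G u (whithamPoly G μ u n)

/-- The polynomial `∑_n T_n R_n` (with `n : Fin M` standing for the index `n + 1`). -/
def dSPoly (G : GaugeGroup) {N M : ℕ} (μ : ℂ) (u : Fin N → ℂ) (t : Fin M → ℂ) : ℂ[X] :=
  ∑ n : Fin M, Polynomial.C (t n) * whithamPoly G μ u (n.val + 1)

/-- `dS = ∑_n T_n dΩ̂_n = (∑_n T_n R_n) dz/z`. -/
def dS (G : GaugeGroup) {N M : ℕ} (μ : ℂ) (u : Fin N → ℂ) (t : Fin M → ℂ) : MerDiff :=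
  mulDLogZ G u (dSPoly G μ u t)

/-! ### Differentiation with `z` kept constant -/

/-- `(X(s), Y(s))` is a continuous family of points of the curves `C_{u(s)}` through the point
`(x₀, y₀)` of `C_{u(s₀)}` along which the function `z` is constant. -/
def IsConstZLift (G : GaugeGroup) {N : ℕ} (μ : ℂ) (u : ℂ → Fin N → ℂ) (s₀ x₀ y₀ : ℂ)
    (X Y : ℂ → ℂ) : Prop :=
  X s₀ = x₀ ∧ Y s₀ = y₀ ∧ ContinuousAt X s₀ ∧ ContinuousAt Y s₀ ∧
    ∀ᶠ s in 𝓝 s₀, Y s ^ 2 = (curvePoly G μ (u s)).eval (X s) ∧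
      zFun G μ (u s) (X s) (Y s) = zFun G μ (u s₀) x₀ y₀

/-- Let `u(s)` be a path in the space of moduli and `R_s(x) dz/z` a differential on `C_{u(s)}`.
Then `∂/∂s (R_s(x) dz/z)|_{z = const} = ω` at `s = s₀`: near every point `(x₀, y₀)` of
`C_{u(s₀)}` where `dz/z` is finite and nonzero (all but finitely many points of the curve), so
that `z` is a local coordinate, the point of `C_{u(s)}` with a given value of `z` is a
function of `s`, and the derivative `r` of `R_s(x)` along this function satisfies `r dz/z = ω`. -/
def HasConstZDeriv (G : GaugeGroup) {N : ℕ} (μ : ℂ) (u : ℂ → Fin N → ℂ) (R : ℂ → ℂ[X]) (s₀ : ℂ)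
    (ω : MerDiff) : Prop :=
  ∀ x₀ y₀ : ℂ, y₀ ^ 2 = (curvePoly G μ (u s₀)).eval x₀ → x₀ ≠ 0 → y₀ ≠ 0 →
    (mulDLogZ G (u s₀) 1).fn x₀ y₀ ≠ 0 →
    (∃ X Y : ℂ → ℂ, IsConstZLift G μ u s₀ x₀ y₀ X Y) ∧
    ∀ X Y : ℂ → ℂ, IsConstZLift G μ u s₀ x₀ y₀ X Y →
      ∃ r : ℂ, HasDerivAt (fun s => (R s).eval (X s)) r s₀ ∧
        r * (mulDLogZ G (u s₀) 1).fn x₀ y₀ = ω.fn x₀ y₀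

/-! ### Cycles, periods and intersection numbers -/

/-- A pair of functions, meant as a parametrized path `t ↦ (x(t), y(t))`. -/
structure Loop where
  x : ℝ → ℂ
  y : ℝ → ℂ

/-- The period `∮_γ ω` of a loop of period `1`. -/
def Loop.period (γ : Loop) (ω : MerDiff) : ℂ :=
  ∫ t in (0 : ℝ)..1, ω.fn (γ.x t) (γ.y t) * deriv γ.x t

/-- The cycle `-σ₂(γ)`: the image of `γ` under `σ₂ : (x, y) ↦ (-x, y)`, run backwards. -/
def Loop.negSigma₂ (γ : Loop) : Loop where
  x t := -γ.x (-t)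
  y t := γ.y (-t)

/-- A locally constant family of cycles on the curves `C_u`, `u ∈ U`: closed `C¹` curves that
avoid the branch points, depend continuously on `u`, and have the same projection to the
`x`-plane for all `u ∈ U`. -/
structure CycleFamily (G : GaugeGroup) {N : ℕ} (μ : ℂ) (U : Set (Fin N → ℂ)) where
  x : ℝ → ℂ
  y : (Fin N → ℂ) → ℝ → ℂ
  contDiff_x : ContDiff ℝ 1 x
  continuousOn_y : ContinuousOn (fun p : (Fin N → ℂ) × ℝ => y p.1 p.2) (U ×ˢ Set.univ)
  periodic_x : ∀ t, x (t + 1) = x t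
  periodic_y : ∀ u ∈ U, ∀ t, y u (t + 1) = y u t
  mem_curve : ∀ u ∈ U, ∀ t, y u t ^ 2 = (curvePoly G μ u).eval (x t)
  y_ne_zero : ∀ u ∈ U, ∀ t, y u t ≠ 0

/-- The member of the family on the curve `C_u`. -/
def CycleFamily.at {G : GaugeGroup} {N : ℕ} {μ : ℂ} {U : Set (Fin N → ℂ)}
    (A : CycleFamily G μ U) (u : Fin N → ℂ) : Loop :=
  ⟨A.x, A.y u⟩

/-- The integral of `φ ψ̄` over the curve `y² = f(x)` with respect to the area in the `x`-plane,
for differentials `ω = φ dx` and `θ = ψ dx`; both sheets `y = ±√f(x)` are summed.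
As `dx ∧ dx̄ = -2i d(area)`, this is `(i/2) ∬_C ω ∧ θ̄`. -/
def hermPairing (f : ℂ[X]) (ω θ : MerDiff) : ℂ :=
  ∫ x : ℂ, (ω.fn x ((f.eval x) ^ (1 / 2 : ℂ)) *
      starRingEnd ℂ (θ.fn x ((f.eval x) ^ (1 / 2 : ℂ))) +
    ω.fn x (-(f.eval x) ^ (1 / 2 : ℂ)) *
      starRingEnd ℂ (θ.fn x (-(f.eval x) ^ (1 / 2 : ℂ))))

/-- The real harmonic differential `η = θ + θ̄`, with `θ` holomorphic, is the Poincaré dual of the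
closed curve `γ`, that is, `∮_γ α = ∬_C η ∧ α` for all harmonic differentials `α`. Harmonic
differentials are the sums of holomorphic and antiholomorphic ones, and the condition for `ᾱ` is
the conjugate of the one for `α`, so that it suffices to take `α = ω` holomorphic; then
`∬ η ∧ ω = -∬ ω ∧ θ̄ = 2i · hermPairing ω θ`. -/
def IsPoincareDual (f : ℂ[X]) (γ : Loop) (θ : MerDiff) : Prop :=
  IsHolomorphic f θ ∧
    ∀ ω : MerDiff, IsHolomorphic f ω → γ.period ω = 2 * Complex.I * hermPairing f ω θ

/-- The intersection number `α · β = ∬_C η_α ∧ η_β = ∮_α η_β` of two closed curves on the compact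
Riemann surface of `y² = f(x)` is `k`; here `η_β = θ + θ̄` is the Poincaré dual of `β`. -/
def HasIntersectionNumber (f : ℂ[X]) (α β : Loop) (k : ℤ) : Prop :=
  ∃ θ : MerDiff, IsPoincareDual f β θ ∧ 2 * (α.period θ).re = k

/-- The intersection matrix of the cycles `a_i, b_i` is the standard symplectic matrix. If the
number of indices is the genus, such cycles are a symplectic basis of the homology. -/
def IsSymplectic (f : ℂ[X]) {ι : Type} [DecidableEq ι] (a b : ι → Loop) : Prop :=
  ∀ i k : ι, HasIntersectionNumber f (a i) (a k) 0 ∧ HasIntersectionNumber f (b i) (b k) 0 ∧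
    HasIntersectionNumber f (a i) (b k) (if i = k then 1 else 0)

/-- Two closed curves are homologous if and only if all holomorphic differentials have the same
periods along them. -/
def IsHomologous (f : ℂ[X]) (α β : Loop) : Prop :=
  ∀ ω : MerDiff, IsHolomorphic f ω → α.period ω = β.period ω

/-- The choice of the `2N` cycles `A_j, B_j` on `C_u`. For `Sp(2N)` (genus `2N`), the `4N` cycles
`A_j, -σ₂(A_j), B_j, -σ₂(B_j)` form a symplectic basis. For `SO(2N+1)` (genus `2N - 1`), the
cycles `A_j, -σ₂(A_j), B_j, -σ₂(B_j)` with `j < N`, together with `A_N, B_N`, form a symplectic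
basis, and the homology classes of `A_N` and `B_N` are odd under `σ₂`. -/
def IsPrymBasis (G : GaugeGroup) {N : ℕ} (μ : ℂ) (u : Fin N → ℂ) (A B : Fin N → Loop) : Prop :=
  match G with
  | .SOodd =>
      IsSymplectic (curvePoly .SOodd μ u)
        (Sum.elim A (fun j : {j : Fin N // j.val + 1 < N} => (A j.1).negSigma₂))
        (Sum.elim B (fun j : {j : Fin N // j.val + 1 < N} => (B j.1).negSigma₂)) ∧
      ∀ j : Fin N, j.val + 1 = N →
        IsHomologous (curvePoly .SOodd μ u) (A j).negSigma₂ (A j) ∧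
        IsHomologous (curvePoly .SOodd μ u) (B j).negSigma₂ (B j)
  | .Sp =>
      IsSymplectic (curvePoly .Sp μ u)
        (Sum.elim A (fun j : Fin N => (A j).negSigma₂))
        (Sum.elim B (fun j : Fin N => (B j).negSigma₂))

/-! ### The Whitham deformations -/

/-- `dω_1, …, dω_N` are `σ'`-invariant holomorphic differentials on `C_u`, normalized by
`∮_{A_j} dω_k = δ_{jk}`. -/
def IsNormalizedBasis (G : GaugeGroup) {N : ℕ} (μ : ℂ) (u : Fin N → ℂ) (A : Fin N → Loop)
    (ω : Fin N → MerDiff) : Prop :=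
  ∀ k : Fin N, IsHolomorphic (curvePoly G μ u) (ω k) ∧
    IsSigmaInvariant G (curvePoly G μ u) (ω k) ∧
    ∀ j : Fin N, (A j).period (ω k) = if j = k then 1 else 0

/-- `dΩ_n = dΩ̂_n - ∑_j c_j^{(n)} dω_j` with `c_j^{(n)} = ∮_{A_j} dΩ̂_n`. -/
def dOmega (G : GaugeGroup) {N : ℕ} (μ : ℂ) (u : Fin N → ℂ) (A : Fin N → Loop)
    (ω : Fin N → MerDiff) (n : ℕ) : MerDiff :=
  dOmegaHat G μ u n - ∑ j : Fin N, (A j).period (dOmegaHat G μ u n) • ω j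

/-- The period map `a_j(u, T) = ∮_{A_j} dS`. -/
def periodMap {G : GaugeGroup} {N M : ℕ} {μ : ℂ} {U : Set (Fin N → ℂ)}
    (A : Fin N → CycleFamily G μ U) (u : Fin N → ℂ) (t : Fin M → ℂ) : Fin N → ℂ :=
  fun j => ((A j).at u).period (dS G μ u t)

/-- The function `v = u(a, T)` is a holomorphic inverse of the period map on the open set `Ω`. -/
def IsInversePeriodMap {G : GaugeGroup} {N M : ℕ} {μ : ℂ} {U : Set (Fin N → ℂ)}
    (A : Fin N → CycleFamily G μ U) (Ω : Set ((Fin N → ℂ) × (Fin M → ℂ)))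
    (v : (Fin N → ℂ) × (Fin M → ℂ) → Fin N → ℂ) : Prop :=
  IsOpen Ω ∧ DifferentiableOn ℂ v Ω ∧ ∀ p ∈ Ω, v p ∈ U ∧ periodMap A (v p) p.2 = p.1

end SeibergWitten

end

open Polynomial SeibergWitten

/-!
Write `q(x) = Q(x²)` and `dz/z = h(x) dx/y`, with `h = (x q' - q)/x` for `SO(2N+1)` and
`h = x q' + 2 q` for `Sp(2N)`.

*Variation at constant `z`.* Along the points with a fixed value of `z` the curve equation is a
relation between `q(x)` and `x` alone, so that the implicit function theorem gives the velocity
of `x`, and the variation of `R dz/z` is `P dx/(xy)`, resp. `P dx/y`, with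
`P = R' (x q' + c q) - x (∂R/∂x) e` (`varNum`; `c = -1`, resp. `c = 2`), where `R'` and `e` are
the velocities of `R` and `q` (`hasConstZDeriv`). For `R = R_n`, the full series `W^α` in place of its polynomial part `R_n` would
give zero, because `W` is a function of `z`. Hence only terms of degree less than `2N` survive
(`natDegree_varNum_lt`). As `P` is odd, these are exactly the invariant holomorphic differentials
(`invariant_iff`); they are parametrized by the vectors `w ∈ ℂ^N` through
`P = -x · charDot w`.

*Periods.* The hermitian form `(i/2) ∬ ω ∧ θ̄` is positive definite on the holomorphic
differentials, and the Poincaré duals of the cycles `a_i` of a symplectic basis span a subspace on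
which it is real; therefore they are a basis, and a holomorphic differential without `a`-periods
vanishes (`eq_zero_of_periods`). For an invariant differential the periods along `-σ₂(A_j)` agree
with those along `A_j` up to sign, so that the `N` periods along the `A_j` suffice. This gives
the normalized differentials `dω_j`.

*The period map.* As the projections of the cycles to the `x`-plane are fixed, the periods can be
differentiated under the integral sign at constant `x`, and they are `C¹` in the moduli. The
variations at constant `x` and at constant `z` differ by the differential of a function on the
curve (`variation_identity`), so that the derivative of a period of `dS` is the period of the
variation of `dS` at constant `z` (`hasDerivAt_periodMap`). At `T = (1, 0, …, 0)` we have
`dS = x dz/z`, whose variation in the direction `w` is the invariant differential with coefficient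
vector `w`. So the derivative of the period map is injective there, and the inverse function
theorem applies (`exists_inversePeriodMap`).

*The Whitham equations.* Under an inverse period map, the variation of `dS` along a path
`(a(s), T(s))` is `∑ T'_n dΩ̂_n` plus an invariant holomorphic differential, and its `A`-periods are
`a'(s)` (`IsInversePeriodMap.exists_variation`). Comparison of the `A`-periods identifies it with
`dω_j`, resp. `dΩ_n`.
-/

noncomputable section

open Polynomial Filter Topology MeasureTheory

namespace SeibergWitten

/-! ### Fractional powers of the superpotential -/

/-- `revChar u = 1 - ∑ u_j s^{2j}`, the polynomial `Q(x²)` written in the variable `s = 1/x` and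
divided by its leading power. -/
def revChar {N : ℕ} (u : Fin N → ℂ) : ℂ[X] :=
  1 - ∑ j : Fin N, Polynomial.C (u j) * X ^ (2 * (j.val + 1))

/-- The derivative of `revChar` in the direction `w`. -/
def revCharDot {N : ℕ} (w : Fin N → ℂ) : ℂ[X] :=
  -∑ j : Fin N, Polynomial.C (w j) * X ^ (2 * (j.val + 1))

/-- The derivative of `charPoly` in the direction `w`. -/
def charDot {N : ℕ} (w : Fin N → ℂ) : ℂ[X] :=
  -∑ j : Fin N, Polynomial.C (w j) * X ^ (2 * N - 2 * (j.val + 1))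

/-- The expansion at infinity of `x^{-d} W(x)`, as a power series in `s = 1/x`. -/
def wSeries (G : GaugeGroup) {N : ℕ} (μ : ℂ) (u : Fin N → ℂ) : PowerSeries ℂ :=
  PowerSeries.mk fun i : ℕ => (superpotential G μ u).coeff ((wDegree G N : ℤ) - (i : ℤ))

theorem reflect_revChar {N : ℕ} (u : Fin N → ℂ) : reflect (2 * N) (revChar u) = charPoly u := by
  have hs : ∀ s : Finset (Fin N), reflect (2 * N)
      (∑ j ∈ s, Polynomial.C (u j) * X ^ (2 * (j.val + 1)) : ℂ[X])
      = ∑ j ∈ s, Polynomial.C (u j) * X ^ (2 * N - 2 * (j.val + 1)) := by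
    intro s
    induction s using Finset.cons_induction with
    | empty => simp
    | cons a s ha ih =>
      rw [Finset.sum_cons, Finset.sum_cons, reflect_add, ih, reflect_C_mul_X_pow, revAt_le]
      have := a.2
      lia
  rw [revChar, reflect_sub, hs, reflect_one, charPoly]

theorem reflect_revCharDot {N : ℕ} (w : Fin N → ℂ) :
    reflect (2 * N) (revCharDot w) = charDot w := by
  have hw : revCharDot w = revChar w - 1 := by simp [revChar, revCharDot]
  rw [hw, reflect_sub, reflect_revChar, reflect_one, charPoly, charDot]
  ring

theorem natDegree_revChar_le {N : ℕ} (u : Fin N → ℂ) : (revChar u).natDegree ≤ 2 * N := by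
  refine (natDegree_sub_le _ _).trans (max_le (by simp) ?_)
  refine natDegree_sum_le_of_forall_le _ _ fun j _ => (natDegree_C_mul_X_pow_le _ _).trans ?_
  have := j.2
  lia

theorem natDegree_revCharDot_le {N : ℕ} (w : Fin N → ℂ) :
    (revCharDot w).natDegree ≤ 2 * N := by
  have hw : revCharDot w = revChar w - 1 := by simp [revChar, revCharDot]
  rw [hw]
  exact (natDegree_sub_le _ _).trans (max_le (natDegree_revChar_le w) (by simp))

theorem coeff_C_mul_T (a : ℂ) (k n : ℤ) :
    (LaurentPolynomial.C a * LaurentPolynomial.T k : LaurentPolynomial ℂ).coeff n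
      = if n = k then a else 0 := by
  rw [← LaurentPolynomial.single_eq_C_mul_T, AddMonoidAlgebra.coeff_single, Finsupp.single_apply]
  simp only [eq_comm]

/-- With respect to `s = 1/x`, the expansion of `W` is a polynomial; the term `2μ` of the `Sp(2N)`
superpotential sits at the power `s^{2N+2}`. -/
theorem wSeries_eq (G : GaugeGroup) {N : ℕ} (hN : 1 ≤ N) (μ : ℂ) (u : Fin N → ℂ) :
    wSeries G μ u = (revChar u : PowerSeries ℂ) + match G with
      | .SOodd => 0
      | .Sp => PowerSeries.C (2 * μ) * PowerSeries.X ^ (2 * N + 2) := by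
  have hq : toLaurent (charPoly u) = LaurentPolynomial.C 1 * LaurentPolynomial.T (2 * N : ℕ)
      - ∑ j : Fin N, LaurentPolynomial.C (u j) *
        LaurentPolynomial.T (2 * N - 2 * (j.val + 1) : ℕ) := by
    simp only [charPoly, map_sub, map_sum, map_mul, map_pow, toLaurent_C, toLaurent_X,
      LaurentPolynomial.T_pow, map_one, one_mul]
    simp
  have hc : ∀ (k n : ℤ), (LaurentPolynomial.T k * toLaurent (charPoly u)).coeff n
      = (if n = k + 2 * N then 1 else 0)
        - ∑ j : Fin N, if n = k + 2 * N - 2 * (j.val + 1) then u j else 0 := by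
    intro k n
    rw [hq, mul_sub, Finset.mul_sum]
    have h1 : ∀ (a : ℂ) (m : ℤ), LaurentPolynomial.T k * (LaurentPolynomial.C a *
        LaurentPolynomial.T m) = LaurentPolynomial.C a * LaurentPolynomial.T (k + m) := by
      intro a m
      rw [LaurentPolynomial.T_add]
      ring
    simp only [h1, AddMonoidAlgebra.coeff_sub, AddMonoidAlgebra.coeff_sum, Finsupp.coe_sub,
      Pi.sub_apply, Finsupp.finsetSum_apply, coeff_C_mul_T]
    congr 1
    refine Finset.sum_congr rfl fun j _ => ?_
    · have : ((2 * N - 2 * (j.val + 1) : ℕ) : ℤ) = 2 * N - 2 * (j.val + 1) := by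
        have := j.2
        rw [Nat.cast_sub (by lia)]
        push_cast
        rfl
      rw [this, add_sub_assoc]
  ext i
  have hr : (revChar u).coeff i = (if i = 0 then 1 else 0)
      - ∑ j : Fin N, if i = 2 * (j.val + 1) then u j else 0 := by
    simp only [revChar, coeff_sub, coeff_one, finsetSum_coeff, coeff_C_mul, coeff_X_pow]
    simp
  cases G with
  | SOodd =>
    simp only [wSeries, PowerSeries.coeff_mk, superpotential, hc, add_zero, coeff_coe, hr]
    simp only [wDegree]
    congr 1
    · congr 1
      rw [eq_iff_iff]
      lia
    · refine Finset.sum_congr rfl fun j _ => ?_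
      have := j.2
      congr 1
      rw [eq_iff_iff]
      omega
  | Sp =>
    simp only [wSeries, PowerSeries.coeff_mk, superpotential, AddMonoidAlgebra.coeff_add,
      Finsupp.coe_add, Pi.add_apply, hc, map_add, coeff_coe, hr, PowerSeries.coeff_C_mul,
      PowerSeries.coeff_X_pow, LaurentPolynomial.C_apply]
    simp only [wDegree]
    congr 1
    · congr 1
      · congr 1
        rw [eq_iff_iff]
        lia
      · refine Finset.sum_congr rfl fun j _ => ?_
        congr 1
        rw [eq_iff_iff]
        omega
    · rw [mul_ite, mul_one, mul_zero]
      congr 1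
      rw [eq_iff_iff]
      lia

theorem coeff_zero_wSeries (G : GaugeGroup) {N : ℕ} (hN : 1 ≤ N) (μ : ℂ) (u : Fin N → ℂ) :
    PowerSeries.coeff 0 (wSeries G μ u) = 1 := by
  rw [wSeries_eq G hN]
  cases G <;> simp [revChar, coeff_zero_eq_eval_zero, eval_finsetSum]

/-- A power series is even if its coefficients of odd index vanish. -/
def IsEvenSeries (F : PowerSeries ℂ) : Prop := ∀ i, Odd i → PowerSeries.coeff i F = 0

theorem IsEvenSeries.mul {F H : PowerSeries ℂ} (hF : IsEvenSeries F) (hH : IsEvenSeries H) :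
    IsEvenSeries (F * H) := by
  intro i hi
  rw [PowerSeries.coeff_mul]
  refine Finset.sum_eq_zero fun p hp => ?_
  rw [Finset.HasAntidiagonal.mem_antidiagonal] at hp
  rcases Nat.even_or_odd p.1 with h1 | h1
  · have h2 : Odd p.2 := by
      by_contra h2
      rw [Nat.not_odd_iff_even] at h2
      rw [← hp] at hi
      exact (Nat.not_odd_iff_even.2 (h1.add h2)) hi
    rw [hH _ h2, mul_zero]
  · rw [hF _ h1, zero_mul]

theorem isEvenSeries_one : IsEvenSeries 1 := by
  intro i hi
  rw [PowerSeries.coeff_one, if_neg]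
  rintro rfl
  exact (by decide : ¬ Odd 0) hi

theorem IsEvenSeries.pow {F : PowerSeries ℂ} (hF : IsEvenSeries F) (k : ℕ) :
    IsEvenSeries (F ^ k) := by
  induction k with
  | zero => simpa using isEvenSeries_one
  | succ k ih => rw [pow_succ]; exact ih.mul hF

theorem isEvenSeries_wSeries (G : GaugeGroup) {N : ℕ} (hN : 1 ≤ N) (μ : ℂ) (u : Fin N → ℂ) :
    IsEvenSeries (wSeries G μ u) := by
  intro i hi
  have h0 : i ≠ 0 := by rintro rfl; exact (by decide : ¬ Odd 0) hi
  have h2 : ∀ k, i ≠ 2 * k := by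
    rintro k rfl
    exact Nat.not_odd_iff_even.2 (even_two_mul k) hi
  have h3 : i ≠ 2 * N + 2 := h2 (N + 1)
  have hr : (revChar u).coeff i = 0 := by
    simp only [revChar, coeff_sub, coeff_one, finsetSum_coeff, coeff_C_mul, coeff_X_pow, h2, h0,
      if_false, mul_zero, Finset.sum_const_zero, sub_zero]
  rw [wSeries_eq G hN]
  cases G
  · simp [hr]
  · rw [map_add, coeff_coe, hr, PowerSeries.coeff_C_mul, PowerSeries.coeff_X_pow, if_neg h3]
    simp

/-- The series `x^{-m} W(x)^{m/d}` in `s = 1/x`. -/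
abbrev fracSeries (G : GaugeGroup) {N : ℕ} (μ : ℂ) (u : Fin N → ℂ) (m : ℕ) : PowerSeries ℂ :=
  fracPowSeries (superpotential G μ u) (wDegree G N) m

theorem coeff_zero_pow_of_lt {H : PowerSeries ℂ} (hH : PowerSeries.coeff 0 H = 0) {i k : ℕ}
    (h : i < k) : PowerSeries.coeff i (H ^ k) = 0 := by
  have h1 : PowerSeries.X ∣ H := by
    rw [PowerSeries.X_dvd_iff, ← PowerSeries.coeff_zero_eq_constantCoeff_apply, hH]
  exact PowerSeries.X_pow_dvd_iff.1 (pow_dvd_pow_of_dvd h1 k) i h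

/-- Each coefficient of the substituted binomial series is a finite sum, because
`wSeries - 1` has no constant term. -/
theorem coeff_fracSeries (G : GaugeGroup) {N : ℕ} (hN : 1 ≤ N) (μ : ℂ) (u : Fin N → ℂ)
    (m i : ℕ) : PowerSeries.coeff i (fracSeries G μ u m) = ∑ k ∈ Finset.range (i + 1),
      PowerSeries.coeff k (PowerSeries.binomialSeries ℂ ((m : ℂ) / (wDegree G N : ℂ)))
        * PowerSeries.coeff i ((wSeries G μ u - 1) ^ k) := by
  have h0 : PowerSeries.coeff 0 (wSeries G μ u - 1) = 0 := by
    rw [map_sub, coeff_zero_wSeries G hN]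
    simp
  have hs : PowerSeries.HasSubst (wSeries G μ u - 1) := by
    apply PowerSeries.HasSubst.of_constantCoeff_zero'
    rw [← PowerSeries.coeff_zero_eq_constantCoeff_apply, h0]
  rw [fracSeries, fracPowSeries]
  change PowerSeries.coeff i (PowerSeries.subst (wSeries G μ u - 1) _) = _
  rw [PowerSeries.coeff_subst' hs]
  rw [finsum_eq_sum_of_support_subset (s := Finset.range (i + 1))]
  · simp only [smul_eq_mul]
  · intro k hk
    simp only [Function.mem_support, smul_eq_mul] at hk
    by_contra hk'
    apply hk
    rw [coeff_zero_pow_of_lt h0 (by simpa using hk'), mul_zero]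

theorem isEvenSeries_fracSeries (G : GaugeGroup) {N : ℕ} (hN : 1 ≤ N) (μ : ℂ) (u : Fin N → ℂ)
    (m : ℕ) : IsEvenSeries (fracSeries G μ u m) := by
  intro i hi
  rw [coeff_fracSeries G hN]
  refine Finset.sum_eq_zero fun k _ => ?_
  have h1 : IsEvenSeries (wSeries G μ u - 1) := fun l hl => by
    rw [map_sub, isEvenSeries_wSeries G hN μ u l hl, isEvenSeries_one l hl, sub_zero]
  rw [h1.pow k i hi, mul_zero]

theorem coeff_zero_fracSeries (G : GaugeGroup) {N : ℕ} (hN : 1 ≤ N) (μ : ℂ) (u : Fin N → ℂ)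
    (m : ℕ) : PowerSeries.coeff 0 (fracSeries G μ u m) = 1 := by
  rw [coeff_fracSeries G hN]
  simp [PowerSeries.binomialSeries_coeff]

/-- The polynomial part of `x^m F(1/x)`. -/
def polyPart (F : PowerSeries ℂ) (m : ℕ) : ℂ[X] :=
  ∑ i ∈ Finset.range (m + 1), monomial (m - i) (PowerSeries.coeff i F)

theorem coeff_polyPart (F : PowerSeries ℂ) (m k : ℕ) :
    (polyPart F m).coeff k = if k ≤ m then PowerSeries.coeff (m - k) F else 0 := by
  simp only [polyPart, finsetSum_coeff, coeff_monomial]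
  split_ifs with h
  · rw [Finset.sum_eq_single (m - k)]
    · rw [if_pos (by lia)]
    · intro b hb hbk
      rw [if_neg]
      simp only [Finset.mem_range] at hb
      lia
    · intro hb
      simp only [Finset.mem_range] at hb
      lia
  · refine Finset.sum_eq_zero fun b hb => if_neg ?_
    lia

theorem polyPart_eq_reflect (F : PowerSeries ℂ) (m : ℕ) :
    polyPart F m = reflect m (PowerSeries.trunc (m + 1) F) := by
  ext k
  rw [coeff_polyPart, coeff_reflect, PowerSeries.coeff_trunc]
  split_ifs with h1 h2 h2
  · rw [revAt_le h1]
  · rw [revAt_le h1] at h2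
    lia
  · rw [revAt_eq_self_of_lt (by lia)] at h2
    lia
  · rfl

theorem natDegree_polyPart_le (F : PowerSeries ℂ) (m : ℕ) : (polyPart F m).natDegree ≤ m := by
  rw [natDegree_le_iff_coeff_eq_zero]
  intro k hk
  rw [coeff_polyPart, if_neg (by lia)]

theorem whithamPoly_eq (G : GaugeGroup) {N : ℕ} (μ : ℂ) (u : Fin N → ℂ) (n : ℕ) :
    whithamPoly G μ u n = polyPart (fracSeries G μ u (2 * n - 1)) (2 * n - 1) := rfl

/-- A polynomial is odd if its coefficients of even index vanish. -/
def IsOddPoly (P : ℂ[X]) : Prop := ∀ i, Even i → P.coeff i = 0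

theorem coeff_comp_neg_X (P : ℂ[X]) (i : ℕ) : (P.comp (-X)).coeff i = (-1) ^ i * P.coeff i := by
  induction P using Polynomial.induction_on' with
  | add p q hp hq => simp [hp, hq, mul_add]
  | monomial n a =>
    rw [monomial_comp, neg_pow, mul_comm ((-1 : ℂ[X]) ^ n), ← mul_assoc, coeff_monomial]
    have : (Polynomial.C a * X ^ n * (-1) ^ n : ℂ[X]) = Polynomial.C (a * (-1) ^ n) * X ^ n := by
      simp
      ring
    rw [this, coeff_C_mul_X_pow]
    by_cases h : i = n
    · subst h
      simp [mul_comm]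
    · rw [if_neg h, if_neg (Ne.symm h), mul_zero]

theorem isOddPoly_iff (P : ℂ[X]) : IsOddPoly P ↔ P.comp (-X) = -P := by
  constructor
  · intro h
    ext i
    rw [coeff_comp_neg_X, coeff_neg]
    rcases Nat.even_or_odd i with hi | hi
    · rw [h i hi]
      simp
    · rw [hi.neg_one_pow]
      ring
  · intro h i hi
    have := congrArg (fun p => Polynomial.coeff p i) h
    simp only [coeff_comp_neg_X, coeff_neg, hi.neg_one_pow, one_mul] at this
    linear_combination this / 2

theorem isOddPoly_polyPart {F : PowerSeries ℂ} (hF : IsEvenSeries F) {m : ℕ} (hm : Odd m) :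
    IsOddPoly (polyPart F m) := by
  intro i hi
  rw [coeff_polyPart]
  split_ifs with h
  · exact hF _ (Nat.Odd.sub_even h hm hi)
  · rfl

theorem isOddPoly_whithamPoly (G : GaugeGroup) {N : ℕ} (hN : 1 ≤ N) (μ : ℂ) (u : Fin N → ℂ)
    {n : ℕ} (hn : 1 ≤ n) : IsOddPoly (whithamPoly G μ u n) :=
  isOddPoly_polyPart (isEvenSeries_fracSeries G hN μ u _) ⟨n - 1, by lia⟩

theorem whithamPoly_one (G : GaugeGroup) {N : ℕ} (hN : 1 ≤ N) (μ : ℂ) (u : Fin N → ℂ) :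
    whithamPoly G μ u 1 = X := by
  rw [whithamPoly_eq]
  ext k
  rw [coeff_polyPart, coeff_X]
  rcases k with _ | _ | k
  · simpa using isEvenSeries_fracSeries G hN μ u 1 1 odd_one
  · simpa using coeff_zero_fracSeries G hN μ u 1
  · simp

/-! ### Families of polynomials and of power series -/

/-- The coefficients of the family `F` of power series have derivatives the coefficients
of `F'`. -/
def HasSeriesDerivAt (F : ℂ → PowerSeries ℂ) (F' : PowerSeries ℂ) (s₀ : ℂ) : Prop :=
  ∀ i, HasDerivAt (fun s => PowerSeries.coeff i (F s)) (PowerSeries.coeff i F') s₀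

theorem HasSeriesDerivAt.mul {F H : ℂ → PowerSeries ℂ} {F' H' : PowerSeries ℂ} {s₀ : ℂ}
    (hF : HasSeriesDerivAt F F' s₀) (hH : HasSeriesDerivAt H H' s₀) :
    HasSeriesDerivAt (fun s => F s * H s) (F' * H s₀ + F s₀ * H') s₀ := by
  intro i
  simp only [PowerSeries.coeff_mul, map_add, ← Finset.sum_add_distrib]
  exact HasDerivAt.fun_sum fun p _ => (hF p.1).mul (hH p.2)

theorem HasSeriesDerivAt.pow {F : ℂ → PowerSeries ℂ} {F' : PowerSeries ℂ} {s₀ : ℂ}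
    (hF : HasSeriesDerivAt F F' s₀) (k : ℕ) :
    HasSeriesDerivAt (fun s => F s ^ (k + 1)) ((k + 1 : ℕ) * F s₀ ^ k * F') s₀ := by
  induction k with
  | zero => simpa using hF
  | succ k ih =>
    have := ih.mul hF
    simp only [← pow_succ] at this
    convert this using 1
    push_cast
    ring

theorem HasSeriesDerivAt.unique {F : ℂ → PowerSeries ℂ} {F' F'' : PowerSeries ℂ} {s₀ : ℂ}
    (h : HasSeriesDerivAt F F' s₀) (h' : HasSeriesDerivAt F F'' s₀) : F' = F'' := by
  ext i
  exact (h i).unique (h' i)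

/-- The coefficients of the family `P` of polynomials have derivatives the coefficients of `P'`;
the degrees in the family are bounded. -/
def HasPolyDerivAt (P : ℂ → ℂ[X]) (P' : ℂ[X]) (s₀ : ℂ) : Prop :=
  (∃ K, ∀ s, (P s).natDegree ≤ K) ∧ ∀ i, HasDerivAt (fun s => (P s).coeff i) (P'.coeff i) s₀

/-- A family of polynomials of bounded degree whose coefficients are `C¹`. -/
def IsC1Family {E : Type*} [NormedAddCommGroup E] [NormedSpace ℂ E] (P : E → ℂ[X]) : Prop :=
  (∃ K, ∀ e, (P e).natDegree ≤ K) ∧ ∀ i, ContDiff ℂ 1 (fun e => (P e).coeff i)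

/-! ### Variation of the polynomials `R_n` -/

theorem contDiff_coeff_mul {E : Type*} [NormedAddCommGroup E] [NormedSpace ℂ E]
    {F H : E → PowerSeries ℂ} (hF : ∀ i, ContDiff ℂ 1 (fun e => PowerSeries.coeff i (F e)))
    (hH : ∀ i, ContDiff ℂ 1 (fun e => PowerSeries.coeff i (H e))) (i : ℕ) :
    ContDiff ℂ 1 (fun e => PowerSeries.coeff i (F e * H e)) := by
  simp only [PowerSeries.coeff_mul]
  exact ContDiff.sum fun p _ => (hF p.1).mul (hH p.2)

theorem contDiff_coeff_pow {E : Type*} [NormedAddCommGroup E] [NormedSpace ℂ E]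
    {F : E → PowerSeries ℂ} (hF : ∀ i, ContDiff ℂ 1 (fun e => PowerSeries.coeff i (F e)))
    (k i : ℕ) : ContDiff ℂ 1 (fun e => PowerSeries.coeff i (F e ^ k)) := by
  induction k generalizing i with
  | zero => simpa using contDiff_const
  | succ k ih =>
    simp only [pow_succ]
    exact contDiff_coeff_mul ih hF i

theorem contDiff_coeff_revChar {N : ℕ} (i : ℕ) :
    ContDiff ℂ 1 (fun u : Fin N → ℂ => (revChar u).coeff i) := by
  simp only [revChar, coeff_sub, finsetSum_coeff, coeff_C_mul]
  fun_prop

theorem contDiff_coeff_wSeries (G : GaugeGroup) {N : ℕ} (hN : 1 ≤ N) (μ : ℂ) (i : ℕ) :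
    ContDiff ℂ 1 (fun u : Fin N → ℂ => PowerSeries.coeff i (wSeries G μ u)) := by
  simp only [wSeries_eq G hN, map_add, coeff_coe]
  exact (contDiff_coeff_revChar i).add contDiff_const

theorem contDiff_coeff_fracSeries (G : GaugeGroup) {N : ℕ} (hN : 1 ≤ N) (μ : ℂ) (m i : ℕ) :
    ContDiff ℂ 1 (fun u : Fin N → ℂ => PowerSeries.coeff i (fracSeries G μ u m)) := by
  simp only [coeff_fracSeries G hN]
  refine ContDiff.sum fun k _ => contDiff_const.mul (contDiff_coeff_pow (fun l => ?_) k i)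
  simp only [map_sub]
  exact (contDiff_coeff_wSeries G hN μ l).sub contDiff_const

theorem isC1Family_whithamPoly (G : GaugeGroup) {N : ℕ} (hN : 1 ≤ N) (μ : ℂ) (n : ℕ) :
    IsC1Family (fun u : Fin N → ℂ => whithamPoly G μ u n) := by
  refine ⟨⟨2 * n - 1, fun u => natDegree_polyPart_le _ _⟩, fun i => ?_⟩
  simp only [whithamPoly_eq, coeff_polyPart]
  split_ifs
  · exact contDiff_coeff_fracSeries G hN μ _ _
  · exact contDiff_const

theorem natDegree_charPoly_le {N : ℕ} (u : Fin N → ℂ) : (charPoly u).natDegree ≤ 2 * N := by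
  rw [← reflect_revChar, natDegree_le_iff_coeff_eq_zero]
  intro k hk
  rw [coeff_reflect, revAt_eq_self_of_lt hk]
  exact coeff_eq_zero_of_natDegree_lt ((natDegree_revChar_le u).trans_lt hk)

theorem isC1Family_charPoly {N : ℕ} : IsC1Family (fun u : Fin N → ℂ => charPoly u) := by
  refine ⟨⟨2 * N, natDegree_charPoly_le⟩, fun i => ?_⟩
  simp only [charPoly, coeff_sub, finsetSum_coeff, coeff_C_mul]
  fun_prop

theorem hasDerivAt_comp_apply {N : ℕ} {u : ℂ → Fin N → ℂ} {w : Fin N → ℂ} {s₀ : ℂ}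
    (hu : HasDerivAt u w s₀) (j : Fin N) : HasDerivAt (fun s => u s j) (w j) s₀ :=
  (hasDerivAt_pi.1 hu) j

theorem hasPolyDerivAt_charPoly {N : ℕ} {u : ℂ → Fin N → ℂ} {w : Fin N → ℂ} {s₀ : ℂ}
    (hu : HasDerivAt u w s₀) : HasPolyDerivAt (fun s => charPoly (u s)) (charDot w) s₀ := by
  refine ⟨⟨2 * N, fun s => natDegree_charPoly_le _⟩, fun i => ?_⟩
  simp only [charPoly, charDot, coeff_sub, coeff_neg, finsetSum_coeff, coeff_C_mul]
  exact (HasDerivAt.fun_sum fun j _ => (hasDerivAt_comp_apply hu j).mul_const _).const_sub _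

theorem hasSeriesDerivAt_wSeries (G : GaugeGroup) {N : ℕ} (hN : 1 ≤ N) (μ : ℂ)
    {u : ℂ → Fin N → ℂ} {w : Fin N → ℂ} {s₀ : ℂ} (hu : HasDerivAt u w s₀) :
    HasSeriesDerivAt (fun s => wSeries G μ (u s)) (revCharDot w) s₀ := by
  intro i
  simp only [wSeries_eq G hN, map_add, coeff_coe, revChar, revCharDot, coeff_sub, coeff_neg,
    finsetSum_coeff, coeff_C_mul]
  exact ((HasDerivAt.fun_sum fun j _ =>
    (hasDerivAt_comp_apply hu j).mul_const _).const_sub _).add_const _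

/-- The derivative of `fracSeries` with respect to `u` in the direction `w`. -/
def fracDot (G : GaugeGroup) {N : ℕ} (μ : ℂ) (u : Fin N → ℂ) (m : ℕ) (w : Fin N → ℂ) :
    PowerSeries ℂ :=
  PowerSeries.mk fun i => fderiv ℂ (fun v => PowerSeries.coeff i (fracSeries G μ v m)) u w

/-- The derivative of `R_n` with respect to `u` in the direction `w`. -/
def whithamDot (G : GaugeGroup) {N : ℕ} (μ : ℂ) (u : Fin N → ℂ) (n : ℕ) (w : Fin N → ℂ) : ℂ[X] :=
  polyPart (fracDot G μ u (2 * n - 1) w) (2 * n - 1)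

theorem hasSeriesDerivAt_fracSeries (G : GaugeGroup) {N : ℕ} (hN : 1 ≤ N) (μ : ℂ) (m : ℕ)
    {u : ℂ → Fin N → ℂ} {w : Fin N → ℂ} {s₀ : ℂ} (hu : HasDerivAt u w s₀) :
    HasSeriesDerivAt (fun s => fracSeries G μ (u s) m) (fracDot G μ (u s₀) m w) s₀ := by
  intro i
  rw [fracDot, PowerSeries.coeff_mk]
  exact ((contDiff_coeff_fracSeries G hN μ m i).differentiable one_ne_zero
    (u s₀)).hasFDerivAt.comp_hasDerivAt s₀ hu

theorem hasPolyDerivAt_whithamPoly (G : GaugeGroup) {N : ℕ} (hN : 1 ≤ N) (μ : ℂ) (n : ℕ)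
    {u : ℂ → Fin N → ℂ} {w : Fin N → ℂ} {s₀ : ℂ} (hu : HasDerivAt u w s₀) :
    HasPolyDerivAt (fun s => whithamPoly G μ (u s) n) (whithamDot G μ (u s₀) n w) s₀ := by
  refine ⟨⟨2 * n - 1, fun s => natDegree_polyPart_le _ _⟩, fun i => ?_⟩
  simp only [whithamPoly_eq, whithamDot, coeff_polyPart]
  split_ifs
  · exact hasSeriesDerivAt_fracSeries G hN μ _ hu _
  · exact hasDerivAt_const _ _

theorem isEvenSeries_fracDot (G : GaugeGroup) {N : ℕ} (hN : 1 ≤ N) (μ : ℂ) (u : Fin N → ℂ)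
    (m : ℕ) (w : Fin N → ℂ) : IsEvenSeries (fracDot G μ u m w) := by
  intro i hi
  simp only [fracDot, PowerSeries.coeff_mk, isEvenSeries_fracSeries G hN μ _ m i hi]
  simp

theorem isOddPoly_whithamDot (G : GaugeGroup) {N : ℕ} (hN : 1 ≤ N) (μ : ℂ) (u : Fin N → ℂ)
    {n : ℕ} (hn : 1 ≤ n) (w : Fin N → ℂ) : IsOddPoly (whithamDot G μ u n w) :=
  isOddPoly_polyPart (isEvenSeries_fracDot G hN μ u _ w) ⟨n - 1, by lia⟩

theorem wDegree_pos (G : GaugeGroup) {N : ℕ} (hN : 1 ≤ N) : 0 < wDegree G N := by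
  cases G <;> simp only [wDegree] <;> lia

theorem fracSeries_pow (G : GaugeGroup) {N : ℕ} (hN : 1 ≤ N) (μ : ℂ) (u : Fin N → ℂ) (m : ℕ) :
    fracSeries G μ u m ^ wDegree G N = wSeries G μ u ^ m := by
  refine fracPowSeries_pow _ _ _ (wDegree_pos G hN).ne' ?_
  simpa [wSeries] using coeff_zero_wSeries G hN μ u

theorem wSeries_ne_zero (G : GaugeGroup) {N : ℕ} (hN : 1 ≤ N) (μ : ℂ) (u : Fin N → ℂ) :
    wSeries G μ u ≠ 0 := by
  intro h
  have := coeff_zero_wSeries G hN μ u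
  rw [h] at this
  simp at this

/-- If `F^{d+1} = g^{m+1}`, a common derivation gives `(d+1) g F' = (m+1) F g'`. -/
theorem log_deriv_of_pow_eq {A : Type*} [CommRing A] [IsDomain A] {F g F' g' : A} {d m : ℕ}
    (hg : g ≠ 0) (h : F ^ (d + 1) = g ^ (m + 1))
    (h' : (d + 1 : ℕ) * F ^ d * F' = (m + 1 : ℕ) * g ^ m * g') :
    (d + 1 : ℕ) * g * F' = (m + 1 : ℕ) * F * g' := by
  refine mul_left_cancel₀ (pow_ne_zero (m + 1) hg) ?_
  calc g ^ (m + 1) * ((d + 1 : ℕ) * g * F')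
      = F ^ (d + 1) * ((d + 1 : ℕ) * g * F') := by rw [h]
    _ = F * g * ((d + 1 : ℕ) * F ^ d * F') := by ring
    _ = F * g * ((m + 1 : ℕ) * g ^ m * g') := by rw [h']
    _ = g ^ (m + 1) * ((m + 1 : ℕ) * F * g') := by ring

/-- The identity `W ∂_u W^α = α W^α ∂_u W` in `1/x`-expansion. -/
theorem wSeries_mul_fracDot (G : GaugeGroup) {N : ℕ} (hN : 1 ≤ N) (μ : ℂ) (u : Fin N → ℂ)
    (m : ℕ) (w : Fin N → ℂ) :
    (wDegree G N : PowerSeries ℂ) * wSeries G μ u * fracDot G μ u (m + 1) w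
      = (m + 1 : ℕ) * fracSeries G μ u (m + 1) * (revCharDot w : PowerSeries ℂ) := by
  obtain ⟨d, hd⟩ := Nat.exists_eq_add_of_lt (wDegree_pos G hN)
  rw [zero_add] at hd
  have hu : HasDerivAt (fun s : ℂ => u + s • w) w 0 := by
    simpa using ((hasDerivAt_id (0 : ℂ)).smul_const w).const_add u
  have h1 := (hasSeriesDerivAt_fracSeries G hN μ (m + 1) hu).pow d
  have h2 := (hasSeriesDerivAt_wSeries G hN μ hu).pow m
  simp only [← hd, fracSeries_pow G hN] at h1
  have h3 := h1.unique h2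
  simp only [zero_smul, add_zero, hd] at h3
  have h4 := fracSeries_pow G hN μ u (m + 1)
  rw [hd] at h4 ⊢
  exact log_deriv_of_pow_eq (wSeries_ne_zero G hN μ u) h4 h3

/-- The identity `W ∂_x W^α = α W^α ∂_x W` in `1/x`-expansion. -/
theorem wSeries_mul_derivative (G : GaugeGroup) {N : ℕ} (hN : 1 ≤ N) (μ : ℂ) (u : Fin N → ℂ)
    (m : ℕ) :
    (wDegree G N : PowerSeries ℂ) * wSeries G μ u *
        PowerSeries.derivative ℂ (fracSeries G μ u (m + 1))
      = (m + 1 : ℕ) * fracSeries G μ u (m + 1) * PowerSeries.derivative ℂ (wSeries G μ u) := by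
  obtain ⟨d, hd⟩ := Nat.exists_eq_add_of_lt (wDegree_pos G hN)
  rw [zero_add] at hd
  have h4 := fracSeries_pow G hN μ u (m + 1)
  rw [hd] at h4 ⊢
  refine log_deriv_of_pow_eq (wSeries_ne_zero G hN μ u) h4 ?_
  have := congrArg (PowerSeries.derivative ℂ) h4
  rw [Derivation.leibniz_pow, Derivation.leibniz_pow] at this
  simpa [mul_assoc] using this

/-- The constant `c` with `dz/z = (x q' + c q) dx / (x y)` resp. `(x q' + c q) dx / y`. -/
def wConst : GaugeGroup → ℂ
  | .SOodd => -1
  | .Sp => 2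

/-- The polynomial `x q' + c q`. -/
def wNum (G : GaugeGroup) (q : ℂ[X]) : ℂ[X] := X * derivative q + Polynomial.C (wConst G) * q

theorem wDegree_eq (G : GaugeGroup) {N : ℕ} (hN : 1 ≤ N) :
    (wDegree G N : ℂ) = 2 * N + wConst G := by
  cases G
  · simp only [wDegree, wConst]
    rw [Nat.cast_sub (by lia)]
    push_cast
    ring
  · simp [wDegree, wConst]

/-- The identity `∂_u W^α · ∂_x W = ∂_x W^α · ∂_u W` in `1/x`-expansion. -/
theorem fracDot_mul (G : GaugeGroup) {N : ℕ} (hN : 1 ≤ N) (μ : ℂ) (u : Fin N → ℂ)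
    (m : ℕ) (w : Fin N → ℂ) :
    fracDot G μ u (m + 1) w * ((Polynomial.C (wDegree G N : ℂ) * revChar u
        - X * derivative (revChar u) : ℂ[X]) : PowerSeries ℂ)
      = (PowerSeries.C ((m + 1 : ℕ) : ℂ) * fracSeries G μ u (m + 1) -
          PowerSeries.X * PowerSeries.derivative ℂ (fracSeries G μ u (m + 1))) *
        (revCharDot w : PowerSeries ℂ) := by
  have hg : ((Polynomial.C (wDegree G N : ℂ) * revChar u - X * derivative (revChar u) : ℂ[X]) :
      PowerSeries ℂ) = (wDegree G N : PowerSeries ℂ) * wSeries G μ u -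
        PowerSeries.X * PowerSeries.derivative ℂ (wSeries G μ u) := by
    have hC : ∀ k : ℕ, PowerSeries.C (k : ℂ) = (k : PowerSeries ℂ) := fun k => map_natCast _ k
    rw [wSeries_eq G hN]
    cases G with
    | SOodd =>
      simp only [add_zero, PowerSeries.derivative_coe, Polynomial.coe_sub, Polynomial.coe_mul,
        Polynomial.coe_C, Polynomial.coe_X, hC]
    | Sp =>
      simp only [map_add, Derivation.leibniz, Derivation.leibniz_pow, PowerSeries.derivative_C,
        PowerSeries.derivative_X, PowerSeries.derivative_coe, Polynomial.coe_sub,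
        Polynomial.coe_mul, Polynomial.coe_C, Polynomial.coe_X, wDegree, hC]
      simp
      ring
  have h1 := wSeries_mul_fracDot G hN μ u m w
  have h2 := wSeries_mul_derivative G hN μ u m
  have hd : (wDegree G N : PowerSeries ℂ) * wSeries G μ u ≠ 0 := by
    refine mul_ne_zero ?_ (wSeries_ne_zero G hN μ u)
    rw [← map_natCast PowerSeries.C, Ne, map_eq_zero_iff _ PowerSeries.C_injective]
    exact_mod_cast (wDegree_pos G hN).ne'
  have h3 : fracDot G μ u (m + 1) w * PowerSeries.derivative ℂ (wSeries G μ u)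
      = PowerSeries.derivative ℂ (fracSeries G μ u (m + 1)) * (revCharDot w : PowerSeries ℂ) := by
    refine mul_left_cancel₀ hd ?_
    linear_combination PowerSeries.derivative ℂ (wSeries G μ u) * h1
      - (revCharDot w : PowerSeries ℂ) * h2
  rw [hg]
  have hC : PowerSeries.C ((m + 1 : ℕ) : ℂ) = ((m + 1 : ℕ) : PowerSeries ℂ) := map_natCast _ _
  rw [hC]
  linear_combination h1 - PowerSeries.X * h3

theorem coeff_X_mul_derivative (P : ℂ[X]) (k : ℕ) :
    (X * derivative P).coeff k = k * P.coeff k := by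
  cases k with
  | zero => simp
  | succ k =>
    rw [coeff_X_mul, coeff_derivative]
    push_cast
    ring

theorem powerSeries_coeff_X_mul_derivative (F : PowerSeries ℂ) (k : ℕ) :
    PowerSeries.coeff k (PowerSeries.X * PowerSeries.derivative ℂ F)
      = k * PowerSeries.coeff k F := by
  cases k with
  | zero => simp
  | succ k =>
    rw [PowerSeries.coeff_succ_X_mul, PowerSeries.coeff_derivative]
    push_cast
    ring

theorem X_mul_derivative_polyPart (F : PowerSeries ℂ) (m : ℕ) :
    X * derivative (polyPart F m)
      = polyPart (PowerSeries.C (m : ℂ) * F - PowerSeries.X * PowerSeries.derivative ℂ F) m := by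
  ext k
  rw [coeff_X_mul_derivative, coeff_polyPart, coeff_polyPart]
  split_ifs with h
  · rw [map_sub, PowerSeries.coeff_C_mul, powerSeries_coeff_X_mul_derivative, Nat.cast_sub h]
    ring
  · simp

/-- In the variable `1/x`, the operator `x ∂_x + c` becomes `d - s ∂_s`, with `d` the degree
of `W`. -/
theorem wNum_charPoly (G : GaugeGroup) {N : ℕ} (hN : 1 ≤ N) (u : Fin N → ℂ) :
    wNum G (charPoly u) = reflect (2 * N)
      (Polynomial.C (wDegree G N : ℂ) * revChar u - X * derivative (revChar u)) := by
  ext k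
  rw [wNum, coeff_add, coeff_X_mul_derivative, coeff_C_mul, ← reflect_revChar, coeff_reflect,
    coeff_reflect, coeff_sub, coeff_C_mul, coeff_X_mul_derivative, wDegree_eq G hN]
  rcases le_or_gt k (2 * N) with h | h
  · rw [revAt_le h, Nat.cast_sub h]
    push_cast
    ring
  · rw [revAt_eq_self_of_lt h,
      coeff_eq_zero_of_natDegree_lt ((natDegree_revChar_le u).trans_lt h)]
    ring

/-- If two series `A`, `B` and two polynomials `a`, `b` of degree at most `D` satisfy `A a = B b`,
then the top terms cancel in the same combination of the polynomial parts. -/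
theorem natDegree_polyPart_mul_sub_lt {A B : PowerSeries ℂ} {a b : ℂ[X]} {D : ℕ} (m : ℕ)
    (hD : 0 < D) (ha : a.natDegree ≤ D) (hb : b.natDegree ≤ D)
    (h : A * (a : PowerSeries ℂ) = B * (b : PowerSeries ℂ)) :
    (polyPart A m * reflect D a - polyPart B m * reflect D b).natDegree < D := by
  have htr : ∀ A : PowerSeries ℂ, (PowerSeries.trunc (m + 1) A).natDegree ≤ m := fun A =>
    Nat.lt_succ_iff.1 (PowerSeries.natDegree_trunc_lt A m)
  rw [Nat.lt_iff_le_pred hD, natDegree_le_iff_coeff_eq_zero]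
  intro k hk
  rw [polyPart_eq_reflect, polyPart_eq_reflect, ← reflect_mul _ _ (htr A) ha,
    ← reflect_mul _ _ (htr B) hb, ← reflect_sub, coeff_reflect, coeff_sub]
  rcases le_or_gt k (m + D) with hkm | hkm
  · rw [revAt_le hkm]
    have key : ∀ (A : PowerSeries ℂ) (a : ℂ[X]),
        (PowerSeries.trunc (m + 1) A * a).coeff (m + D - k)
          = PowerSeries.coeff (m + D - k) (A * (a : PowerSeries ℂ)) := by
      intro A a
      rw [← coeff_coe, Polynomial.coe_mul, PowerSeries.coeff_mul, PowerSeries.coeff_mul]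
      refine Finset.sum_congr rfl fun p hp => ?_
      rw [Finset.HasAntidiagonal.mem_antidiagonal] at hp
      rw [PowerSeries.coeff_coe_trunc_of_lt (by lia)]
    rw [key, key, h, sub_self]
  · rw [revAt_eq_self_of_lt hkm]
    have key : ∀ (A : PowerSeries ℂ) (a : ℂ[X]), a.natDegree ≤ D →
        (PowerSeries.trunc (m + 1) A * a).coeff k = 0 := fun A a ha' =>
      coeff_eq_zero_of_natDegree_lt ((natDegree_mul_le.trans
        (add_le_add (htr A) ha')).trans_lt hkm)
    rw [key A a ha, key B b hb, sub_self]

/-- The numerator of the derivative of `R dz/z` at constant `z`, where `R` moves with velocity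
`R'` and `q` moves with velocity `e`. -/
def varNum (G : GaugeGroup) (q R R' e : ℂ[X]) : ℂ[X] := R' * wNum G q - X * derivative R * e

/-- The leading terms of the variation of `dΩ̂_n` at constant `z` cancel, because `R_n` agrees with
a power of `W`, a function of `z`, up to terms that vanish at infinity. -/
theorem natDegree_varNum_lt (G : GaugeGroup) {N : ℕ} (hN : 1 ≤ N) (μ : ℂ) (u : Fin N → ℂ)
    {n : ℕ} (hn : 1 ≤ n) (w : Fin N → ℂ) :
    (varNum G (charPoly u) (whithamPoly G μ u n) (whithamDot G μ u n w) (charDot w)).natDegree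
      < 2 * N := by
  obtain ⟨m, hm⟩ : ∃ m, 2 * n - 1 = m + 1 := ⟨2 * n - 2, by lia⟩
  rw [varNum, whithamDot, whithamPoly_eq, hm, wNum_charPoly G hN, X_mul_derivative_polyPart,
    ← reflect_revCharDot]
  refine natDegree_polyPart_mul_sub_lt (m + 1) (by lia) ?_ (natDegree_revCharDot_le w)
    (fracDot_mul G hN μ u m w)
  refine (natDegree_sub_le _ _).trans (max_le ((natDegree_C_mul_le _ _).trans
    (natDegree_revChar_le u)) ?_)
  rw [natDegree_le_iff_coeff_eq_zero]
  intro k hk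
  rw [coeff_X_mul_derivative,
    coeff_eq_zero_of_natDegree_lt ((natDegree_revChar_le u).trans_lt hk), mul_zero]

/-! ### Holomorphic differentials on a hyperelliptic curve -/

theorem meromorphicAt_eval {X : ℂ → ℂ} (hX : MeromorphicAt X 0) (p : ℂ[X]) :
    MeromorphicAt (fun t => p.eval (X t)) 0 := by
  simp only [eval_eq_sum_range]
  exact MeromorphicAt.fun_sum fun i _ => (MeromorphicAt.const _ _).mul (hX.pow i)

/-- At a pole of `X`, the order of `p(X)` is `deg p` times the order of `X`. -/
theorem order_eval_of_pole {X : ℂ → ℂ} {n : ℤ} (hn : n < 0) (hX : meromorphicOrderAt X 0 = n)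
    {p : ℂ[X]} (hp : p ≠ 0) :
    meromorphicOrderAt (fun t => p.eval (X t)) 0 = ((p.natDegree * n : ℤ) : WithTop ℤ) := by
  have hneg : meromorphicOrderAt X 0 < 0 := by
    rw [hX]
    exact_mod_cast hn
  have hmer : MeromorphicAt X 0 := meromorphicAt_of_meromorphicOrderAt_ne_zero hneg.ne
  have hlim := tendsto_cobounded_of_meromorphicOrderAt_neg hneg
  have hinv : Tendsto (fun t => (X t)⁻¹) (𝓝[≠] 0) (𝓝 0) := tendsto_inv₀_cobounded.comp hlim
  have hne : ∀ᶠ t in 𝓝[≠] (0 : ℂ), X t ≠ 0 := hlim.eventually_ne_cobounded 0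
  have hrev : meromorphicOrderAt (fun t => p.reverse.eval (X t)⁻¹) 0 = 0 := by
    rw [← tendsto_ne_zero_iff_meromorphicOrderAt_eq_zero (meromorphicAt_eval hmer.fun_inv _)]
    refine ⟨p.reverse.eval 0, ?_, (p.reverse.continuous.tendsto 0).comp hinv⟩
    rw [← coeff_zero_eq_eval_zero, coeff_zero_reverse]
    exact leadingCoeff_ne_zero.2 hp
  have hpow : meromorphicOrderAt (fun t => X t ^ p.natDegree) 0
      = ((p.natDegree * n : ℤ) : WithTop ℤ) := by
    rw [fun_meromorphicOrderAt_pow hmer, hX]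
    push_cast
    rfl
  have heq : (fun t => p.eval (X t)) =ᶠ[𝓝[≠] 0]
      fun t => p.reverse.eval (X t)⁻¹ * X t ^ p.natDegree := by
    filter_upwards [hne] with t ht
    let _ := invertibleOfNonzero ht
    have := eval₂_reverse_mul_pow (RingHom.id ℂ) (X t) p
    simpa [eval₂_id] using this.symm
  rw [meromorphicOrderAt_congr heq,
    fun_meromorphicOrderAt_mul (meromorphicAt_eval hmer.fun_inv _) (hmer.fun_pow _), hrev, hpow, zero_add]

theorem order_eval_of_tendsto {X : ℂ → ℂ} (hX : MeromorphicAt X 0) {x₀ : ℂ}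
    (h : Tendsto X (𝓝[≠] 0) (𝓝 x₀)) {p : ℂ[X]} (hp : p.eval x₀ ≠ 0) :
    meromorphicOrderAt (fun t => p.eval (X t)) 0 = 0 := by
  rw [← tendsto_ne_zero_iff_meromorphicOrderAt_eq_zero (meromorphicAt_eval hX _)]
  exact ⟨p.eval x₀, hp, (p.continuous.tendsto x₀).comp h⟩

theorem order_eval_nonneg {X : ℂ → ℂ} (hX : MeromorphicAt X 0) {x₀ : ℂ}
    (h : Tendsto X (𝓝[≠] 0) (𝓝 x₀)) (p : ℂ[X]) :
    0 ≤ meromorphicOrderAt (fun t => p.eval (X t)) 0 := by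
  rw [← tendsto_nhds_iff_meromorphicOrderAt_nonneg (meromorphicAt_eval hX _)]
  exact ⟨p.eval x₀, (p.continuous.tendsto x₀).comp h⟩

/-- A squarefree polynomial has at most a simple zero at any point. -/
theorem exists_simple_factor {f : ℂ[X]} (hf : Squarefree f) (x₀ : ℂ) :
    ∃ (k : ℕ) (f₁ : ℂ[X]), k ≤ 1 ∧ f = (X - Polynomial.C x₀) ^ k * f₁ ∧ f₁.eval x₀ ≠ 0 := by
  by_cases h : f.eval x₀ = 0
  · obtain ⟨f₁, hf₁⟩ := dvd_iff_isRoot.2 h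
    refine ⟨1, f₁, le_rfl, by rw [pow_one, hf₁], fun h1 => ?_⟩
    obtain ⟨f₂, hf₂⟩ := dvd_iff_isRoot.2 h1
    have := hf (X - Polynomial.C x₀) ⟨f₂, by rw [hf₁, hf₂, mul_assoc]⟩
    exact not_isUnit_X_sub_C x₀ this
  · exact ⟨0, f, zero_le_one, by simp, h⟩

/-- The differential `p(x) dx/y`. -/
def polyDiff (p : ℂ[X]) : MerDiff := (0, algebraMap ℂ[X] (RatFunc ℂ) p)

theorem polyDiff_fn (p : ℂ[X]) (x y : ℂ) : (polyDiff p).fn x y = p.eval x / y := by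
  simp [polyDiff, MerDiff.fn, RatFunc.eval_algebraMap, eval₂_id]

/-- The differentials `p(x) dx/y` with `deg p < g` are holomorphic. -/
theorem isHolomorphic_polyDiff {f : ℂ[X]} (hf : Squarefree f) {g : ℕ}
    (hdeg : f.natDegree = 2 * g + 2) {p : ℂ[X]} (hp : p.degree < g) :
    IsHolomorphic f (polyDiff p) := by
  intro X Y hX hY hXY
  have hf0 : f ≠ 0 := hf.ne_zero
  -- the order of `Y` is half the order of `f(X)`
  simp only [polyDiff_fn, div_eq_mul_inv]
  rw [fun_meromorphicOrderAt_mul ((meromorphicAt_eval hX p).fun_mul hY.fun_inv) hX.deriv,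
    fun_meromorphicOrderAt_mul (meromorphicAt_eval hX p) hY.fun_inv, fun_meromorphicOrderAt_inv]
  by_cases hX' : meromorphicOrderAt (deriv X) 0 = ⊤
  · rw [hX', WithTop.add_top]
    exact le_top
  have h2 : ((2 : ℤ) : WithTop ℤ) * meromorphicOrderAt Y 0
      = meromorphicOrderAt (fun t => f.eval (X t)) 0 := by
    have := fun_meromorphicOrderAt_pow hY (n := 2)
    rw [← meromorphicOrderAt_congr hXY, this]
    rfl
  rcases lt_or_ge (meromorphicOrderAt X 0) 0 with hneg | hpos
  · -- where `X` has order `n < 0`, `Y` has order `(g + 1) n`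
    rcases eq_or_ne p 0 with rfl | hp0
    · have : meromorphicOrderAt (fun t => (0 : ℂ[X]).eval (X t)) 0 = ⊤ := by
        rw [meromorphicOrderAt_eq_top_iff]
        simp
      rw [this]
      simp
    obtain ⟨n, hn⟩ := WithTop.ne_top_iff_exists.1 (hneg.trans (WithTop.coe_lt_top 0)).ne
    have hn0 : n < 0 := by
      rw [← hn] at hneg
      exact_mod_cast hneg
    rw [order_eval_of_pole hn0 hn.symm hf0, hdeg] at h2
    have hYt : meromorphicOrderAt Y 0 ≠ ⊤ := by
      intro h
      rw [h, WithTop.mul_top (by simp)] at h2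
      exact WithTop.coe_ne_top h2.symm
    obtain ⟨b, hb⟩ := WithTop.ne_top_iff_exists.1 hYt
    have hnC : (n : ℂ) ≠ 0 := by exact_mod_cast hn0.ne
    rw [order_eval_of_pole hn0 hn.symm hp0, meromorphicOrderAt_deriv_eq_sub_one hnC hn.symm, ← hb]
    rw [← hb] at h2
    have hb2 : 2 * b = ((2 * g + 2 : ℕ) : ℤ) * n := by exact_mod_cast h2
    have hpd : (p.natDegree : ℤ) + 1 ≤ g := by
      rw [degree_eq_natDegree hp0] at hp
      have : p.natDegree < g := by exact_mod_cast hp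
      exact_mod_cast this
    have : 0 ≤ p.natDegree * n + -b + (n - 1) := by
      push_cast at hb2
      nlinarith
    exact_mod_cast this
  · -- at a finite value of `X`, the order of `Y` is at most half the order of `X - x₀`, and
    -- `deriv X` loses only one order
    obtain ⟨x₀, hx₀⟩ := tendsto_nhds_of_meromorphicOrderAt_nonneg hX hpos
    have ha := order_eval_nonneg hX hx₀ p
    have hXs : MeromorphicAt (fun t => X t - x₀) 0 := hX.sub (MeromorphicAt.const _ _)
    have hlim : Tendsto (fun t => X t - x₀) (𝓝[≠] 0) (𝓝 0) := by
      simpa using hx₀.sub_const x₀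
    have hk := (tendsto_zero_iff_meromorphicOrderAt_pos hXs).1 hlim
    have hd : deriv (fun t => X t - x₀) = deriv X := by
      funext t
      exact deriv_sub_const _
    have hkt : meromorphicOrderAt (fun t => X t - x₀) 0 ≠ ⊤ := by
      intro h
      apply hX'
      rw [meromorphicOrderAt_eq_top_iff] at h ⊢
      have h' : (fun t => X t - x₀) =ᶠ[𝓝[≠] 0] fun _ => 0 := h
      have := h'.nhdsNE_deriv
      rw [hd] at this
      filter_upwards [this] with t ht
      simpa using ht
    obtain ⟨n, hn⟩ := WithTop.ne_top_iff_exists.1 hkt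
    have hn0 : 0 < n := by
      rw [← hn] at hk
      exact_mod_cast hk
    have hnC : (n : ℂ) ≠ 0 := by exact_mod_cast hn0.ne'
    have hX1 : meromorphicOrderAt (deriv X) 0 = ((n - 1 : ℤ) : WithTop ℤ) := by
      rw [← hd]
      exact meromorphicOrderAt_deriv_eq_sub_one hnC hn.symm
    obtain ⟨k, f₁, hk1, hfk, hf₁⟩ := exists_simple_factor hf x₀
    have hfo : meromorphicOrderAt (fun t => f.eval (X t)) 0 = ((k * n : ℤ) : WithTop ℤ) := by
      rw [hfk]
      simp only [eval_mul, eval_pow, eval_sub, eval_X, eval_C]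
      rw [fun_meromorphicOrderAt_mul (hXs.fun_pow k) (meromorphicAt_eval hX f₁),
        order_eval_of_tendsto hX hx₀ hf₁, fun_meromorphicOrderAt_pow hXs, ← hn, add_zero]
      push_cast
      rfl
    rw [hfo] at h2
    have hYt : meromorphicOrderAt Y 0 ≠ ⊤ := by
      intro h
      rw [h, WithTop.mul_top (by simp)] at h2
      exact WithTop.coe_ne_top h2.symm
    obtain ⟨b, hb⟩ := WithTop.ne_top_iff_exists.1 hYt
    rw [← hb] at h2 ⊢
    have hb2 : 2 * b = k * n := by exact_mod_cast h2
    have hb3 : b ≤ n - 1 := by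
      interval_cases k
      · simp at hb2
        lia
      · push_cast at hb2
        lia
    rw [hX1, add_assoc]
    refine add_nonneg ha ?_
    have : 0 ≤ -b + (n - 1) := by lia
    exact_mod_cast this

theorem exists_analytic_sqrt {h : ℂ → ℂ} (hh : AnalyticAt ℂ h 0) (h0 : h 0 ≠ 0) :
    ∃ S : ℂ → ℂ, AnalyticAt ℂ S 0 ∧ S 0 ≠ 0 ∧ ∀ t, S t ^ 2 = h t := by
  obtain ⟨c, hc⟩ := IsAlgClosed.exists_pow_nat_eq (h 0) (n := 2) two_pos
  have hc0 : c ≠ 0 := by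
    rintro rfl
    simp at hc
    exact h0 hc.symm
  refine ⟨fun t => c * (h t / h 0) ^ ((2 : ℕ) : ℂ)⁻¹, ?_, ?_, fun t => ?_⟩
  · refine analyticAt_const.mul ((hh.div analyticAt_const h0).cpow analyticAt_const ?_)
    simp [h0]
  · simpa [h0] using hc0
  · rw [mul_pow, Complex.cpow_nat_inv_pow _ two_ne_zero, hc]
    field_simp

theorem order_of_analytic_ne_zero {S : ℂ → ℂ} (hS : AnalyticAt ℂ S 0) (h0 : S 0 ≠ 0) :
    meromorphicOrderAt S 0 = 0 := by
  rw [← tendsto_ne_zero_iff_meromorphicOrderAt_eq_zero hS.meromorphicAt]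
  exact ⟨S 0, h0, hS.continuousAt.tendsto.mono_left nhdsWithin_le_nhds⟩

theorem meromorphicOrderAt_const_ne_zero {c : ℂ} (hc : c ≠ 0) :
    meromorphicOrderAt (fun _ : ℂ => c) 0 = 0 :=
  order_of_analytic_ne_zero analyticAt_const hc

/-- The hyperelliptic involution splits a holomorphic differential into the parts `a(x) dx` and
`b(x) dx/y`. -/
theorem IsHolomorphic.order_split {f : ℂ[X]} {ω : MerDiff} (h : IsHolomorphic f ω)
    {X Y : ℂ → ℂ} (hX : MeromorphicAt X 0) (hY : MeromorphicAt Y 0)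
    (hXY : ∀ᶠ t in 𝓝[≠] (0 : ℂ), Y t ^ 2 = f.eval (X t)) :
    0 ≤ meromorphicOrderAt (fun t => ω.1.eval (RingHom.id ℂ) (X t) * deriv X t) 0 ∧
    0 ≤ meromorphicOrderAt (fun t => ω.2.eval (RingHom.id ℂ) (X t) * (Y t)⁻¹ * deriv X t) 0 := by
  have hr : ∀ r : RatFunc ℂ, MeromorphicAt (fun t => r.eval (RingHom.id ℂ) (X t)) 0 := by
    intro r
    simp only [RatFunc.eval, eval₂_id]
    exact (meromorphicAt_eval hX _).div (meromorphicAt_eval hX _)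
  have h1 := h X Y hX hY hXY
  have h2 := h X (-Y) hX hY.neg (by simpa using hXY)
  have hm1 : MeromorphicAt (fun t => ω.fn (X t) (Y t) * deriv X t) 0 :=
    ((hr _).add ((hr _).div hY)).mul hX.deriv
  have hm2 : MeromorphicAt (fun t => ω.fn (X t) ((-Y) t) * deriv X t) 0 :=
    ((hr _).add ((hr _).div hY.neg)).mul hX.deriv
  constructor
  -- `a dx` is half the sum, `b dx/y` half the difference of the pull-backs along `(X, ±Y)`
  · have h3 : 0 ≤ meromorphicOrderAt (fun t => (2 : ℂ)⁻¹ * ((fun t => ω.fn (X t) (Y t) * deriv X t)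
        + fun t => ω.fn (X t) ((-Y) t) * deriv X t) t) 0 := by
      rw [fun_meromorphicOrderAt_mul (MeromorphicAt.const _ _) (hm1.add hm2),
        meromorphicOrderAt_const_ne_zero (by norm_num), zero_add]
      exact (le_min h1 h2).trans (meromorphicOrderAt_add hm1 hm2)
    convert h3 using 2
    funext t
    simp only [MerDiff.fn, Pi.add_apply, Pi.neg_apply, div_neg]
    ring
  · have h3 : 0 ≤ meromorphicOrderAt (fun t => (2 : ℂ)⁻¹ * ((fun t => ω.fn (X t) (Y t) * deriv X t)
        + -fun t => ω.fn (X t) ((-Y) t) * deriv X t) t) 0 := by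
      rw [fun_meromorphicOrderAt_mul (MeromorphicAt.const _ _) (hm1.add hm2.neg),
        meromorphicOrderAt_const_ne_zero (by norm_num), zero_add]
      exact (le_min h1 (h2.trans_eq meromorphicOrderAt_neg)).trans
        (meromorphicOrderAt_add hm1 hm2.neg)
    convert h3 using 2
    funext t
    simp only [MerDiff.fn, Pi.add_apply, Pi.neg_apply, div_neg]
    ring

theorem meromorphicAt_pow_zero (k : ℕ) : MeromorphicAt (fun t : ℂ => t ^ k) 0 :=
  (MeromorphicAt.id (0 : ℂ)).fun_pow k

theorem meromorphicOrderAt_id_pow (k : ℕ) :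
    meromorphicOrderAt (fun t : ℂ => t ^ k) 0 = ((k : ℤ) : WithTop ℤ) := by
  have := fun_meromorphicOrderAt_pow (MeromorphicAt.id (0 : ℂ)) (n := k)
  rw [meromorphicOrderAt_id, mul_one] at this
  exact this

/-- If `x₀` is a pole of the rational function `r`, then `r(x₀ + t²) · 2t` has a pole. -/
theorem order_ratFunc_neg {r : RatFunc ℂ} {x₀ : ℂ} (h : r.denom.eval x₀ = 0) :
    meromorphicOrderAt (fun t : ℂ => r.eval (RingHom.id ℂ) (x₀ + t ^ 2)
      * deriv (fun t : ℂ => x₀ + t ^ 2) t) 0 < 0 := by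
  have hXa : AnalyticAt ℂ (fun t : ℂ => x₀ + t ^ 2) 0 := by fun_prop
  have hX := hXa.meromorphicAt
  have hlim : Tendsto (fun t : ℂ => x₀ + t ^ 2) (𝓝[≠] 0) (𝓝 x₀) := by
    have := hXa.continuousAt.tendsto.mono_left (nhdsWithin_le_nhds (s := {0}ᶜ))
    simpa using this
  obtain ⟨d, hd⟩ := dvd_iff_isRoot.2 h
  have hnum : r.num.eval x₀ ≠ 0 := by
    intro h0
    obtain ⟨a, b, hab⟩ := RatFunc.isCoprime_num_denom r
    have := congrArg (Polynomial.eval x₀) hab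
    simp [h, h0] at this
  have hder : deriv (fun t : ℂ => x₀ + t ^ 2) = fun t => 2 * t ^ 1 := by
    funext t
    simp
  have hderord : meromorphicOrderAt (fun t : ℂ => 2 * t ^ 1) 0 = ((1 : ℤ) : WithTop ℤ) := by
    rw [fun_meromorphicOrderAt_mul (MeromorphicAt.const _ _) (meromorphicAt_pow_zero 1),
      meromorphicOrderAt_const_ne_zero two_ne_zero, zero_add]
    exact meromorphicOrderAt_id_pow 1
  have hden : meromorphicOrderAt (fun t : ℂ => r.denom.eval (x₀ + t ^ 2)) 0
      = ((2 : ℤ) : WithTop ℤ) + meromorphicOrderAt (fun t : ℂ => d.eval (x₀ + t ^ 2)) 0 := by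
    rw [hd]
    simp only [eval_mul, eval_sub, eval_X, eval_C, add_sub_cancel_left]
    rw [fun_meromorphicOrderAt_mul (meromorphicAt_pow_zero 2) (meromorphicAt_eval hX d)]
    congr 1
    exact meromorphicOrderAt_id_pow 2
  have hd0 := order_eval_nonneg hX hlim d
  have hdt : meromorphicOrderAt (fun t : ℂ => d.eval (x₀ + t ^ 2)) 0 ≠ ⊤ := by
    intro htop
    rw [meromorphicOrderAt_eq_top_iff] at htop
    have hroots : ∀ᶠ t : ℂ in 𝓝[≠] 0, t ∈ ((d.comp (Polynomial.C x₀ + X ^ 2)).roots.toFinset :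
        Set ℂ) := by
      have hne : d.comp (Polynomial.C x₀ + X ^ 2) ≠ 0 := by
        intro h0
        rw [comp_eq_zero_iff] at h0
        rcases h0 with h0 | ⟨_, h0⟩
        · rw [h0, mul_zero] at hd
          exact RatFunc.denom_ne_zero r hd
        · have := congrArg natDegree h0
          rw [add_comm, natDegree_X_pow_add_C, natDegree_C] at this
          exact two_ne_zero this
      filter_upwards [htop] with t ht
      simp only [Finset.mem_coe, Multiset.mem_toFinset, mem_roots hne, IsRoot.def, eval_comp,
        eval_add, eval_C, eval_pow, eval_X]
      exact ht
    have hcompl : ∀ᶠ t : ℂ in 𝓝[≠] 0,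
        t ∉ ((d.comp (Polynomial.C x₀ + X ^ 2)).roots.toFinset : Set ℂ) :=
      nhdsNE_le_cofinite 0 (Finset.finite_toSet _).compl_mem_cofinite
    obtain ⟨t, h1, h2⟩ := (hroots.and hcompl).exists
    exact h2 h1
  obtain ⟨n, hn⟩ := WithTop.ne_top_iff_exists.1 hdt
  rw [hder]
  simp only [RatFunc.eval, eval₂_id, div_eq_mul_inv]
  rw [fun_meromorphicOrderAt_mul ((meromorphicAt_eval hX _).fun_mul (meromorphicAt_eval hX _).fun_inv)
    ((MeromorphicAt.const _ _).fun_mul (meromorphicAt_pow_zero 1)), hderord,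
    fun_meromorphicOrderAt_mul (meromorphicAt_eval hX _) (meromorphicAt_eval hX _).fun_inv,
    fun_meromorphicOrderAt_inv, order_eval_of_tendsto hX hlim hnum, hden, ← hn, zero_add]
  rw [← hn] at hd0
  have hn0 : 0 ≤ n := by exact_mod_cast hd0
  have : -(2 + n) + 1 < 0 := by lia
  exact_mod_cast this

/-- A rational function without poles is a polynomial. -/
theorem eq_algebraMap_num {r : RatFunc ℂ} (h : ∀ x, r.denom.eval x ≠ 0) :
    r = algebraMap ℂ[X] (RatFunc ℂ) r.num := by
  have h1 : r.denom = 1 := by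
    refine eq_one_of_monic_natDegree_zero (RatFunc.monic_denom r) ?_
    by_contra hne
    obtain ⟨x, hx⟩ := IsAlgClosed.exists_root r.denom
      (fun h0 => hne (natDegree_eq_of_degree_eq_some h0))
    exact h x hx
  conv_lhs => rw [← RatFunc.num_div_denom r, h1, map_one, div_one]

/-- Every holomorphic differential on the curve `y² = f(x)` of genus `g` is `p(x) dx/y` with
`deg p < g`. The pole orders are tested along `x = x₀ + t²` and `x = 1/t`. -/
theorem IsHolomorphic.exists_eq {f : ℂ[X]} (hf : Squarefree f) {g : ℕ}
    (hdeg : f.natDegree = 2 * g + 2) {ω : MerDiff} (h : IsHolomorphic f ω) :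
    ∃ p : ℂ[X], p.degree < g ∧ ω = polyDiff p := by
  have hf0 : f ≠ 0 := hf.ne_zero
  have hfin : ∀ x₀ : ℂ, ω.1.denom.eval x₀ ≠ 0 ∧ ω.2.denom.eval x₀ ≠ 0 := by
    intro x₀
    -- `x = x₀ + t²`, `y = t^k S(t)` is a map to the curve whether or not `x₀` is a branch point
    have hXa : AnalyticAt ℂ (fun t : ℂ => x₀ + t ^ 2) 0 := by fun_prop
    obtain ⟨k, f₁, -, hfk, hf₁⟩ := exists_simple_factor hf x₀
    obtain ⟨S, hS, hS0, hS2⟩ := exists_analytic_sqrt (h := fun t => f₁.eval (x₀ + t ^ 2))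
      (by simpa using hXa.aeval_polynomial f₁) (by simpa using hf₁)
    have hYa : AnalyticAt ℂ (fun t => t ^ k * S t) 0 := (analyticAt_id.pow k).mul hS
    have hs := h.order_split hXa.meromorphicAt hYa.meromorphicAt (Eventually.of_forall fun t => by
      rw [mul_pow, hS2, hfk]
      simp only [eval_mul, eval_pow, eval_sub, eval_X, eval_C, add_sub_cancel_left]
      ring)
    refine ⟨fun h0 => (order_ratFunc_neg h0).not_ge hs.1, fun h0 => ?_⟩
    refine (order_ratFunc_neg h0).not_ge ?_
    have hr : MeromorphicAt (fun t : ℂ => ω.2.eval (RingHom.id ℂ) (x₀ + t ^ 2)) 0 := by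
      simp only [RatFunc.eval, eval₂_id]
      exact (meromorphicAt_eval hXa.meromorphicAt _).div (meromorphicAt_eval hXa.meromorphicAt _)
    have h1 := hs.2
    have heq : (fun t : ℂ => ω.2.eval (RingHom.id ℂ) (x₀ + t ^ 2)
        * deriv (fun t : ℂ => x₀ + t ^ 2) t) =ᶠ[𝓝[≠] 0]
        fun t => (t ^ k * S t) * (ω.2.eval (RingHom.id ℂ) (x₀ + t ^ 2) * (t ^ k * S t)⁻¹
        * deriv (fun t : ℂ => x₀ + t ^ 2) t) := by
      have hSne : ∀ᶠ t in 𝓝[≠] (0 : ℂ), S t ≠ 0 :=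
        nhdsWithin_le_nhds (hS.continuousAt.eventually_ne hS0)
      filter_upwards [hSne, self_mem_nhdsWithin] with t ht ht0
      have h3 : t ^ k * S t ≠ 0 := mul_ne_zero (pow_ne_zero _ ht0) ht
      rw [mul_assoc _ (t ^ k * S t)⁻¹, mul_left_comm, mul_inv_cancel_left₀ h3]
    rw [meromorphicOrderAt_congr heq, fun_meromorphicOrderAt_mul hYa.meromorphicAt
      ((hr.fun_mul hYa.meromorphicAt.fun_inv).fun_mul hXa.meromorphicAt.deriv)]
    exact add_nonneg hYa.meromorphicOrderAt_nonneg h1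
  have e1 := eq_algebraMap_num fun x => (hfin x).1
  have e2 := eq_algebraMap_num fun x => (hfin x).2
  -- the chart `x = 1/t` at infinity
  have hX : MeromorphicAt (fun t : ℂ => t⁻¹) 0 := (MeromorphicAt.id _).inv
  have hXo : meromorphicOrderAt (fun t : ℂ => t⁻¹) 0 = ((-1 : ℤ) : WithTop ℤ) := by
    rw [fun_meromorphicOrderAt_inv]
    have h1 : meromorphicOrderAt (fun t : ℂ => t) 0 = 1 := meromorphicOrderAt_id
    rw [h1]
    rfl
  have hX' : meromorphicOrderAt (deriv fun t : ℂ => t⁻¹) 0 = ((-2 : ℤ) : WithTop ℤ) :=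
    meromorphicOrderAt_deriv_eq_sub_one (by norm_num) hXo
  obtain ⟨S, hS, hS0, hS2⟩ := exists_analytic_sqrt (h := fun t => f.reverse.eval t)
    (by simpa using (analyticAt_id (𝕜 := ℂ) (z := (0 : ℂ))).aeval_polynomial f.reverse) (by
      rw [← coeff_zero_eq_eval_zero, coeff_zero_reverse]
      exact leadingCoeff_ne_zero.2 hf0)
  have hY : MeromorphicAt (fun t : ℂ => (t ^ (g + 1))⁻¹ * S t) 0 :=
    (meromorphicAt_pow_zero (g + 1)).fun_inv.mul hS.meromorphicAt
  have hYo : meromorphicOrderAt (fun t : ℂ => (t ^ (g + 1))⁻¹ * S t) 0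
      = ((-(g + 1) : ℤ) : WithTop ℤ) := by
    rw [fun_meromorphicOrderAt_mul (meromorphicAt_pow_zero (g + 1)).fun_inv hS.meromorphicAt,
      fun_meromorphicOrderAt_inv, order_of_analytic_ne_zero hS hS0, add_zero]
    have := meromorphicOrderAt_id_pow (g + 1)
    rw [this]
    push_cast
    rfl
  have hs := h.order_split hX hY (by
    filter_upwards [self_mem_nhdsWithin] with t ht
    have ht : t ≠ 0 := ht
    let _ := invertibleOfNonzero (inv_ne_zero ht)
    have := eval₂_reverse_mul_pow (RingHom.id ℂ) t⁻¹ f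
    simp only [invOf_eq_inv, inv_inv, eval₂_id, hdeg] at this
    rw [mul_pow, hS2, ← this, inv_pow, ← pow_mul, inv_pow, mul_comm]
    ring_nf)
  have hn1 : ω.1.num = 0 := by
    by_contra hne
    have h1 := hs.1
    rw [e1] at h1
    simp only [RatFunc.eval_algebraMap, eval₂_id, Algebra.algebraMap_self, RingHom.id_apply] at h1
    rw [fun_meromorphicOrderAt_mul (meromorphicAt_eval hX _) hX.deriv,
      order_eval_of_pole (by norm_num) hXo hne, hX'] at h1
    have h2 : (0 : ℤ) ≤ ω.1.num.natDegree * (-1) + (-2) := by exact_mod_cast h1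
    lia
  refine ⟨ω.2.num, ?_, ?_⟩
  · rcases eq_or_ne ω.2.num 0 with h0 | hne
    · rw [h0, degree_zero]
      exact WithBot.bot_lt_coe _
    have h1 := hs.2
    rw [e2] at h1
    simp only [RatFunc.eval_algebraMap, eval₂_id, Algebra.algebraMap_self, RingHom.id_apply] at h1
    rw [fun_meromorphicOrderAt_mul ((meromorphicAt_eval hX _).fun_mul hY.fun_inv) hX.deriv,
      fun_meromorphicOrderAt_mul (meromorphicAt_eval hX _) hY.fun_inv, fun_meromorphicOrderAt_inv,
      order_eval_of_pole (by norm_num) hXo hne, hX', hYo] at h1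
    have h2 : (0 : ℤ) ≤ ω.2.num.natDegree * (-1) + -(-(g + 1)) + (-2) := by exact_mod_cast h1
    rw [degree_eq_natDegree hne]
    have : ω.2.num.natDegree < g := by lia
    exact_mod_cast this
  · rw [hn1, map_zero] at e1
    exact Prod.ext e1 e2

/-! ### The hermitian form on the holomorphic differentials -/

theorem hermPairing_polyDiff (f p r : ℂ[X]) :
    hermPairing f (polyDiff p) (polyDiff r)
      = ∫ x : ℂ, 2 * (p.eval x * starRingEnd ℂ (r.eval x) / (‖f.eval x‖ : ℂ)) := by
  refine integral_congr_ae (Eventually.of_forall fun x => ?_)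
  have hy : ∀ y : ℂ, y ^ 2 = f.eval x → p.eval x / y * starRingEnd ℂ (r.eval x / y)
      = p.eval x * starRingEnd ℂ (r.eval x) / (‖f.eval x‖ : ℂ) := by
    intro y hy
    rw [← hy, norm_pow, Complex.ofReal_pow, ← Complex.mul_conj', map_div₀]
    rcases eq_or_ne y 0 with rfl | h0
    · simp
    · have : starRingEnd ℂ y ≠ 0 := by simpa using h0
      field_simp
  have hs : ((f.eval x) ^ (1 / 2 : ℂ)) ^ 2 = f.eval x := by
    have := Complex.cpow_nat_inv_pow (f.eval x) two_ne_zero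
    simp only [one_div]
    exact_mod_cast this
  simp only [polyDiff_fn]
  rw [hy _ hs, hy (-(f.eval x) ^ (1 / 2 : ℂ)) (by rw [neg_sq, hs])]
  ring

theorem integrableAtFilter_inv_norm_sub (x₀ : ℂ) :
    IntegrableAtFilter (fun x : ℂ => ‖x - x₀‖⁻¹) (𝓝 x₀) := by
  have h0 : Integrable (fun x : ℂ => Set.indicator (Set.Iio (1 : ℝ)) (fun y => y⁻¹) ‖x‖) := by
    rw [integrable_fun_norm_addHaar (μ := (volume : Measure ℂ))
      (f := Set.indicator (Set.Iio (1 : ℝ)) (fun y => y⁻¹))]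
    have h1 : IntegrableOn (fun _ : ℝ => (1 : ℝ)) (Set.Ioo 0 1) := by
      simp
    have h2 : IntegrableOn (Set.indicator (Set.Ioo (0 : ℝ) 1) fun _ : ℝ => (1 : ℝ))
        (Set.Ioi 0) := (h1.integrable_indicator measurableSet_Ioo).integrableOn
    refine h2.congr_fun (fun y hy => ?_) measurableSet_Ioi
    have hy : 0 < y := hy
    by_cases h : y < 1
    · rw [Set.indicator_of_mem (show y ∈ Set.Ioo 0 1 from ⟨hy, h⟩)]
      simp only [Complex.finrank_real_complex, smul_eq_mul]
      rw [Set.indicator_of_mem (show y ∈ Set.Iio 1 from h)]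
      simp [hy.ne']
    · rw [Set.indicator_of_notMem (fun hm => h hm.2)]
      simp only [smul_eq_mul]
      rw [Set.indicator_of_notMem (show y ∉ Set.Iio 1 from h), mul_zero]
  have h1 := h0.comp_sub_right x₀
  refine ⟨Metric.ball x₀ 1, Metric.ball_mem_nhds _ one_pos, ?_⟩
  refine h1.integrableOn.congr_fun (fun x hx => ?_) measurableSet_ball
  rw [Metric.mem_ball, dist_eq_norm] at hx
  simp only
  rw [Set.indicator_of_mem (show ‖x - x₀‖ ∈ Set.Iio 1 from hx)]

/-- The area form of two holomorphic differentials is integrable: at the branch points the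
integrand is `O(1/|x - x₀|)`, at infinity `O(|x|⁻⁴)`. -/
theorem integrable_herm {f : ℂ[X]} (hf : Squarefree f) {g : ℕ} (hdeg : f.natDegree = 2 * g + 2)
    {p r : ℂ[X]} (hp : p.degree < g) (hr : r.degree < g) :
    Integrable (fun x : ℂ => p.eval x * starRingEnd ℂ (r.eval x) / (‖f.eval x‖ : ℂ)) := by
  have hmeas : Measurable
      (fun x : ℂ => p.eval x * starRingEnd ℂ (r.eval x) / (‖f.eval x‖ : ℂ)) := by
    refine Measurable.div ?_ ?_
    · exact (p.continuous.mul (Complex.continuous_conj.comp r.continuous)).measurable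
    · exact (Complex.continuous_ofReal.comp (continuous_norm.comp f.continuous)).measurable
  have hloc : LocallyIntegrable
      (fun x : ℂ => p.eval x * starRingEnd ℂ (r.eval x) / (‖f.eval x‖ : ℂ)) := by
    intro x₀
    obtain ⟨k, f₁, hk, hfk, hf₁⟩ := exists_simple_factor hf x₀
    refine Asymptotics.IsBigO.integrableAtFilter (g := fun x : ℂ => ‖x - x₀‖⁻¹ + 1) ?_
      hmeas.aestronglyMeasurable.stronglyMeasurableAtFilter
      ((integrableAtFilter_inv_norm_sub x₀).add
        ((continuous_const (y := (1 : ℝ))).locallyIntegrable x₀))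
    have h1 : (fun x : ℂ => p.eval x * starRingEnd ℂ (r.eval x) / (‖f₁.eval x‖ : ℂ))
        =O[𝓝 x₀] (fun _ => (1 : ℝ)) := by
      refine Tendsto.isBigO_one (F := ℝ) (f' := fun x : ℂ => p.eval x *
        starRingEnd ℂ (r.eval x) / (‖f₁.eval x‖ : ℂ)) (ContinuousAt.tendsto ?_)
      refine ContinuousAt.div ?_ ?_ (by simpa using hf₁)
      · exact (p.continuous.mul (Complex.continuous_conj.comp r.continuous)).continuousAt
      · exact (Complex.continuous_ofReal.comp (continuous_norm.comp f₁.continuous)).continuousAt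
    have h2 : (fun x : ℂ => ((‖x - x₀‖ : ℂ) ^ k)⁻¹) =O[𝓝 x₀] (fun x : ℂ => ‖x - x₀‖⁻¹ + 1) := by
      refine Asymptotics.IsBigO.of_bound 1 (Eventually.of_forall fun x => ?_)
      have h0 : 0 ≤ ‖x - x₀‖⁻¹ := by positivity
      rw [one_mul, Real.norm_of_nonneg (by positivity), norm_inv, norm_pow, Complex.norm_real,
        norm_norm]
      interval_cases k
      · simp
      · simp
    have h3 := h1.mul h2
    simp only [one_mul] at h3
    refine h3.congr_left fun x => ?_
    rw [hfk]
    simp only [eval_mul, eval_pow, eval_sub, eval_X, eval_C, norm_mul, norm_pow, Complex.ofReal_mul,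
      Complex.ofReal_pow]
    rw [mul_comm ((‖x - x₀‖ : ℂ) ^ k), ← div_div, div_eq_mul_inv _ ((‖x - x₀‖ : ℂ) ^ k)]
  refine hloc.integrable_of_isBigO_cocompact (g := fun x : ℂ => (1 + ‖x‖) ^ (-4 : ℝ)) ?_
    ((integrable_one_add_norm (by rw [Complex.finrank_real_complex]; norm_num)).integrableAtFilter
      _)
  rw [← Metric.cobounded_eq_cocompact]
  have hdegle : (p * r * X ^ 4).degree ≤ f.degree := by
    rcases eq_or_ne p 0 with rfl | hp0
    · simp
    rcases eq_or_ne r 0 with rfl | hr0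
    · simp
    rw [degree_eq_natDegree hf.ne_zero, hdeg, degree_mul, degree_mul, degree_X_pow,
      degree_eq_natDegree hp0, degree_eq_natDegree hr0]
    rw [degree_eq_natDegree hp0] at hp
    rw [degree_eq_natDegree hr0] at hr
    have hp' : p.natDegree < g := by exact_mod_cast hp
    have hr' : r.natDegree < g := by exact_mod_cast hr
    have : p.natDegree + r.natDegree + 4 ≤ 2 * g + 2 := by lia
    exact_mod_cast this
  obtain ⟨C, hC0, hC⟩ := (isBigO_cobounded_of_degree_le hdegle).exists_nonneg
  replace hC := hC.bound
  refine Asymptotics.IsBigO.of_bound (C * 2 ^ 4) ?_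
  have hbig : ∀ᶠ x : ℂ in Bornology.cobounded ℂ, 1 ≤ ‖x‖ :=
    tendsto_norm_cobounded_atTop.eventually_ge_atTop 1
  filter_upwards [hC, hbig] with x hx hx1
  have hx0 : 0 < ‖x‖ := by linarith
  rw [norm_div, norm_mul, RCLike.norm_conj, Complex.norm_real, norm_norm,
    Real.norm_of_nonneg (by positivity), Real.rpow_neg (by positivity)]
  have hr4 : (1 + ‖x‖) ^ (4 : ℝ) = (1 + ‖x‖) ^ 4 := by
    exact_mod_cast Real.rpow_natCast (1 + ‖x‖) 4
  rw [hr4]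
  simp only [eval_mul, eval_pow, eval_X, norm_mul, norm_pow] at hx
  have h4 : (1 + ‖x‖) ^ 4 ≤ 2 ^ 4 * ‖x‖ ^ 4 := by
    rw [← mul_pow]
    exact pow_le_pow_left₀ (by positivity) (by linarith) 4
  rcases eq_or_lt_of_le (norm_nonneg (f.eval x)) with h0 | h0
  · rw [← h0, div_zero]
    positivity
  · rw [div_le_iff₀ h0, ← div_eq_mul_inv, div_mul_eq_mul_div, le_div_iff₀ (by positivity)]
    calc ‖p.eval x‖ * ‖r.eval x‖ * (1 + ‖x‖) ^ 4
        ≤ ‖p.eval x‖ * ‖r.eval x‖ * (2 ^ 4 * ‖x‖ ^ 4) := by gcongr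
      _ = (‖p.eval x‖ * ‖r.eval x‖ * ‖x‖ ^ 4) * 2 ^ 4 := by ring
      _ ≤ (C * ‖f.eval x‖) * 2 ^ 4 := by gcongr
      _ = C * 2 ^ 4 * ‖f.eval x‖ := by ring

/-! ### The Riemann bilinear relation -/

/-- The linear algebra behind the Riemann bilinear relations. The vectors `a i` and `b i` are the
Poincaré duals of a symplectic basis, and `-4 Im h` is the intersection form. As `h` is real on the
real span of the `a i`, a complex relation between the `a i` splits into two real ones, and these
are trivial by pairing with the `b k`. Hence the `a i` are a basis of `V` over `ℂ`. -/
theorem eq_zero_of_orthogonal_lagrangian {V ι : Type*} [AddCommGroup V] [Module ℂ V]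
    [FiniteDimensional ℂ V] [Fintype ι] [DecidableEq ι] (hcard : Fintype.card ι = Module.finrank ℂ V)
    (h : V → V →ₗ[ℂ] ℂ) (hconj : ∀ v w, h w v = starRingEnd ℂ (h v w))
    (hdef : ∀ v, h v v = 0 → v = 0) (a b : ι → V)
    (haa : ∀ i k, 2 * (2 * Complex.I * h (a i) (a k)).re = 0)
    (hab : ∀ i k, 2 * (2 * Complex.I * h (a i) (b k)).re = if i = k then 1 else 0)
    {v : V} (hv : ∀ i, h (a i) v = 0) : v = 0 := by
  have him : ∀ i k, (h (a i) (a k)).im = 0 := by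
    intro i k
    have := haa i k
    simp at this
    exact this
  -- a real combination of the `a i` which is `h`-orthogonal to them vanishes
  have hreal : ∀ c : ι → ℝ, (∀ k, ∑ i, (c i : ℂ) * h (a k) (a i) = 0) → ∀ i, c i = 0 := by
    intro c hc
    have hz : ∑ i, (c i : ℂ) • a i = 0 := by
      apply hdef
      have h1 : ∀ k, h (a k) (∑ i, (c i : ℂ) • a i) = 0 := by
        intro k
        simpa using hc k
      rw [map_sum]
      refine Finset.sum_eq_zero fun i _ => ?_
      rw [map_smul, hconj, h1, map_zero, smul_zero]
    intro k
    -- pairing with `b k` extracts the coefficient `c k`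
    have h2 : ∑ i, (c i : ℂ) * h (b k) (a i) = 0 := by
      have := congrArg (h (b k)) hz
      simpa using this
    have h3 : ∑ i, c i * (2 * (2 * Complex.I * h (a i) (b k)).re) = 0 := by
      have h4 : ∑ i, (c i : ℂ) * h (a i) (b k) = 0 := by
        have := congrArg (starRingEnd ℂ) h2
        rw [map_sum, map_zero] at this
        rw [← this]
        refine Finset.sum_congr rfl fun i _ => ?_
        rw [map_mul, Complex.conj_ofReal, ← hconj]
      have h5 := congrArg (fun z => 2 * (2 * Complex.I * z).re) h4
      simp only [Finset.mul_sum, mul_zero, Complex.zero_re, Complex.re_sum] at h5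
      rw [← h5]
      refine Finset.sum_congr rfl fun i _ => ?_
      simp
      ring
    simp only [hab, mul_ite, mul_one, mul_zero] at h3
    simpa using h3
  have hli : LinearIndependent ℂ a := by
    rw [Fintype.linearIndependent_iff]
    intro c hc
    have h1 : ∀ k, ∑ i, c i * h (a k) (a i) = 0 := by
      intro k
      have := congrArg (h (a k)) hc
      simpa using this
    have hre : ∀ i, (c i).re = 0 := by
      refine hreal _ fun k => ?_
      have h2 := congrArg Complex.re (h1 k)
      rw [Complex.re_sum] at h2
      apply Complex.ext
      · rw [Complex.re_sum, ← h2]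
        refine Finset.sum_congr rfl fun i _ => ?_
        simp [him]
      · rw [Complex.im_sum]
        refine Finset.sum_eq_zero fun i _ => ?_
        simp [him]
    have himc : ∀ i, (c i).im = 0 := by
      refine hreal _ fun k => ?_
      have h2 := congrArg Complex.im (h1 k)
      rw [Complex.im_sum] at h2
      apply Complex.ext
      · rw [Complex.re_sum, Complex.zero_re, ← Complex.zero_im, ← h2]
        refine Finset.sum_congr rfl fun i _ => ?_
        simp [him]
      · rw [Complex.im_sum]
        refine Finset.sum_eq_zero fun i _ => ?_
        simp [him]
    exact fun i => Complex.ext (hre i) (himc i)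
  have hspan := hli.span_eq_top_of_card_eq_finrank' hcard
  have hall : ∀ w ∈ Submodule.span ℂ (Set.range a), h v w = 0 := by
    intro w hw
    induction hw using Submodule.span_induction with
    | mem x hx =>
      obtain ⟨i, rfl⟩ := hx
      rw [hconj, hv, map_zero]
    | zero => simp
    | add x y _ _ hx hy => rw [map_add, hx, hy, add_zero]
    | smul c x _ hx => rw [map_smul, hx, smul_zero]
  exact hdef v (hall v (hspan ▸ Submodule.mem_top))

/-- The space of polynomials `p` with `p dx/y` holomorphic. -/
abbrev holPolys (g : ℕ) : Submodule ℂ ℂ[X] := degreeLT ℂ g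

/-- The hermitian form `(r, p) ↦ (i/2) ∬ (p dx/y) ∧ conj (r dx/y)` as a linear map in `p`. -/
def hermForm {f : ℂ[X]} (hf : Squarefree f) {g : ℕ} (hdeg : f.natDegree = 2 * g + 2)
    (r : holPolys g) : holPolys g →ₗ[ℂ] ℂ where
  toFun p := hermPairing f (polyDiff p) (polyDiff r)
  map_add' p q := by
    simp only [hermPairing_polyDiff]
    rw [← integral_add]
    · refine integral_congr_ae (Eventually.of_forall fun x => ?_)
      simp only [Submodule.coe_add, eval_add]
      ring
    · exact (integrable_herm hf hdeg (mem_degreeLT.1 p.2) (mem_degreeLT.1 r.2)).const_mul 2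
    · exact (integrable_herm hf hdeg (mem_degreeLT.1 q.2) (mem_degreeLT.1 r.2)).const_mul 2
  map_smul' c p := by
    simp only [hermPairing_polyDiff, RingHom.id_apply, smul_eq_mul]
    rw [← integral_const_mul]
    refine integral_congr_ae (Eventually.of_forall fun x => ?_)
    simp only [Submodule.coe_smul, eval_smul, smul_eq_mul]
    ring

theorem hermForm_conj {f : ℂ[X]} (hf : Squarefree f) {g : ℕ} (hdeg : f.natDegree = 2 * g + 2)
    (p r : holPolys g) :
    hermForm hf hdeg r p = starRingEnd ℂ (hermForm hf hdeg p r) := by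
  simp only [hermForm, LinearMap.coe_mk, AddHom.coe_mk, hermPairing_polyDiff]
  rw [← integral_conj]
  refine integral_congr_ae (Eventually.of_forall fun x => ?_)
  simp only [map_mul, map_div₀, Complex.conj_ofReal, Complex.conj_conj, map_ofNat]
  ring

/-- The integrand is nonnegative and continuous off the zeros of `f`. -/
theorem hermForm_definite {f : ℂ[X]} (hf : Squarefree f) {g : ℕ} (hdeg : f.natDegree = 2 * g + 2)
    (p : holPolys g) (h : hermForm hf hdeg p p = 0) : p = 0 := by
  have hint := integrable_herm hf hdeg (mem_degreeLT.1 p.2) (mem_degreeLT.1 p.2)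
  have heq : ∀ x : ℂ, p.1.eval x * starRingEnd ℂ (p.1.eval x) / (‖f.eval x‖ : ℂ)
      = ((‖p.1.eval x‖ ^ 2 / ‖f.eval x‖ : ℝ) : ℂ) := by
    intro x
    rw [Complex.mul_conj']
    push_cast
    rfl
  simp only [hermForm, LinearMap.coe_mk, AddHom.coe_mk, hermPairing_polyDiff] at h
  rw [integral_const_mul] at h
  simp only [heq] at h hint
  rw [integral_complex_ofReal] at h
  have h0 : ∫ x : ℂ, ‖p.1.eval x‖ ^ 2 / ‖f.eval x‖ = 0 := by
    have := (mul_eq_zero.1 h).resolve_left two_ne_zero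
    exact_mod_cast this
  have hint' : Integrable (fun x : ℂ => ‖p.1.eval x‖ ^ 2 / ‖f.eval x‖) := by
    have := hint.re
    simpa only [RCLike.re_to_complex, Complex.ofReal_re] using this
  rw [integral_eq_zero_iff_of_nonneg (fun x => by positivity) hint'] at h0
  have h1 : (fun x : ℂ => (p.1 * f).eval x) =ᵐ[volume] fun _ => 0 := by
    filter_upwards [h0] with x hx
    rw [eval_mul]
    simp only [Pi.zero_apply, div_eq_zero_iff, norm_eq_zero, sq_eq_zero_iff] at hx
    rcases hx with hx | hx <;> simp [hx]
  have h2 := ((p.1 * f).continuous.ae_eq_iff_eq volume continuous_const).1 h1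
  have h3 : p.1 * f = 0 := Polynomial.funext fun x => by simpa using congrFun h2 x
  exact Subtype.ext ((mul_eq_zero.1 h3).resolve_right hf.ne_zero)

/-- Riemann's theorem: a holomorphic differential is determined by its periods along the first
half of a symplectic basis. -/
theorem eq_zero_of_periods {f : ℂ[X]} (hf : Squarefree f) {g : ℕ} (hdeg : f.natDegree = 2 * g + 2)
    {ι : Type} [Fintype ι] [DecidableEq ι] (hcard : Fintype.card ι = g) {a b : ι → Loop}
    (hab : IsSymplectic f a b) {p : ℂ[X]} (hp : p.degree < g)
    (hper : ∀ i, (a i).period (polyDiff p) = 0) : p = 0 := by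
  have hfr : Module.finrank ℂ (holPolys g) = g := by
    rw [(degreeLTEquiv ℂ g).finrank_eq]
    simp
  have : FiniteDimensional ℂ (holPolys g) := (degreeLTEquiv ℂ g).symm.finiteDimensional
  set h := hermForm hf hdeg with hh
  -- Poincaré duals are given by elements of `holPolys g` and are unique
  have hdual : ∀ (γ : Loop) (θ : MerDiff), IsPoincareDual f γ θ → ∃ r : holPolys g,
      θ = polyDiff r ∧ ∀ q : holPolys g, γ.period (polyDiff q) = 2 * Complex.I * h r q := by
    intro γ θ hθ
    obtain ⟨r, hr, rfl⟩ := hθ.1.exists_eq hf hdeg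
    exact ⟨⟨r, mem_degreeLT.2 hr⟩, rfl, fun q =>
      hθ.2 _ (isHolomorphic_polyDiff hf hdeg (mem_degreeLT.1 q.2))⟩
  have huniq : ∀ (γ : Loop) (r r' : holPolys g),
      (∀ q : holPolys g, γ.period (polyDiff q) = 2 * Complex.I * h r q) →
      (∀ q : holPolys g, γ.period (polyDiff q) = 2 * Complex.I * h r' q) → r = r' := by
    intro γ r r' h1 h2
    have h3 : ∀ q, h r q = h r' q := fun q =>
      mul_left_cancel₀ (mul_ne_zero two_ne_zero Complex.I_ne_zero) ((h1 q).symm.trans (h2 q))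
    rw [← sub_eq_zero]
    apply hermForm_definite hf hdeg
    rw [hermForm_conj hf hdeg, map_eq_zero, ← hh]
    have h4 : ∀ q, h (r - r') q = 0 := by
      intro q
      rw [hh, hermForm_conj hf hdeg, map_sub, map_sub, ← hermForm_conj hf hdeg,
        ← hermForm_conj hf hdeg, ← hh, h3, sub_self]
    exact h4 _
  choose θa hθa hθa' using fun i => (hab i i).1
  choose θb hθb hθb' using fun i => (hab i i).2.1
  choose ra hra hra' using fun i => hdual _ _ (hθa i)
  choose rb hrb hrb' using fun i => hdual _ _ (hθb i)
  have key : (⟨p, mem_degreeLT.2 hp⟩ : holPolys g) = 0 := by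
    refine eq_zero_of_orthogonal_lagrangian (hcard.trans hfr.symm) h
      (fun v w => hermForm_conj hf hdeg v w) (hermForm_definite hf hdeg) ra rb ?_ ?_ ?_
    · intro i k
      obtain ⟨θ, hθ, hθ'⟩ := (hab i k).1
      obtain ⟨r, rfl, hr⟩ := hdual _ _ hθ
      rw [huniq _ _ _ hr (hra' k), hra' i] at hθ'
      simpa using hθ'
    · intro i k
      obtain ⟨θ, hθ, hθ'⟩ := (hab i k).2.2
      obtain ⟨r, rfl, hr⟩ := hdual _ _ hθ
      rw [huniq _ _ _ hr (hrb' k), hra' i] at hθ'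
      rw [hθ']
      split_ifs <;> simp
    · intro i
      have := hra' i ⟨p, mem_degreeLT.2 hp⟩
      rw [hper i] at this
      exact ((mul_eq_zero.1 this.symm).resolve_left
        (mul_ne_zero two_ne_zero Complex.I_ne_zero))
  exact congrArg Subtype.val key

/-! ### Invariant holomorphic differentials -/

/-- The genus of the curve. -/
def genus : GaugeGroup → ℕ → ℕ
  | .SOodd, N => 2 * N - 1
  | .Sp, N => 2 * N

theorem coeff_charPoly_top {N : ℕ} (u : Fin N → ℂ) : (charPoly u).coeff (2 * N) = 1 := by
  rw [← reflect_revChar, coeff_reflect, revAt_le le_rfl, Nat.sub_self]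
  simp [revChar, coeff_zero_eq_eval_zero, eval_finsetSum]

theorem monic_charPoly {N : ℕ} (u : Fin N → ℂ) : (charPoly u).Monic :=
  monic_of_natDegree_le_of_coeff_eq_one _ (natDegree_charPoly_le u) (coeff_charPoly_top u)

theorem natDegree_charPoly {N : ℕ} (u : Fin N → ℂ) : (charPoly u).natDegree = 2 * N :=
  natDegree_eq_of_le_of_coeff_ne_zero (natDegree_charPoly_le u)
    (by rw [coeff_charPoly_top]; exact one_ne_zero)

theorem natDegree_curvePoly (G : GaugeGroup) {N : ℕ} (hN : 1 ≤ N) (μ : ℂ) (u : Fin N → ℂ) :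
    (curvePoly G μ u).natDegree = 2 * genus G N + 2 := by
  have hq := monic_charPoly u
  cases G with
  | SOodd =>
    have h1 : (charPoly u ^ 2).natDegree = 4 * N := by
      rw [hq.natDegree_pow, natDegree_charPoly]
      ring
    have h2 : (Polynomial.C (4 * μ ^ 2) * X ^ 2 : ℂ[X]).natDegree ≤ 2 :=
      natDegree_C_mul_X_pow_le _ _
    simp only [curvePoly, genus]
    rw [natDegree_sub_eq_left_of_natDegree_lt (by lia), h1]
    lia
  | Sp =>
    have h1 : (X ^ 2 * charPoly u).natDegree = 2 * N + 2 := by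
      rw [(monic_X_pow 2).natDegree_mul hq, natDegree_charPoly, natDegree_X_pow]
      ring
    have h2 : (X ^ 2 * charPoly u + Polynomial.C (4 * μ)).natDegree = 2 * N + 2 := by
      rw [natDegree_add_C, h1]
    simp only [curvePoly, genus]
    rw [hq.natDegree_mul' (by
      intro h0
      rw [h0] at h2
      simp at h2), natDegree_charPoly, h2]
    ring

/-- The polynomial `p` with `p dx/y = P dx/(xy)` for `SO(2N+1)`, resp. `p dx/y = P dx/y` for
`Sp(2N)`. For `SO(2N+1)`, `P` is meant to be odd: `divX` drops the constant term. -/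
def redX : GaugeGroup → ℂ[X] → ℂ[X]
  | .SOodd, P => divX P
  | .Sp, P => P

theorem redX_add (G : GaugeGroup) (P Q : ℂ[X]) : redX G (P + Q) = redX G P + redX G Q := by
  cases G
  · exact divX_add
  · rfl

theorem redX_C_mul (G : GaugeGroup) (a : ℂ) (P : ℂ[X]) :
    redX G (Polynomial.C a * P) = Polynomial.C a * redX G P := by
  cases G
  · exact divX_C_mul
  · rfl

theorem IsOddPoly.X_mul_divX {P : ℂ[X]} (hP : IsOddPoly P) : X * divX P = P := by
  have := X_mul_divX_add P
  rwa [hP 0 Even.zero, map_zero, add_zero] at this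

theorem IsOddPoly.add {P Q : ℂ[X]} (hP : IsOddPoly P) (hQ : IsOddPoly Q) : IsOddPoly (P + Q) :=
  fun i hi => by rw [coeff_add, hP i hi, hQ i hi, add_zero]

theorem IsOddPoly.C_mul {P : ℂ[X]} (hP : IsOddPoly P) (a : ℂ) : IsOddPoly (Polynomial.C a * P) :=
  fun i hi => by rw [coeff_C_mul, hP i hi, mul_zero]

theorem isOddPoly_sum {ι : Type*} (s : Finset ι) {P : ι → ℂ[X]} (hP : ∀ i ∈ s, IsOddPoly (P i)) :
    IsOddPoly (∑ i ∈ s, P i) := fun k hk => by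
  rw [finsetSum_coeff]
  exact Finset.sum_eq_zero fun i hi => hP i hi k hk

/-- The sign of the polynomials `p(x) dx/y` under `x ↦ -x` for invariant differentials. -/
def sgn : GaugeGroup → ℂ
  | .SOodd => 1
  | .Sp => -1

theorem eval_neg_redX (G : GaugeGroup) {P : ℂ[X]} (hP : IsOddPoly P) (x : ℂ) :
    (redX G P).eval (-x) = sgn G * (redX G P).eval x := by
  cases G with
  | SOodd =>
    have h1 : (divX P).comp (-X) = divX P := by
      ext i
      rw [coeff_comp_neg_X, coeff_divX]
      rcases Nat.even_or_odd i with hi | hi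
      · rw [hi.neg_one_pow, one_mul]
      · rw [hP _ hi.add_one, mul_zero]
    have := congrArg (Polynomial.eval x) h1
    simpa [redX, sgn, eval_comp] using this
  | Sp =>
    have := congrArg (Polynomial.eval x) ((isOddPoly_iff P).1 hP)
    simpa [redX, sgn, eval_comp] using this

theorem isSigmaInvariant_polyDiff (G : GaugeGroup) (f : ℂ[X]) {P : ℂ[X]} (hP : IsOddPoly P) :
    IsSigmaInvariant G f (polyDiff (redX G P)) := by
  intro x y _
  have := eval_neg_redX G hP x
  cases G
  · simp only [polyDiff_fn, this, sgn, div_neg, one_mul, neg_neg]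
  · simp only [polyDiff_fn, this, sgn, neg_one_mul, neg_div, neg_neg]

theorem degree_redX_lt (G : GaugeGroup) {N : ℕ} (hN : 1 ≤ N) {P : ℂ[X]}
    (hP : P.natDegree < 2 * N) : (redX G P).degree < genus G N := by
  have key : ∀ Q : ℂ[X], ∀ g : ℕ, 0 < g → Q.natDegree < g → Q.degree < g := fun Q g hg hQ =>
    (degree_le_natDegree).trans_lt (by exact_mod_cast hQ)
  cases G with
  | SOodd =>
    refine key _ _ (by simp only [genus]; lia) ?_
    simp only [redX, genus, natDegree_divX_eq_natDegree_tsub_one]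
    lia
  | Sp => exact key _ _ (by simp only [genus]; lia) hP

/-- The general odd polynomial of degree less than `2N`. -/
def oddPoly {N : ℕ} (w : Fin N → ℂ) : ℂ[X] := -(X * charDot w)

theorem oddPoly_eq {N : ℕ} (w : Fin N → ℂ) :
    oddPoly w = ∑ j : Fin N, Polynomial.C (w j) * X ^ (2 * N - 2 * (j.val + 1) + 1) := by
  simp only [oddPoly, charDot, mul_neg, neg_neg, Finset.mul_sum]
  refine Finset.sum_congr rfl fun j _ => ?_
  ring

theorem coeff_oddPoly {N : ℕ} (w : Fin N → ℂ) (i : ℕ) :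
    (oddPoly w).coeff i
      = ∑ j : Fin N, if i = 2 * N - 2 * (j.val + 1) + 1 then w j else 0 := by
  rw [oddPoly_eq, finsetSum_coeff]
  simp only [coeff_C_mul, coeff_X_pow, mul_ite, mul_one, mul_zero]

theorem coeff_oddPoly_self {N : ℕ} (w : Fin N → ℂ) (j : Fin N) :
    (oddPoly w).coeff (2 * N - 2 * (j.val + 1) + 1) = w j := by
  rw [coeff_oddPoly, Finset.sum_eq_single j]
  · rw [if_pos rfl]
  · intro k _ hk
    rw [if_neg]
    intro h
    apply hk
    have := j.2
    have := k.2
    exact Fin.ext (by lia)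
  · simp

theorem isOddPoly_oddPoly {N : ℕ} (w : Fin N → ℂ) : IsOddPoly (oddPoly w) := by
  intro i hi
  rw [coeff_oddPoly]
  refine Finset.sum_eq_zero fun j _ => if_neg ?_
  rintro rfl
  obtain ⟨k, hk⟩ := hi
  lia

theorem natDegree_oddPoly_lt {N : ℕ} (hN : 1 ≤ N) (w : Fin N → ℂ) :
    (oddPoly w).natDegree < 2 * N := by
  rw [Nat.lt_iff_le_pred (by lia), natDegree_le_iff_coeff_eq_zero]
  intro i hi
  rw [coeff_oddPoly]
  refine Finset.sum_eq_zero fun j _ => if_neg ?_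
  have := j.2
  lia

theorem oddPoly_add {N : ℕ} (v w : Fin N → ℂ) : oddPoly (v + w) = oddPoly v + oddPoly w := by
  simp only [oddPoly_eq, Pi.add_apply, map_add, add_mul, Finset.sum_add_distrib]

theorem oddPoly_smul {N : ℕ} (a : ℂ) (w : Fin N → ℂ) :
    oddPoly (a • w) = Polynomial.C a * oddPoly w := by
  simp only [oddPoly_eq, Pi.smul_apply, smul_eq_mul, map_mul, Finset.mul_sum, mul_assoc]

theorem IsOddPoly.exists_oddPoly {N : ℕ} {P : ℂ[X]} (hP : IsOddPoly P)
    (hdeg : P.natDegree < 2 * N) : ∃ w : Fin N → ℂ, P = oddPoly w := by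
  refine ⟨fun j => P.coeff (2 * N - 2 * (j.val + 1) + 1), ?_⟩
  ext i
  rcases Nat.even_or_odd i with hi | hi
  · rw [hP i hi, isOddPoly_oddPoly _ i hi]
  · rcases lt_or_ge i (2 * N) with h | h
    · obtain ⟨k, rfl⟩ := hi
      have hk : 2 * k + 1 = 2 * N - 2 * ((N - 1 - k) + 1) + 1 := by lia
      have := coeff_oddPoly_self (fun j : Fin N => P.coeff (2 * N - 2 * (j.val + 1) + 1))
        ⟨N - 1 - k, by lia⟩
      simp only at this
      rw [hk, this]
    · rw [coeff_eq_zero_of_natDegree_lt (hdeg.trans_le h), coeff_oddPoly]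
      refine (Finset.sum_eq_zero fun j _ => if_neg ?_).symm
      have := j.2
      lia

/-- The invariant holomorphic differential with coefficient vector `w`. -/
def invForm (G : GaugeGroup) {N : ℕ} (w : Fin N → ℂ) : MerDiff := polyDiff (redX G (oddPoly w))

/-- The invariant holomorphic differentials are the `P dx/(xy)`, resp. `P dx/y`, with `P` an odd
polynomial of degree less than `2N`. -/
theorem invariant_iff (G : GaugeGroup) {N : ℕ} (hN : 1 ≤ N) {μ : ℂ} {u : Fin N → ℂ}
    (hf : Squarefree (curvePoly G μ u)) (ω : MerDiff) :
    (IsHolomorphic (curvePoly G μ u) ω ∧ IsSigmaInvariant G (curvePoly G μ u) ω)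
      ↔ ∃ w : Fin N → ℂ, ω = invForm G w := by
  have hdeg := natDegree_curvePoly G hN μ u
  constructor
  · rintro ⟨hol, hinv⟩
    obtain ⟨p, hp, rfl⟩ := hol.exists_eq hf hdeg
    -- invariance fixes the parity of `p` off the branch points, hence everywhere
    have hpar : p.comp (-X) = Polynomial.C (sgn G) * p := by
      have h0 : (p.comp (-X) - Polynomial.C (sgn G) * p) * curvePoly G μ u = 0 := by
        refine Polynomial.funext fun x => ?_
        simp only [eval_mul, eval_sub, eval_comp, eval_neg, eval_X, eval_C, eval_zero]
        by_cases hx : (curvePoly G μ u).eval x = 0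
        · rw [hx, mul_zero]
        · obtain ⟨y, hy⟩ := IsAlgClosed.exists_pow_nat_eq ((curvePoly G μ u).eval x) two_pos
          have hy0 : y ≠ 0 := by
            rintro rfl
            apply hx
            rw [← hy]
            simp
          have h1 := hinv x y hy
          have h2 : p.eval (-x) = sgn G * p.eval x := by
            cases G
            · simp only [polyDiff_fn, sgn] at h1 ⊢
              field_simp at h1
              linear_combination h1
            · simp only [polyDiff_fn, sgn] at h1 ⊢
              field_simp at h1
              linear_combination -h1
          rw [h2, sub_self, zero_mul]
      exact sub_eq_zero.1 ((mul_eq_zero.1 h0).resolve_right hf.ne_zero)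
    have hcoef : ∀ i, (-1) ^ i * p.coeff i = sgn G * p.coeff i := fun i => by
      rw [← coeff_comp_neg_X, hpar, coeff_C_mul]
    have hpd : p = 0 ∨ p.natDegree < genus G N := by
      rcases eq_or_ne p 0 with h0 | h0
      · exact Or.inl h0
      · rw [degree_eq_natDegree h0] at hp
        exact Or.inr (by exact_mod_cast hp)
    cases G with
    | SOodd =>
      have hodd : IsOddPoly (X * p) := by
        intro i hi
        rcases i with _ | i
        · simp
        · rw [coeff_X_mul]
          have hi' : Odd i := by
            by_contra h
            rw [Nat.not_odd_iff_even] at h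
            exact Nat.not_even_iff_odd.2 h.add_one hi
          have := hcoef i
          rw [hi'.neg_one_pow, sgn] at this
          linear_combination -this / 2
      have hd : (X * p).natDegree < 2 * N := by
        rcases hpd with rfl | h
        · simp
          lia
        · refine (natDegree_mul_le).trans_lt ?_
          simp only [genus] at h
          rw [natDegree_X]
          lia
      obtain ⟨w, hw⟩ := hodd.exists_oddPoly hd
      refine ⟨w, ?_⟩
      rw [invForm, ← hw, redX]
      congr 1
      ext i
      rw [coeff_divX, coeff_X_mul]
    | Sp =>
      have hodd : IsOddPoly p := by
        intro i hi
        have := hcoef i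
        rw [hi.neg_one_pow, sgn] at this
        linear_combination this / 2
      have hd : p.natDegree < 2 * N := by
        rcases hpd with rfl | h
        · simp
          lia
        · exact h
      obtain ⟨w, hw⟩ := hodd.exists_oddPoly hd
      exact ⟨w, by rw [invForm, ← hw, redX]⟩
  · rintro ⟨w, rfl⟩
    exact ⟨isHolomorphic_polyDiff hf hdeg (degree_redX_lt G hN (natDegree_oddPoly_lt hN w)),
      isSigmaInvariant_polyDiff G _ (isOddPoly_oddPoly w)⟩

theorem redX_injective_of_odd (G : GaugeGroup) {P : ℂ[X]} (hP : IsOddPoly P) (h : redX G P = 0) :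
    P = 0 := by
  cases G
  · rw [← hP.X_mul_divX, show divX P = 0 from h, mul_zero]
  · exact h

theorem eq_zero_of_oddPoly_eq_zero {N : ℕ} {w : Fin N → ℂ} (h : oddPoly w = 0) : w = 0 := by
  funext j
  rw [← coeff_oddPoly_self w j, h]
  simp

/-! ### Periods of invariant differentials -/

/-- The cycle `-σ₂(γ)` and `γ` have the same periods up to sign, because `x` enters the invariant
differentials with a definite parity. -/
theorem period_negSigma₂ (G : GaugeGroup) {N : ℕ} {μ : ℂ} {U : Set (Fin N → ℂ)}
    (A : CycleFamily G μ U) {u : Fin N → ℂ} (hu : u ∈ U) {P : ℂ[X]} (hP : IsOddPoly P) :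
    (A.at u).negSigma₂.period (polyDiff (redX G P))
      = sgn G * (A.at u).period (polyDiff (redX G P)) := by
  simp only [Loop.period, Loop.negSigma₂, CycleFamily.at, polyDiff_fn]
  have hd : ∀ t, deriv (fun t => -A.x (-t)) t = deriv A.x (-t) := by
    intro t
    rw [deriv.fun_neg, deriv_comp_neg, neg_neg]
  simp only [hd, eval_neg_redX G hP]
  rw [intervalIntegral.integral_comp_neg
    (fun t => sgn G * (redX G P).eval (A.x t) / A.y u t * deriv A.x t)]
  have hdx : Function.Periodic (deriv A.x) 1 := by
    intro t
    rw [← deriv_comp_add_const]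
    congr 1
    exact funext A.periodic_x
  have hper : Function.Periodic
      (fun t => sgn G * (redX G P).eval (A.x t) / A.y u t * deriv A.x t) 1 := by
    intro t
    simp only [A.periodic_x t, A.periodic_y u hu t, hdx t]
  have := hper.intervalIntegral_add_eq (-1) 0
  simp only [neg_add_cancel, zero_add] at this
  rw [neg_zero, this, ← intervalIntegral.integral_const_mul]
  refine intervalIntegral.integral_congr fun t _ => ?_
  ring

/-- An invariant holomorphic differential with vanishing `A`-periods vanishes: its periods along
the image cycles `-σ₂(A_j)` vanish as well. -/
theorem eq_zero_of_invForm_periods (G : GaugeGroup) {N : ℕ} (hN : 1 ≤ N) {μ : ℂ}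
    {U : Set (Fin N → ℂ)} {A B : Fin N → CycleFamily G μ U} {u : Fin N → ℂ} (hu : u ∈ U)
    (hf : Squarefree (curvePoly G μ u))
    (hAB : IsPrymBasis G μ u (fun j => (A j).at u) (fun j => (B j).at u)) {w : Fin N → ℂ}
    (hw : ∀ j, ((A j).at u).period (invForm G w) = 0) : w = 0 := by
  have hdeg := natDegree_curvePoly G hN μ u
  have hp := degree_redX_lt G hN (natDegree_oddPoly_lt hN w)
  have hneg : ∀ j, ((A j).at u).negSigma₂.period (invForm G w) = 0 := fun j => by
    rw [invForm, period_negSigma₂ G (A j) hu (isOddPoly_oddPoly w)]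
    rw [invForm] at hw
    rw [hw j, mul_zero]
  refine eq_zero_of_oddPoly_eq_zero (redX_injective_of_odd G (isOddPoly_oddPoly w) ?_)
  cases G with
  | SOodd =>
    refine eq_zero_of_periods hf hdeg ?_ hAB.1 hp ?_
    · have h1 : Fintype.card {j : Fin N // j.val + 1 < N} = N - 1 := by
        have e : {j : Fin N // j.val + 1 < N} ≃ Fin (N - 1) :=
          { toFun := fun j => ⟨j.1.1, by have := j.2; lia⟩
            invFun := fun j => ⟨⟨j.1, by have := j.2; lia⟩, by have := j.2; simp only; lia⟩
            left_inv := fun j => rfl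
            right_inv := fun j => rfl }
        rw [Fintype.card_congr e, Fintype.card_fin]
      rw [Fintype.card_sum, h1, Fintype.card_fin, genus]
      lia
    · rintro (j | j)
      · exact hw j
      · exact hneg j.1
  | Sp =>
    refine eq_zero_of_periods hf hdeg ?_ hAB hp ?_
    · rw [Fintype.card_sum, Fintype.card_fin, genus]
      lia
    · rintro (j | j)
      · exact hw j
      · exact hneg j

/-! ### Differentiation at constant `z` -/

theorem HasPolyDerivAt.natDegree_le {P : ℂ → ℂ[X]} {P' : ℂ[X]} {s₀ : ℂ}
    (h : HasPolyDerivAt P P' s₀) {K : ℕ} (hK : ∀ s, (P s).natDegree ≤ K) : P'.natDegree ≤ K := by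
  rw [natDegree_le_iff_coeff_eq_zero]
  intro i hi
  have h0 : (fun s => (P s).coeff i) = fun _ => 0 :=
    funext fun s => coeff_eq_zero_of_natDegree_lt ((hK s).trans_lt hi)
  have h1 := h.2 i
  rw [h0] at h1
  exact h1.unique (hasDerivAt_const _ _)

theorem HasPolyDerivAt.eval {P : ℂ → ℂ[X]} {P' : ℂ[X]} {s₀ : ℂ} (h : HasPolyDerivAt P P' s₀)
    {X : ℂ → ℂ} {X' : ℂ} (hX : HasDerivAt X X' s₀) :
    HasDerivAt (fun s => (P s).eval (X s))
      (P'.eval (X s₀) + (derivative (P s₀)).eval (X s₀) * X') s₀ := by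
  obtain ⟨K, hK⟩ := h.1
  have h1 : (fun s => (P s).eval (X s))
      = fun s => ∑ i ∈ Finset.range (K + 1), (P s).coeff i * X s ^ i :=
    funext fun s => eval_eq_sum_range' (Nat.lt_succ_of_le (hK s)) _
  have h2 : HasDerivAt (fun s => ∑ i ∈ Finset.range (K + 1), (P s).coeff i * X s ^ i)
      (∑ i ∈ Finset.range (K + 1),
        (P'.coeff i * X s₀ ^ i + (P s₀).coeff i * (i * X s₀ ^ (i - 1) * X'))) s₀ :=
    HasDerivAt.fun_sum fun i _ => (h.2 i).mul (hX.pow i)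
  rw [h1]
  refine h2.congr_deriv ?_
  rw [Finset.sum_add_distrib, ← eval_eq_sum_range' (Nat.lt_succ_of_le (h.natDegree_le hK)),
    derivative_eval, sum_over_range' _ (by simp) (K + 1) (Nat.lt_succ_of_le (hK s₀)),
    Finset.sum_mul]
  congr 1
  refine Finset.sum_congr rfl fun i _ => ?_
  ring

/-- The implicit function theorem for `H(s, x) = 0`, with local uniqueness. -/
theorem exists_implicit {H : ℂ × ℂ → ℂ} {L : ℂ × ℂ →L[ℂ] ℂ} {s₀ x₀ : ℂ}
    (hH : HasStrictFDerivAt H L (s₀, x₀)) (h0 : H (s₀, x₀) = 0) (hb : L (0, 1) ≠ 0) :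
    ∃ (φ : ℂ → ℂ) (φ' : ℂ), φ s₀ = x₀ ∧ HasDerivAt φ φ' s₀ ∧ L (1, 0) + L (0, 1) * φ' = 0 ∧
      (∀ᶠ s in 𝓝 s₀, H (s, φ s) = 0) ∧ ∀ᶠ p in 𝓝 (s₀, x₀), H p = 0 → φ p.1 = p.2 := by
  have hinv : (L ∘L .inr ℂ ℂ ℂ).IsInvertible := by
    refine ⟨ContinuousLinearEquiv.unitsEquivAut ℂ (Units.mk0 _ hb), ?_⟩
    ext
    simp
  set φ := hH.implicitFunctionOfProdDomain hinv with hφ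
  have h1 := hH.eventually_apply_eq_iff_implicitFunctionOfProdDomain hinv
  have h2 := hH.eventually_apply_implicitFunctionOfProdDomain hinv
  have h3 := (hH.hasStrictFDerivAt_implicitFunctionOfProdDomain hinv).hasFDerivAt.hasDerivAt
  have h4 : φ s₀ = x₀ := h1.self_of_nhds.1 rfl
  refine ⟨φ, _, h4, h3, ?_, ?_, ?_⟩
  · have h5 : HasDerivAt (fun s => (s, φ s)) (1, _) s₀ := (hasDerivAt_id s₀).prodMk h3
    have hH' : HasFDerivAt H L (s₀, φ s₀) := by
      rw [h4]
      exact hH.hasFDerivAt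
    have h6 := hH'.comp_hasDerivAt s₀ h5
    have h7 : (H ∘ fun s => (s, φ s)) =ᶠ[𝓝 s₀] fun _ => 0 := by
      filter_upwards [h2] with s hs
      simpa [h0] using hs
    have h8 := h6.unique ((hasDerivAt_const s₀ (0 : ℂ)).congr_of_eventuallyEq h7)
    have h9 : ∀ a : ℂ, L (1, a) = L (1, 0) + L (0, 1) * a := fun a => by
      rw [mul_comm, ← smul_eq_mul, ← map_smul, ← map_add]
      simp
    exact (h9 _).symm.trans h8
  · filter_upwards [h2] with s hs
    rw [hs, h0]
  · filter_upwards [h1] with p hp hp0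
    exact hp.1 (hp0.trans h0.symm)

theorem exists_hasStrictFDerivAt_charPoly {N : ℕ} {u : ℂ → Fin N → ℂ} {w : Fin N → ℂ} {s₀ : ℂ}
    (hu : HasStrictDerivAt u w s₀) (x₀ : ℂ) : ∃ L : ℂ × ℂ →L[ℂ] ℂ,
      HasStrictFDerivAt (fun p : ℂ × ℂ => (charPoly (u p.1)).eval p.2) L (s₀, x₀) ∧
      L (1, 0) = (charDot w).eval x₀ ∧
      L (0, 1) = (derivative (charPoly (u s₀))).eval x₀ := by
  have h1 : ContDiff ℂ 1 (fun p : (Fin N → ℂ) × ℂ => (charPoly p.1).eval p.2) := by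
    simp only [charPoly, eval_sub, eval_finsetSum, eval_mul, eval_pow, eval_X, eval_C]
    fun_prop
  have h2 : HasStrictFDerivAt (fun p : ℂ × ℂ => (u p.1, p.2)) _ (s₀, x₀) :=
    (hu.hasStrictFDerivAt.comp (s₀, x₀) hasStrictFDerivAt_fst).prodMk hasStrictFDerivAt_snd
  have h3 := ((h1.contDiffAt (x := (u s₀, x₀))).hasStrictFDerivAt one_ne_zero).comp
    (s₀, x₀) h2
  refine ⟨_, h3, ?_, ?_⟩
  · have h4 : HasDerivAt (fun s : ℂ => (s, x₀)) (1, 0) s₀ :=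
      (hasDerivAt_id s₀).prodMk (hasDerivAt_const _ _)
    have h5 := h3.hasFDerivAt.comp_hasDerivAt s₀ h4
    have h6 := (hasPolyDerivAt_charPoly hu.hasDerivAt).eval (hasDerivAt_const s₀ x₀)
    rw [mul_zero, add_zero] at h6
    exact h5.unique h6
  · have h4 : HasDerivAt (fun x : ℂ => (s₀, x)) (0, 1) x₀ :=
      (hasDerivAt_const _ _).prodMk (hasDerivAt_id x₀)
    have h5 := h3.hasFDerivAt.comp_hasDerivAt x₀ h4
    exact h5.unique ((charPoly (u s₀)).hasDerivAt x₀)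

/-- For `μ = 0` the curve polynomial is `q²`, resp. `x² q²`. -/
theorem mu_ne_zero_of_squarefree {G : GaugeGroup} {N : ℕ} (hN : 1 ≤ N) {μ : ℂ} {u : Fin N → ℂ}
    (hf : Squarefree (curvePoly G μ u)) : μ ≠ 0 := by
  rintro rfl
  have hq : ¬ IsUnit (charPoly u) := by
    rw [(monic_charPoly u).isUnit_iff]
    intro h
    have := natDegree_charPoly u
    rw [h, natDegree_one] at this
    lia
  refine hq (hf _ ?_)
  cases G
  · simp [curvePoly, sq]
  · simp only [curvePoly, mul_zero, map_zero, add_zero]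
    exact ⟨X ^ 2, by ring⟩

/-- The equation between `x` and `q = Q(x²)` at a fixed value `ζ` of `z`: it is `z + μ²/z = W(x)`
multiplied by `xζ`, resp. `ζ`. -/
def zEq (G : GaugeGroup) (μ ζ x q : ℂ) : ℂ :=
  match G with
  | .SOodd => x * (ζ ^ 2 + μ ^ 2) - ζ * q
  | .Sp => (ζ - μ) ^ 2 - ζ * (x ^ 2 * q)

/-- The function `y` in terms of `x` and the value `ζ` of `z`. -/
def yOfZ (G : GaugeGroup) (μ ζ x q : ℂ) : ℂ :=
  match G with
  | .SOodd => 2 * x * ζ - q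
  | .Sp => (2 * ζ - 2 * μ - x ^ 2 * q) / x

/-- For `x ≠ 0`, the points with `z = ζ` are the solutions `x` of `zEq`. -/
theorem curve_and_zFun_iff (G : GaugeGroup) {N : ℕ} (μ : ℂ) (u : Fin N → ℂ) (ζ : ℂ) {x y : ℂ}
    (hx : x ≠ 0) : (y ^ 2 = (curvePoly G μ u).eval x ∧ zFun G μ u x y = ζ) ↔
      (zEq G μ ζ x ((charPoly u).eval x) = 0 ∧ y = yOfZ G μ ζ x ((charPoly u).eval x)) := by
  cases G with
  | SOodd =>
    simp only [curvePoly, zFun, zEq, yOfZ, eval_sub, eval_mul, eval_pow, eval_X, eval_C]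
    constructor
    · rintro ⟨h1, h2⟩
      rw [div_eq_iff (by simpa using hx)] at h2
      have hy : y = 2 * x * ζ - (charPoly u).eval x := by linear_combination h2
      refine ⟨?_, hy⟩
      rw [hy] at h1
      refine mul_left_cancel₀ (mul_ne_zero (by norm_num : (4 : ℂ) ≠ 0) hx) ?_
      linear_combination h1
    · rintro ⟨h1, rfl⟩
      refine ⟨by linear_combination 4 * x * h1, ?_⟩
      rw [div_eq_iff (by simpa using hx)]
      ring
  | Sp =>
    simp only [curvePoly, zFun, zEq, yOfZ, eval_add, eval_mul, eval_pow, eval_X, eval_C]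
    constructor
    · rintro ⟨h1, h2⟩
      have hy : x * y = 2 * ζ - 2 * μ - x ^ 2 * (charPoly u).eval x := by
        linear_combination 2 * h2
      refine ⟨?_, by rw [eq_div_iff hx, ← hy, mul_comm]⟩
      refine mul_left_cancel₀ (by norm_num : (4 : ℂ) ≠ 0) ?_
      linear_combination x ^ 2 * h1 -
        (x * y + (2 * ζ - 2 * μ - x ^ 2 * (charPoly u).eval x)) * hy
    · rintro ⟨h1, h2⟩
      rw [eq_div_iff hx] at h2
      refine ⟨?_, by linear_combination h2 / 2⟩
      refine mul_left_cancel₀ (pow_ne_zero 2 hx) ?_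
      linear_combination 4 * h1 + (y * x + (2 * ζ - 2 * μ - x ^ 2 * (charPoly u).eval x)) * h2

theorem mulDLogZ_one_fn (G : GaugeGroup) {N : ℕ} (u : Fin N → ℂ) {x : ℂ} (hx : x ≠ 0) (y : ℂ) :
    (mulDLogZ G u 1).fn x y = match G with
      | .SOodd => (wNum G (charPoly u)).eval x / x / y
      | .Sp => (wNum G (charPoly u)).eval x / y := by
  cases G with
  | SOodd =>
    rw [mulDLogZ_one_fn_SOodd u x y hx]
    simp [wNum, wConst, sub_eq_add_neg]
  | Sp =>
    rw [mulDLogZ_one_fn_Sp u x y]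
    simp [wNum, wConst]

theorem eval_redX (G : GaugeGroup) {P : ℂ[X]} (hP : IsOddPoly P) {x : ℂ} (hx : x ≠ 0) :
    (redX G P).eval x = match G with
      | .SOodd => P.eval x / x
      | .Sp => P.eval x := by
  cases G
  · have := congrArg (Polynomial.eval x) hP.X_mul_divX
    rw [eval_mul, eval_X] at this
    rw [redX, eq_div_iff hx, mul_comm, this]
  · rfl

/-- The variation at constant `z` of a differential `R dz/z`, where `R` moves with velocity `R'`
and the moduli with velocity `w`. -/
theorem hasConstZDeriv (G : GaugeGroup) {N : ℕ} {μ : ℂ} (hμ : μ ≠ 0) {u : ℂ → Fin N → ℂ}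
    {w : Fin N → ℂ} {s₀ : ℂ} (hu : HasStrictDerivAt u w s₀) {R : ℂ → ℂ[X]} {R' : ℂ[X]}
    (hR : HasPolyDerivAt R R' s₀)
    (hodd : IsOddPoly (varNum G (charPoly (u s₀)) (R s₀) R' (charDot w))) :
    HasConstZDeriv G μ u R s₀
      (polyDiff (redX G (varNum G (charPoly (u s₀)) (R s₀) R' (charDot w)))) := by
  intro x₀ y₀ hy₀ hx₀ hy0 hdz
  set ζ := zFun G μ (u s₀) x₀ y₀ with hζ
  obtain ⟨hz0, hyz⟩ := (curve_and_zFun_iff G μ (u s₀) ζ hx₀).1 ⟨hy₀, hζ.symm⟩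
  obtain ⟨L, hL, hL1, hL2⟩ := exists_hasStrictFDerivAt_charPoly hu x₀
  set q₀ := (charPoly (u s₀)).eval x₀ with hq₀
  have hw0 : (wNum G (charPoly (u s₀))).eval x₀ ≠ 0 := by
    intro h
    rw [mulDLogZ_one_fn G (u s₀) hx₀] at hdz
    cases G <;> simp [h] at hdz
  have hwN : (wNum G (charPoly (u s₀))).eval x₀ = x₀ * L (0, 1) + wConst G * q₀ := by
    rw [wNum, eval_add, eval_mul, eval_mul, eval_X, eval_C, hL2]
  have hζ0 : ζ ≠ 0 := by
    intro h
    rw [h] at hz0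
    cases G
    · simp [zEq, hx₀, hμ] at hz0
    · simp [zEq, hμ] at hz0
  -- the defining equation of the points with `z = ζ`
  -- up to a factor `c`, its derivatives are `x₀ e(x₀)` in `s` and the numerator of `dz/z` in `x`
  obtain ⟨K, hK, hK1⟩ : ∃ K : ℂ × ℂ →L[ℂ] ℂ, HasStrictFDerivAt
      (fun p : ℂ × ℂ => zEq G μ ζ p.2 ((charPoly (u p.1)).eval p.2)) K (s₀, x₀) ∧
      ∃ c : ℂ, c ≠ 0 ∧ c * K (1, 0) = x₀ * L (1, 0) ∧
        c * K (0, 1) = (wNum G (charPoly (u s₀))).eval x₀ := by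
    have hsnd : HasStrictFDerivAt (fun p : ℂ × ℂ => p.2) (.snd ℂ ℂ ℂ) (s₀, x₀) :=
      hasStrictFDerivAt_snd
    cases G with
    | SOodd =>
      refine ⟨_, (hsnd.mul_const (ζ ^ 2 + μ ^ 2)).sub (hL.const_mul ζ), -x₀ / ζ,
        div_ne_zero (neg_ne_zero.2 hx₀) hζ0, ?_, ?_⟩
      · simp
        field_simp
      · rw [hwN]
        simp [wConst]
        simp only [zEq] at hz0
        field_simp
        linear_combination -hz0
    | Sp =>
      refine ⟨_, (((hsnd.pow 2).mul hL).const_mul ζ).const_sub ((ζ - μ) ^ 2), -1 / (x₀ * ζ),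
        div_ne_zero (neg_ne_zero.2 one_ne_zero) (mul_ne_zero hx₀ hζ0), ?_, ?_⟩
      · simp
        field_simp
      · rw [hwN]
        simp [wConst]
        field_simp
        ring
  obtain ⟨c, hc0, hKs, hKx⟩ := hK1
  have hb : K (0, 1) ≠ 0 := by
    intro h
    rw [h, mul_zero] at hKx
    exact hw0 hKx.symm
  obtain ⟨φ, φ', hφ0, hφ, hφ', hφz, hφu⟩ := exists_implicit hK hz0 hb
  -- the velocity of `x` at constant `z`
  have hvel : (wNum G (charPoly (u s₀))).eval x₀ * φ' = -(x₀ * (charDot w).eval x₀) := by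
    rw [← hL1]
    linear_combination c * hφ' - hKs - φ' * hKx
  have hne : ∀ X : ℂ → ℂ, X s₀ = x₀ → ContinuousAt X s₀ → ∀ᶠ s in 𝓝 s₀, X s ≠ 0 :=
    fun X h0 hX => hX.eventually_ne (h0 ▸ hx₀)
  constructor
  · refine ⟨φ, fun s => yOfZ G μ ζ (φ s) ((charPoly (u s)).eval (φ s)), hφ0, ?_,
      hφ.continuousAt, ?_, ?_⟩
    · simp only [hφ0]
      exact hyz.symm
    · have hq : ContinuousAt (fun s => (charPoly (u s)).eval (φ s)) s₀ :=
        ((hasPolyDerivAt_charPoly hu.hasDerivAt).eval hφ).continuousAt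
      have hφc := hφ.continuousAt
      cases G with
      | SOodd =>
        simp only [yOfZ]
        fun_prop
      | Sp =>
        simp only [yOfZ]
        exact ContinuousAt.div (by fun_prop) hφc (hφ0 ▸ hx₀)
    · filter_upwards [hφz, hne φ hφ0 hφ.continuousAt] with s hs hs0
      exact (curve_and_zFun_iff G μ (u s) ζ hs0).2 ⟨hs, rfl⟩
  · rintro X Y ⟨hX0, hY0, hXc, hYc, hXY⟩
    have heq : X =ᶠ[𝓝 s₀] φ := by
      have hpair : Tendsto (fun s => (s, X s)) (𝓝 s₀) (𝓝 (s₀, x₀)) := by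
        have := (continuousAt_id (x := s₀)).prodMk hXc
        rw [ContinuousAt, hX0] at this
        exact this
      filter_upwards [hpair.eventually hφu, hXY, hne X hX0 hXc] with s hs h1 h2
      exact (hs ((curve_and_zFun_iff G μ (u s) ζ h2).1 h1).1).symm
    have hXd : HasDerivAt X φ' s₀ := hφ.congr_of_eventuallyEq heq
    refine ⟨_, hR.eval hXd, ?_⟩
    rw [polyDiff_fn, eval_redX G hodd hx₀, mulDLogZ_one_fn G (u s₀) hx₀, hX0]
    have hmain : (R'.eval x₀ + (derivative (R s₀)).eval x₀ * φ')
        * (wNum G (charPoly (u s₀))).eval x₀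
        = (varNum G (charPoly (u s₀)) (R s₀) R' (charDot w)).eval x₀ := by
      simp only [varNum, eval_sub, eval_mul, eval_X]
      linear_combination (derivative (R s₀)).eval x₀ * hvel
    cases G
    · simp only
      rw [← hmain]
      ring
    · simp only
      rw [← hmain]
      ring

/-! ### Periods as functions of the moduli -/

/-- A local inverse of `y ↦ y²` near `y₀ ≠ 0`. -/
theorem exists_localSqrt {y₀ : ℂ} (h0 : y₀ ≠ 0) :
    ∃ φ : ℂ → ℂ, HasDerivAt φ (2 * y₀)⁻¹ (y₀ ^ 2) ∧ ∀ᶠ y in 𝓝 y₀, φ (y ^ 2) = y := by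
  have h : HasStrictDerivAt (fun y : ℂ => y ^ 2) (2 * y₀) y₀ := by
    simpa using hasStrictDerivAt_pow 2 y₀
  have h2 : (2 * y₀ : ℂ) ≠ 0 := mul_ne_zero two_ne_zero h0
  exact ⟨_, (h.to_localInverse h2).hasDerivAt,
    (h.hasStrictFDerivAt_equiv h2).eventually_left_inverse⟩

/-- A continuous square root of a differentiable function is differentiable. -/
theorem hasFDerivAt_of_sq_eq {E : Type*} [NormedAddCommGroup E] [NormedSpace ℂ E] {y g : E → ℂ}
    {g' : E →L[ℂ] ℂ} {p : E} (hg : HasFDerivAt g g' p) (hy : ContinuousAt y p) (h0 : y p ≠ 0)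
    (hsq : ∀ᶠ q in 𝓝 p, y q ^ 2 = g q) : HasFDerivAt y ((2 * y p)⁻¹ • g') p := by
  obtain ⟨φ, hφ, hinv⟩ := exists_localSqrt h0
  rw [hsq.self_of_nhds] at hφ
  refine (hφ.comp_hasFDerivAt p hg).congr_of_eventuallyEq ?_
  filter_upwards [hy.eventually hinv, hsq] with q h1 h2
  rw [Function.comp_apply, ← h2, h1]

theorem hasDerivAt_of_sq_eq {𝕜 : Type*} [NontriviallyNormedField 𝕜] [NormedAlgebra 𝕜 ℂ]
    {y g : 𝕜 → ℂ} {g' : ℂ} {t : 𝕜} (hg : HasDerivAt g g' t) (hy : ContinuousAt y t)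
    (h0 : y t ≠ 0) (hsq : ∀ᶠ s in 𝓝 t, y s ^ 2 = g s) :
    HasDerivAt y ((2 * y t)⁻¹ * g') t := by
  obtain ⟨φ, hφ, hinv⟩ := exists_localSqrt h0
  rw [hsq.self_of_nhds] at hφ
  refine (HasDerivAt.comp t hφ hg).congr_of_eventuallyEq ?_
  filter_upwards [hy.eventually hinv, hsq] with q h1 h2
  rw [Function.comp_apply, ← h2, h1]

/-- Differentiation under the integral sign over a compact interval. -/
theorem hasFDerivAt_intervalIntegral_of_continuousOn {E : Type*} [NormedAddCommGroup E]
    [NormedSpace ℂ E] {U : Set E} (hU : IsOpen U) {F : E → ℝ → ℂ} {F' : E → ℝ → E →L[ℂ] ℂ}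
    (hF : ContinuousOn (Function.uncurry F) (U ×ˢ Set.univ))
    (hF' : ContinuousOn (Function.uncurry F') (U ×ˢ Set.univ))
    (h : ∀ p ∈ U, ∀ t, HasFDerivAt (fun q => F q t) (F' p t) p) (a b : ℝ) {p₀ : E}
    (hp₀ : p₀ ∈ U) :
    HasFDerivAt (fun p => ∫ t in a..b, F p t) (∫ t in a..b, F' p₀ t) p₀ := by
  have hFc : ∀ p ∈ U, Continuous (F p) := fun p hp =>
    continuousOn_univ.1 (hF.comp (f := fun t : ℝ => (p, t)) (by fun_prop) fun t _ => ⟨hp, trivial⟩)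
  have hFc' : ∀ p ∈ U, Continuous (F' p) := fun p hp =>
    continuousOn_univ.1 (hF'.comp (f := fun t : ℝ => (p, t)) (by fun_prop)
      fun t _ => ⟨hp, trivial⟩)
  obtain ⟨C, hC⟩ := isCompact_uIcc.exists_bound_of_continuousOn
    ((hFc' p₀ hp₀).continuousOn (s := Set.uIcc a b))
  -- by compactness of the interval, `F'` is bounded uniformly near `p₀`
  have hbd : ∀ᶠ p in 𝓝 p₀, ∀ t ∈ Set.uIcc a b, ‖F' p t‖ ≤ C + 1 := by
    refine isCompact_uIcc.eventually_forall_of_forall_eventually fun t ht => ?_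
    have hc : ContinuousAt (Function.uncurry F') (p₀, t) :=
      hF'.continuousAt ((hU.prod isOpen_univ).mem_nhds ⟨hp₀, trivial⟩)
    filter_upwards [hc.norm.eventually_lt_const (show ‖F' p₀ t‖ < C + 1 by linarith [hC t ht])]
      with z hz using hz.le
  have hUn := hU.mem_nhds hp₀
  refine intervalIntegral.hasFDerivAt_integral_of_dominated_of_fderiv_le (F' := F')
    (bound := fun _ => C + 1) (Filter.inter_mem hUn hbd) ?_ ((hFc p₀ hp₀).intervalIntegrable _ _)
    (hFc' p₀ hp₀).aestronglyMeasurable ?_ intervalIntegrable_const ?_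
  · filter_upwards [hUn] with p hp using (hFc p hp).aestronglyMeasurable
  · exact Eventually.of_forall fun t ht p hp => hp.2 t (Set.uIoc_subset_uIcc ht)
  · exact Eventually.of_forall fun t _ p hp => h p hp.1 t

theorem contDiffOn_intervalIntegral {E : Type*} [NormedAddCommGroup E]
    [NormedSpace ℂ E] {U : Set E} (hU : IsOpen U) {F : E → ℝ → ℂ} {F' : E → ℝ → E →L[ℂ] ℂ}
    (hF : ContinuousOn (Function.uncurry F) (U ×ˢ Set.univ))
    (hF' : ContinuousOn (Function.uncurry F') (U ×ˢ Set.univ))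
    (h : ∀ p ∈ U, ∀ t, HasFDerivAt (fun q => F q t) (F' p t) p) (a b : ℝ) :
    ContDiffOn ℂ 1 (fun p => ∫ t in a..b, F p t) U := by
  intro p hp
  refine ContDiffAt.contDiffWithinAt (contDiffAt_one_iff.2
    ⟨fun p => ∫ t in a..b, F' p t, U, hU.mem_nhds hp, ?_, fun q hq =>
      hasFDerivAt_intervalIntegral_of_continuousOn hU hF hF' h a b hq⟩)
  rw [continuousOn_iff_continuous_domRestrict]
  refine intervalIntegral.continuous_parametric_intervalIntegral_of_continuous'
    (f := fun (q : U) t => F' q t) ?_ a b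
  refine hF'.comp_continuous (f := fun z : U × ℝ => ((z.1 : E), z.2)) (by fun_prop)
    fun z => ⟨z.1.2, trivial⟩

/-! ### Families of polynomials -/

theorem IsC1Family.contDiff_eval {E : Type*} [NormedAddCommGroup E] [NormedSpace ℂ E]
    {P : E → ℂ[X]} (hP : IsC1Family P) : ContDiff ℂ 1 (fun p : E × ℂ => (P p.1).eval p.2) := by
  obtain ⟨K, hK⟩ := hP.1
  have h1 : (fun p : E × ℂ => (P p.1).eval p.2)
      = fun p => ∑ i ∈ Finset.range (K + 1), (P p.1).coeff i * p.2 ^ i :=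
    funext fun p => eval_eq_sum_range' (Nat.lt_succ_of_le (hK p.1)) _
  rw [h1]
  exact ContDiff.sum fun i _ => ((hP.2 i).comp contDiff_fst).mul (contDiff_snd.pow i)

/-- The derivative of `P_e(x)` with respect to the parameter `e`. -/
def evalDeriv {E : Type*} [NormedAddCommGroup E] [NormedSpace ℂ E] (P : E → ℂ[X]) (e : E)
    (x : ℂ) : E →L[ℂ] ℂ :=
  (fderiv ℂ (fun p : E × ℂ => (P p.1).eval p.2) (e, x)).comp (.inl ℂ E ℂ)

theorem IsC1Family.hasFDerivAt_eval {E : Type*} [NormedAddCommGroup E] [NormedSpace ℂ E]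
    {P : E → ℂ[X]} (hP : IsC1Family P) (e : E) (x : ℂ) :
    HasFDerivAt (fun e => (P e).eval x) (evalDeriv P e x) e := by
  have h1 : HasFDerivAt (fun e : E => (e, x)) (.inl ℂ E ℂ) e :=
    hasFDerivAt_prodMk_left e x
  exact ((hP.contDiff_eval.differentiable one_ne_zero (e, x)).hasFDerivAt).comp e h1

theorem IsC1Family.continuous_evalDeriv {E : Type*} [NormedAddCommGroup E] [NormedSpace ℂ E]
    {P : E → ℂ[X]} (hP : IsC1Family P) :
    Continuous (fun p : E × ℂ => evalDeriv P p.1 p.2) :=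
  (hP.contDiff_eval.continuous_fderiv one_ne_zero).clm_comp continuous_const

theorem IsC1Family.comp {E F : Type*} [NormedAddCommGroup E] [NormedSpace ℂ E]
    [NormedAddCommGroup F] [NormedSpace ℂ F] {P : E → ℂ[X]} (hP : IsC1Family P) {g : F → E}
    (hg : ContDiff ℂ 1 g) : IsC1Family (fun e => P (g e)) :=
  ⟨hP.1.imp fun _ hK _ => hK _, fun i => (hP.2 i).comp hg⟩

theorem IsC1Family.mul {E : Type*} [NormedAddCommGroup E] [NormedSpace ℂ E] {P R : E → ℂ[X]}
    (hP : IsC1Family P) (hR : IsC1Family R) : IsC1Family (fun e => P e * R e) := by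
  obtain ⟨K, hK⟩ := hP.1
  obtain ⟨L, hL⟩ := hR.1
  refine ⟨⟨K + L, fun e => natDegree_mul_le.trans (add_le_add (hK e) (hL e))⟩, fun i => ?_⟩
  simp only [coeff_mul]
  exact ContDiff.sum fun p _ => (hP.2 p.1).mul (hR.2 p.2)

theorem IsC1Family.add {E : Type*} [NormedAddCommGroup E] [NormedSpace ℂ E] {P R : E → ℂ[X]}
    (hP : IsC1Family P) (hR : IsC1Family R) : IsC1Family (fun e => P e + R e) := by
  obtain ⟨K, hK⟩ := hP.1
  obtain ⟨L, hL⟩ := hR.1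
  refine ⟨⟨max K L, fun e => (natDegree_add_le _ _).trans (max_le_max (hK e) (hL e))⟩,
    fun i => ?_⟩
  simp only [coeff_add]
  exact (hP.2 i).add (hR.2 i)

theorem isC1Family_const {E : Type*} [NormedAddCommGroup E] [NormedSpace ℂ E] (P : ℂ[X]) :
    IsC1Family (fun _ : E => P) := ⟨⟨_, fun _ => le_rfl⟩, fun _ => contDiff_const⟩

theorem isC1Family_C {E : Type*} [NormedAddCommGroup E] [NormedSpace ℂ E] {a : E → ℂ}
    (ha : ContDiff ℂ 1 a) : IsC1Family (fun e => Polynomial.C (a e)) := by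
  refine ⟨⟨0, fun _ => (natDegree_C _).le⟩, fun i => ?_⟩
  simp only [coeff_C]
  split_ifs
  · exact ha
  · exact contDiff_const

theorem isC1Family_sum {E ι : Type*} [NormedAddCommGroup E] [NormedSpace ℂ E] (s : Finset ι)
    {P : ι → E → ℂ[X]} (hP : ∀ i, IsC1Family (P i)) : IsC1Family (fun e => ∑ i ∈ s, P i e) := by
  classical
  induction s using Finset.induction_on with
  | empty => simpa using isC1Family_const 0
  | insert i s hi ih => simpa only [Finset.sum_insert hi] using (hP i).add ih

theorem isC1Family_curvePoly (G : GaugeGroup) {N : ℕ} (μ : ℂ) :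
    IsC1Family (fun u : Fin N → ℂ => curvePoly G μ u) := by
  have hq := isC1Family_charPoly (N := N)
  cases G with
  | SOodd =>
    have := (hq.mul hq).add (isC1Family_const (-(Polynomial.C (4 * μ ^ 2) * X ^ 2)))
    simpa only [curvePoly, sq, sub_eq_add_neg] using this
  | Sp => exact hq.mul (((isC1Family_const _).mul hq).add (isC1Family_const _))

theorem isC1Family_wNum (G : GaugeGroup) {N : ℕ} :
    IsC1Family (fun u : Fin N → ℂ => wNum G (charPoly u)) := by
  have hq := isC1Family_charPoly (N := N)
  refine IsC1Family.add ?_ ((isC1Family_const _).mul hq)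
  obtain ⟨K, hK⟩ := hq.1
  refine ⟨⟨K, fun e => ?_⟩, fun i => ?_⟩
  · rw [natDegree_le_iff_coeff_eq_zero]
    intro i hi
    rw [coeff_X_mul_derivative, coeff_eq_zero_of_natDegree_lt ((hK e).trans_lt hi), mul_zero]
  · simp only [coeff_X_mul_derivative]
    exact contDiff_const.mul (hq.2 i)

theorem natDegree_redX_le (G : GaugeGroup) (P : ℂ[X]) : (redX G P).natDegree ≤ P.natDegree := by
  cases G
  · simp only [redX, natDegree_divX_eq_natDegree_tsub_one]
    exact Nat.sub_le _ _
  · exact le_rfl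

theorem IsC1Family.redX (G : GaugeGroup) {E : Type*} [NormedAddCommGroup E] [NormedSpace ℂ E]
    {P : E → ℂ[X]} (hP : IsC1Family P) : IsC1Family (fun e => redX G (P e)) := by
  refine ⟨hP.1.imp fun _ hK e => (natDegree_redX_le G _).trans (hK e), fun i => ?_⟩
  cases G
  · simp only [SeibergWitten.redX, coeff_divX]
    exact hP.2 _
  · exact hP.2 i

/-! ### Differentiation of periods -/

namespace CycleFamily

variable {G : GaugeGroup} {N : ℕ} {μ : ℂ} {U : Set (Fin N → ℂ)} (A : CycleFamily G μ U)

theorem continuous_deriv_x : Continuous (deriv A.x) :=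
  A.contDiff_x.continuous_deriv le_rfl

theorem hasDerivAt_x (t : ℝ) : HasDerivAt A.x (deriv A.x t) t :=
  (A.contDiff_x.differentiable one_ne_zero t).hasDerivAt

theorem continuous_y {u : Fin N → ℂ} (hu : u ∈ U) : Continuous (A.y u) :=
  continuousOn_univ.1 (A.continuousOn_y.comp (f := fun t : ℝ => (u, t)) (by fun_prop)
    fun _ _ => ⟨hu, trivial⟩)

theorem continuousAt_y (hU : IsOpen U) {u : Fin N → ℂ} (hu : u ∈ U) (t : ℝ) :
    ContinuousAt (fun v => A.y v t) u :=
  (A.continuousOn_y.continuousAt ((hU.prod isOpen_univ).mem_nhds ⟨hu, trivial⟩)).comp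
    (f := fun v => (v, t)) (by fun_prop)

theorem hasDerivAt_y {u : Fin N → ℂ} (hu : u ∈ U) (t : ℝ) : HasDerivAt (A.y u)
    ((2 * A.y u t)⁻¹ * ((derivative (curvePoly G μ u)).eval (A.x t) * deriv A.x t)) t :=
  hasDerivAt_of_sq_eq (HasDerivAt.comp t ((curvePoly G μ u).hasDerivAt (A.x t)) (A.hasDerivAt_x t))
    (A.continuous_y hu).continuousAt (A.y_ne_zero u hu t)
    (Eventually.of_forall fun s => A.mem_curve u hu s)

theorem period_polyDiff (u : Fin N → ℂ) (p : ℂ[X]) :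
    (A.at u).period (polyDiff p) = ∫ t in (0 : ℝ)..1, p.eval (A.x t) / A.y u t * deriv A.x t := by
  simp only [Loop.period, CycleFamily.at, polyDiff_fn]

theorem continuous_integrand {u : Fin N → ℂ} (hu : u ∈ U) (p : ℂ[X]) :
    Continuous fun t => p.eval (A.x t) / A.y u t * deriv A.x t :=
  ((p.continuous.comp A.contDiff_x.continuous).div (A.continuous_y hu)
    (A.y_ne_zero u hu)).mul A.continuous_deriv_x

theorem period_add {u : Fin N → ℂ} (hu : u ∈ U) (p q : ℂ[X]) :
    (A.at u).period (polyDiff (p + q))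
      = (A.at u).period (polyDiff p) + (A.at u).period (polyDiff q) := by
  simp only [period_polyDiff]
  rw [← intervalIntegral.integral_add ((A.continuous_integrand hu p).intervalIntegrable _ _)
    ((A.continuous_integrand hu q).intervalIntegrable _ _)]
  refine intervalIntegral.integral_congr fun t _ => ?_
  simp only [eval_add]
  ring

theorem period_C_mul (u : Fin N → ℂ) (a : ℂ) (p : ℂ[X]) :
    (A.at u).period (polyDiff (Polynomial.C a * p)) = a * (A.at u).period (polyDiff p) := by
  simp only [period_polyDiff]
  rw [← intervalIntegral.integral_const_mul]
  refine intervalIntegral.integral_congr fun t _ => ?_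
  simp only [eval_mul, eval_C]
  ring

theorem continuous_exact {u : Fin N → ℂ} (hu : u ∈ U) (E : ℂ[X]) :
    Continuous fun t => ((derivative E).eval (A.x t) / A.y u t
      - E.eval (A.x t) * (derivative (curvePoly G μ u)).eval (A.x t) / (2 * A.y u t ^ 3))
        * deriv A.x t := by
  have hx := A.contDiff_x.continuous
  have hy := A.continuous_y hu
  have h0 := A.y_ne_zero u hu
  refine Continuous.mul (Continuous.sub (((derivative E).continuous.comp hx).div hy h0)
    (Continuous.div (((E.continuous.comp hx)).mul ((derivative _).continuous.comp hx))
      (continuous_const.mul (hy.pow 3)) fun t => ?_)) A.continuous_deriv_x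
  exact mul_ne_zero two_ne_zero (pow_ne_zero 3 (h0 t))

/-- The differential of `E(x)/y` has vanishing periods. -/
theorem integral_exact {u : Fin N → ℂ} (hu : u ∈ U) (E : ℂ[X]) :
    ∫ t in (0 : ℝ)..1, ((derivative E).eval (A.x t) / A.y u t
      - E.eval (A.x t) * (derivative (curvePoly G μ u)).eval (A.x t) / (2 * A.y u t ^ 3))
        * deriv A.x t = 0 := by
  have hd : ∀ t, HasDerivAt (fun t => E.eval (A.x t) / A.y u t)
      (((derivative E).eval (A.x t) / A.y u t
        - E.eval (A.x t) * (derivative (curvePoly G μ u)).eval (A.x t) / (2 * A.y u t ^ 3))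
          * deriv A.x t) t := fun t => by
    have h0 := A.y_ne_zero u hu t
    refine ((HasDerivAt.comp t (E.hasDerivAt (A.x t)) (A.hasDerivAt_x t)).fun_div
      (A.hasDerivAt_y hu t) h0).congr_deriv ?_
    simp only [Function.comp_apply]
    field_simp
  rw [intervalIntegral.integral_eq_sub_of_hasDerivAt (fun t _ => hd t)
    ((A.continuous_exact hu E).intervalIntegrable _ _)]
  have h1 := A.periodic_x 0
  have h2 := A.periodic_y u hu 0
  rw [zero_add] at h1 h2
  rw [h1, h2, sub_self]

variable {M : ℕ}

/-- The derivative in `(u, T)` of the integrand `P(x(t)) x'(t) / y(t)` of a period; the derivative of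
`1/y` is `-f' / 2y³`. -/
def integrandDeriv (P : (Fin N → ℂ) × (Fin M → ℂ) → ℂ[X]) (p : (Fin N → ℂ) × (Fin M → ℂ))
    (t : ℝ) : (Fin N → ℂ) × (Fin M → ℂ) →L[ℂ] ℂ :=
  deriv A.x t • ((A.y p.1 t)⁻¹ • evalDeriv P p (A.x t) -
    ((P p).eval (A.x t) * (2 * A.y p.1 t ^ 3)⁻¹) •
      evalDeriv (fun p : (Fin N → ℂ) × (Fin M → ℂ) => curvePoly G μ p.1) p (A.x t))

theorem isC1Family_curve : IsC1Family
    (fun p : (Fin N → ℂ) × (Fin M → ℂ) => curvePoly G μ p.1) :=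
  (isC1Family_curvePoly G μ).comp contDiff_fst

theorem hasFDerivAt_integrand (hU : IsOpen U) {P : (Fin N → ℂ) × (Fin M → ℂ) → ℂ[X]}
    (hP : IsC1Family P) {p : (Fin N → ℂ) × (Fin M → ℂ)} (hp : p ∈ U ×ˢ Set.univ) (t : ℝ) :
    HasFDerivAt (fun q : (Fin N → ℂ) × (Fin M → ℂ) =>
      (P q).eval (A.x t) / A.y q.1 t * deriv A.x t) (A.integrandDeriv P p t) p := by
  have h0 := A.y_ne_zero p.1 hp.1 t
  have hy := hasFDerivAt_of_sq_eq (y := fun q : (Fin N → ℂ) × (Fin M → ℂ) => A.y q.1 t)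
    (isC1Family_curve.hasFDerivAt_eval p (A.x t))
    (ContinuousAt.comp (f := Prod.fst) (A.continuousAt_y hU hp.1 t) continuousAt_fst) h0 (by
      filter_upwards [(hU.prod isOpen_univ).mem_nhds hp] with q hq using A.mem_curve q.1 hq.1 t)
  have hi := (hasDerivAt_inv h0).comp_hasFDerivAt p hy
  refine (((hP.hasFDerivAt_eval p (A.x t)).fun_mul hi).mul_const (deriv A.x t)).congr_fderiv ?_
  ext v <;>
  · simp [integrandDeriv]
    field_simp
    ring

theorem continuousOn_y_prod : ContinuousOn
    (fun z : ((Fin N → ℂ) × (Fin M → ℂ)) × ℝ => A.y z.1.1 z.2)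
      ((U ×ˢ Set.univ) ×ˢ Set.univ) :=
  A.continuousOn_y.comp (f := fun z : ((Fin N → ℂ) × (Fin M → ℂ)) × ℝ => (z.1.1, z.2))
    (by fun_prop) fun _ hz => ⟨hz.1.1, trivial⟩

theorem continuousOn_integrand {P : (Fin N → ℂ) × (Fin M → ℂ) → ℂ[X]} (hP : IsC1Family P) :
    ContinuousOn (Function.uncurry fun (q : (Fin N → ℂ) × (Fin M → ℂ)) (t : ℝ) =>
      (P q).eval (A.x t) / A.y q.1 t * deriv A.x t) ((U ×ˢ Set.univ) ×ˢ Set.univ) := by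
  have hx := A.contDiff_x.continuous
  have hx' := A.continuous_deriv_x
  have hE : Continuous fun z : ((Fin N → ℂ) × (Fin M → ℂ)) × ℝ => (P z.1).eval (A.x z.2) :=
    hP.contDiff_eval.continuous.comp (continuous_fst.prodMk (hx.comp continuous_snd))
  exact (hE.continuousOn.div A.continuousOn_y_prod fun z hz => A.y_ne_zero _ hz.1.1 _).mul
    (hx'.comp continuous_snd).continuousOn

theorem continuousOn_integrandDeriv {P : (Fin N → ℂ) × (Fin M → ℂ) → ℂ[X]}
    (hP : IsC1Family P) :
    ContinuousOn (Function.uncurry (A.integrandDeriv P)) ((U ×ˢ Set.univ) ×ˢ Set.univ) := by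
  have hx := A.contDiff_x.continuous
  have hx' := A.continuous_deriv_x
  have hpair : Continuous fun z : ((Fin N → ℂ) × (Fin M → ℂ)) × ℝ => (z.1, A.x z.2) :=
    continuous_fst.prodMk (hx.comp continuous_snd)
  have hE := (hP.contDiff_eval.continuous.comp hpair).continuousOn
    (s := (U ×ˢ Set.univ) ×ˢ Set.univ)
  have hE' := (hP.continuous_evalDeriv.comp hpair).continuousOn
    (s := (U ×ˢ Set.univ) ×ˢ Set.univ)
  have hF' := ((isC1Family_curve (G := G) (μ := μ)).continuous_evalDeriv.comp
    hpair).continuousOn (s := (U ×ˢ Set.univ) ×ˢ Set.univ)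
  have hy := A.continuousOn_y_prod (M := M)
  have h0 : ∀ z ∈ ((U ×ˢ Set.univ) ×ˢ Set.univ : Set (((Fin N → ℂ) × (Fin M → ℂ)) × ℝ)),
      A.y z.1.1 z.2 ≠ 0 := fun z hz => A.y_ne_zero _ hz.1.1 _
  refine (hx'.comp continuous_snd).continuousOn.smul (((hy.inv₀ h0).smul hE').sub
    ((hE.mul (ContinuousOn.inv₀ (continuousOn_const.mul (hy.pow 3)) fun z hz => ?_)).smul hF'))
  exact mul_ne_zero two_ne_zero (pow_ne_zero 3 (h0 z hz))

/-- Periods are continuously differentiable functions of the moduli. -/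
theorem contDiffOn_period (hU : IsOpen U) {P : (Fin N → ℂ) × (Fin M → ℂ) → ℂ[X]}
    (hP : IsC1Family P) :
    ContDiffOn ℂ 1 (fun p => (A.at p.1).period (polyDiff (P p))) (U ×ˢ Set.univ) := by
  simp only [period_polyDiff]
  exact contDiffOn_intervalIntegral (hU.prod isOpen_univ) (A.continuousOn_integrand hP)
    (A.continuousOn_integrandDeriv hP) (fun p hp t => A.hasFDerivAt_integrand hU hP hp t) 0 1

/-- The derivative of a period along a path in the space of moduli. -/
theorem hasDerivAt_period (hU : IsOpen U) {P : (Fin N → ℂ) × (Fin M → ℂ) → ℂ[X]}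
    (hP : IsC1Family P) {p : ℂ → (Fin N → ℂ) × (Fin M → ℂ)} {p' : (Fin N → ℂ) × (Fin M → ℂ)}
    {s₀ : ℂ} (hp : HasDerivAt p p' s₀) (hpU : (p s₀).1 ∈ U) {L' f' : ℂ[X]}
    (hL : HasPolyDerivAt (fun s => P (p s)) L' s₀)
    (hf : HasPolyDerivAt (fun s => curvePoly G μ (p s).1) f' s₀) :
    HasDerivAt (fun s => (A.at (p s).1).period (polyDiff (P (p s))))
      (∫ t in (0 : ℝ)..1, (L'.eval (A.x t) / A.y (p s₀).1 t
        - (P (p s₀)).eval (A.x t) * f'.eval (A.x t) / (2 * A.y (p s₀).1 t ^ 3))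
          * deriv A.x t) s₀ := by
  have hmem : p s₀ ∈ U ×ˢ (Set.univ : Set (Fin M → ℂ)) := ⟨hpU, trivial⟩
  have h1 := (hasFDerivAt_intervalIntegral_of_continuousOn (hU.prod isOpen_univ)
    (A.continuousOn_integrand hP) (A.continuousOn_integrandDeriv hP)
    (fun p hp t => A.hasFDerivAt_integrand hU hP hp t) 0 1 hmem).comp_hasDerivAt s₀ hp
  simp only [period_polyDiff]
  refine h1.congr_deriv ?_
  have hc : Continuous (A.integrandDeriv P (p s₀)) :=
    continuousOn_univ.1 ((A.continuousOn_integrandDeriv hP).comp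
      (f := fun t : ℝ => (p s₀, t)) (by fun_prop) fun _ _ => ⟨hmem, trivial⟩)
  rw [ContinuousLinearMap.intervalIntegral_apply (hc.intervalIntegrable 0 1)]
  refine intervalIntegral.integral_congr fun t _ => ?_
  have hL1 := (hL.eval (hasDerivAt_const s₀ (A.x t))).unique
    ((hP.hasFDerivAt_eval (p s₀) (A.x t)).comp_hasDerivAt s₀ hp)
  have hf1 := (hf.eval (hasDerivAt_const s₀ (A.x t))).unique
    ((isC1Family_curve.hasFDerivAt_eval (p s₀) (A.x t)).comp_hasDerivAt s₀ hp)
  rw [mul_zero, add_zero] at hL1 hf1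
  simp only [integrandDeriv, hL1, hf1]
  simp
  ring

/-- If the derivative of the integrand is that of `p dx/y` up to an exact differential
`d(E(x)/y)`, then the derivative of the period is the period of `p dx/y`. -/
theorem integral_eq_period {u : Fin N → ℂ} (hu : u ∈ U) {L L' f' p E : ℂ[X]}
    (h : 2 * curvePoly G μ u * L' - L * f' = 2 * curvePoly G μ u * p +
      2 * curvePoly G μ u * derivative E - E * derivative (curvePoly G μ u)) :
    ∫ t in (0 : ℝ)..1, (L'.eval (A.x t) / A.y u t
      - L.eval (A.x t) * f'.eval (A.x t) / (2 * A.y u t ^ 3)) * deriv A.x t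
      = (A.at u).period (polyDiff p) := by
  have hE := A.integral_exact hu E
  rw [period_polyDiff, ← add_zero (∫ t in (0 : ℝ)..1, p.eval (A.x t) / A.y u t * deriv A.x t),
    ← hE, ← intervalIntegral.integral_add ((A.continuous_integrand hu p).intervalIntegrable _ _)
      ((A.continuous_exact hu E).intervalIntegrable _ _)]
  refine intervalIntegral.integral_congr fun t _ => ?_
  have h1 := congrArg (Polynomial.eval (A.x t)) h
  simp only [eval_add, eval_sub, eval_mul, eval_ofNat, ← A.mem_curve u hu t] at h1
  have h0 := A.y_ne_zero u hu t
  field_simp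
  linear_combination deriv A.x t * h1

end CycleFamily

/-! ### Parity -/

/-- A polynomial is even if its coefficients of odd index vanish. -/
def IsEvenPoly (P : ℂ[X]) : Prop := ∀ i, Odd i → P.coeff i = 0

theorem IsOddPoly.mul_even {P Q : ℂ[X]} (hP : IsOddPoly P) (hQ : IsEvenPoly Q) :
    IsOddPoly (P * Q) := by
  intro i hi
  rw [coeff_mul]
  refine Finset.sum_eq_zero fun p hp => ?_
  rw [Finset.HasAntidiagonal.mem_antidiagonal] at hp
  rcases Nat.even_or_odd p.1 with h | h
  · rw [hP _ h, zero_mul]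
  · rw [hQ p.2 ?_, mul_zero]
    rw [← hp, Nat.even_add'] at hi
    exact hi.1 h

theorem IsOddPoly.X_mul_derivative {P : ℂ[X]} (hP : IsOddPoly P) :
    IsOddPoly (X * derivative P) := fun i hi => by
  rw [coeff_X_mul_derivative, hP i hi, mul_zero]

theorem IsOddPoly.sub {P Q : ℂ[X]} (hP : IsOddPoly P) (hQ : IsOddPoly Q) : IsOddPoly (P - Q) :=
  fun i hi => by rw [coeff_sub, hP i hi, hQ i hi, sub_zero]

theorem isEvenPoly_charDot {N : ℕ} (w : Fin N → ℂ) : IsEvenPoly (charDot w) := by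
  intro i hi
  have := isOddPoly_oddPoly w (i + 1) hi.add_one
  rwa [oddPoly, coeff_neg, coeff_X_mul, neg_eq_zero] at this

theorem charPoly_eq_add_charDot {N : ℕ} (u : Fin N → ℂ) :
    charPoly u = X ^ (2 * N) + charDot u := by
  rw [charPoly, charDot, sub_eq_add_neg]

theorem isEvenPoly_charPoly {N : ℕ} (u : Fin N → ℂ) : IsEvenPoly (charPoly u) := by
  intro i hi
  rw [charPoly_eq_add_charDot, coeff_add, isEvenPoly_charDot u i hi, coeff_X_pow, if_neg, add_zero]
  rintro rfl
  exact Nat.not_odd_iff_even.2 (even_two_mul N) hi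

theorem IsEvenPoly.wNum (G : GaugeGroup) {q : ℂ[X]} (hq : IsEvenPoly q) :
    IsEvenPoly (wNum G q) := by
  intro i hi
  rw [SeibergWitten.wNum, coeff_add, coeff_X_mul_derivative, coeff_C_mul, hq i hi, mul_zero,
    mul_zero, add_zero]

theorem isOddPoly_varNum (G : GaugeGroup) {q R R' e : ℂ[X]} (hq : IsEvenPoly q)
    (hR : IsOddPoly R) (hR' : IsOddPoly R') (he : IsEvenPoly e) :
    IsOddPoly (varNum G q R R' e) :=
  (hR'.mul_even (hq.wNum G)).sub (hR.X_mul_derivative.mul_even he)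

/-! ### The differentials `R dz/z` in polynomial form -/

theorem polyDiff_add (p q : ℂ[X]) : polyDiff (p + q) = polyDiff p + polyDiff q := by
  simp [polyDiff]

theorem polyDiff_C_mul (a : ℂ) (p : ℂ[X]) : polyDiff (Polynomial.C a * p) = a • polyDiff p := by
  simp only [polyDiff, map_mul, RatFunc.algebraMap_C, Prod.smul_mk, smul_zero,
    RatFunc.smul_eq_C_mul]

theorem mulDLogZ_add (G : GaugeGroup) {N : ℕ} (u : Fin N → ℂ) (P R : ℂ[X]) :
    mulDLogZ G u (P + R) = mulDLogZ G u P + mulDLogZ G u R := by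
  simp only [mulDLogZ, map_add, add_mul, Prod.mk_add_mk, add_zero]

theorem mulDLogZ_C_mul (G : GaugeGroup) {N : ℕ} (u : Fin N → ℂ) (a : ℂ) (R : ℂ[X]) :
    mulDLogZ G u (Polynomial.C a * R) = a • mulDLogZ G u R := by
  simp only [mulDLogZ, map_mul, RatFunc.algebraMap_C, Prod.smul_mk, smul_zero,
    RatFunc.smul_eq_C_mul, mul_assoc]

theorem mulDLogZ_zero (G : GaugeGroup) {N : ℕ} (u : Fin N → ℂ) :
    mulDLogZ G u 0 = 0 := by
  simp only [mulDLogZ, map_zero, zero_mul, Prod.mk_zero_zero]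

theorem dS_eq_sum (G : GaugeGroup) {N M : ℕ} (μ : ℂ) (u : Fin N → ℂ) (t : Fin M → ℂ) :
    dS G μ u t = ∑ n : Fin M, t n • dOmegaHat G μ u (n.val + 1) := by
  simp only [dS, dSPoly, dOmegaHat, ← mulDLogZ_C_mul]
  induction (Finset.univ : Finset (Fin M)) using Finset.induction_on with
  | empty => simp [mulDLogZ_zero]
  | insert i s hi ih => rw [Finset.sum_insert hi, Finset.sum_insert hi, mulDLogZ_add, ih]

theorem mulDLogZ_eq_polyDiff (G : GaugeGroup) {N : ℕ} (u : Fin N → ℂ) {R : ℂ[X]}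
    (hR : IsOddPoly R) :
    mulDLogZ G u R = polyDiff (redX G (R * wNum G (charPoly u))) := by
  have hodd := hR.mul_even ((isEvenPoly_charPoly u).wNum G)
  cases G with
  | SOodd =>
    simp only [mulDLogZ, polyDiff, redX]
    refine Prod.ext rfl ?_
    simp only
    rw [← mul_div_assoc, div_eq_iff (RatFunc.X_ne_zero : (RatFunc.X : RatFunc ℂ) ≠ 0), ← RatFunc.algebraMap_X, ← map_mul,
      ← map_mul, mul_comm (divX _), hodd.X_mul_divX]
    simp [wNum, wConst, sub_eq_add_neg]
  | Sp =>
    simp only [mulDLogZ, polyDiff, redX, ← map_mul, wNum, wConst, map_ofNat]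

theorem isOddPoly_dSPoly (G : GaugeGroup) {N : ℕ} (hN : 1 ≤ N) (μ : ℂ) {M : ℕ} (u : Fin N → ℂ)
    (t : Fin M → ℂ) : IsOddPoly (dSPoly G μ u t) :=
  isOddPoly_sum _ fun n _ => (isOddPoly_whithamPoly G hN μ u (Nat.le_add_left 1 n.val)).C_mul _

/-- The polynomial `p` with `dS = p dx/y`. -/
def dSForm (G : GaugeGroup) {N M : ℕ} (μ : ℂ) (p : (Fin N → ℂ) × (Fin M → ℂ)) : ℂ[X] :=
  redX G (dSPoly G μ p.1 p.2 * wNum G (charPoly p.1))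

theorem dS_eq_polyDiff (G : GaugeGroup) {N : ℕ} (hN : 1 ≤ N) (μ : ℂ) {M : ℕ} (u : Fin N → ℂ)
    (t : Fin M → ℂ) : dS G μ u t = polyDiff (dSForm G μ (u, t)) :=
  mulDLogZ_eq_polyDiff G u (isOddPoly_dSPoly G hN μ u t)

theorem isC1Family_dSForm (G : GaugeGroup) {N : ℕ} (hN : 1 ≤ N) (μ : ℂ) (M : ℕ) :
    IsC1Family (fun p : (Fin N → ℂ) × (Fin M → ℂ) => dSForm G μ p) := by
  refine IsC1Family.redX G (IsC1Family.mul (isC1Family_sum _ fun n => ?_)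
    ((isC1Family_wNum G).comp contDiff_fst))
  exact (isC1Family_C (contDiff_apply ℂ ℂ n |>.comp contDiff_snd)).mul
    ((isC1Family_whithamPoly G hN μ _).comp contDiff_fst)

/-! ### Variation of `dS` -/

theorem HasPolyDerivAt.mul {P R : ℂ → ℂ[X]} {P' R' : ℂ[X]} {s₀ : ℂ} (hP : HasPolyDerivAt P P' s₀)
    (hR : HasPolyDerivAt R R' s₀) :
    HasPolyDerivAt (fun s => P s * R s) (P' * R s₀ + P s₀ * R') s₀ := by
  obtain ⟨K, hK⟩ := hP.1
  obtain ⟨L, hL⟩ := hR.1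
  refine ⟨⟨K + L, fun e => natDegree_mul_le.trans (add_le_add (hK e) (hL e))⟩, fun i => ?_⟩
  simp only [coeff_add, coeff_mul, ← Finset.sum_add_distrib]
  exact HasDerivAt.fun_sum fun p _ => (hP.2 p.1).mul (hR.2 p.2)

theorem HasPolyDerivAt.add {P R : ℂ → ℂ[X]} {P' R' : ℂ[X]} {s₀ : ℂ} (hP : HasPolyDerivAt P P' s₀)
    (hR : HasPolyDerivAt R R' s₀) : HasPolyDerivAt (fun s => P s + R s) (P' + R') s₀ := by
  obtain ⟨K, hK⟩ := hP.1
  obtain ⟨L, hL⟩ := hR.1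
  refine ⟨⟨max K L, fun e => (natDegree_add_le _ _).trans (max_le_max (hK e) (hL e))⟩,
    fun i => ?_⟩
  simp only [coeff_add]
  exact (hP.2 i).add (hR.2 i)

theorem hasPolyDerivAt_const (P : ℂ[X]) (s₀ : ℂ) : HasPolyDerivAt (fun _ => P) 0 s₀ :=
  ⟨⟨_, fun _ => le_rfl⟩, fun i => by simpa using hasDerivAt_const s₀ (P.coeff i)⟩

theorem hasPolyDerivAt_C {a : ℂ → ℂ} {a' s₀ : ℂ} (ha : HasDerivAt a a' s₀) :
    HasPolyDerivAt (fun s => Polynomial.C (a s)) (Polynomial.C a') s₀ := by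
  refine ⟨⟨0, fun _ => (natDegree_C _).le⟩, fun i => ?_⟩
  simp only [coeff_C]
  split_ifs
  · exact ha
  · exact hasDerivAt_const _ _

theorem hasPolyDerivAt_sum {ι : Type*} (s : Finset ι) {P : ι → ℂ → ℂ[X]} {P' : ι → ℂ[X]} {s₀ : ℂ}
    (hP : ∀ i, HasPolyDerivAt (P i) (P' i) s₀) :
    HasPolyDerivAt (fun r => ∑ i ∈ s, P i r) (∑ i ∈ s, P' i) s₀ := by
  classical
  induction s using Finset.induction_on with
  | empty => simpa using hasPolyDerivAt_const 0 s₀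
  | insert i s hi ih => simpa only [Finset.sum_insert hi] using (hP i).add ih

theorem HasPolyDerivAt.wNum (G : GaugeGroup) {q : ℂ → ℂ[X]} {e : ℂ[X]} {s₀ : ℂ}
    (hq : HasPolyDerivAt q e s₀) :
    HasPolyDerivAt (fun s => wNum G (q s)) (wNum G e) s₀ := by
  obtain ⟨K, hK⟩ := hq.1
  have h : ∀ (p : ℂ[X]) (i : ℕ), (SeibergWitten.wNum G p).coeff i
      = (i + wConst G) * p.coeff i := fun p i => by
    rw [SeibergWitten.wNum, coeff_add, coeff_X_mul_derivative, coeff_C_mul, add_mul]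
  refine ⟨⟨K, fun s => ?_⟩, fun i => ?_⟩
  · rw [natDegree_le_iff_coeff_eq_zero]
    intro i hi
    rw [h, coeff_eq_zero_of_natDegree_lt ((hK s).trans_lt hi), mul_zero]
  · simp only [h]
    exact (hq.2 i).const_mul _

theorem HasPolyDerivAt.redX (G : GaugeGroup) {P : ℂ → ℂ[X]} {P' : ℂ[X]} {s₀ : ℂ}
    (hP : HasPolyDerivAt P P' s₀) : HasPolyDerivAt (fun s => redX G (P s)) (redX G P') s₀ := by
  refine ⟨hP.1.imp fun _ hK e => (natDegree_redX_le G _).trans (hK e), fun i => ?_⟩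
  cases G
  · simp only [SeibergWitten.redX, coeff_divX]
    exact hP.2 _
  · exact hP.2 i

/-- The velocity of the curve polynomial `f`, if `q` moves with velocity `e`. -/
def curveDot (G : GaugeGroup) (μ : ℂ) (q e : ℂ[X]) : ℂ[X] :=
  match G with
  | .SOodd => 2 * q * e
  | .Sp => e * (X ^ 2 * q + Polynomial.C (4 * μ)) + q * (X ^ 2 * e)

theorem hasPolyDerivAt_curvePoly (G : GaugeGroup) {N : ℕ} (μ : ℂ) {u : ℂ → Fin N → ℂ}
    {w : Fin N → ℂ} {s₀ : ℂ} (hu : HasDerivAt u w s₀) :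
    HasPolyDerivAt (fun s => curvePoly G μ (u s))
      (curveDot G μ (charPoly (u s₀)) (charDot w)) s₀ := by
  have hq := hasPolyDerivAt_charPoly hu
  cases G with
  | SOodd =>
    have h := (hq.mul hq).add (hasPolyDerivAt_const (-(Polynomial.C (4 * μ ^ 2) * X ^ 2)) s₀)
    simp only [curvePoly, sub_eq_add_neg, sq (charPoly _)]
    convert h using 1
    simp only [curveDot]
    ring
  | Sp =>
    have h := hq.mul (((hasPolyDerivAt_const (X ^ 2) s₀).mul hq).add
      (hasPolyDerivAt_const (Polynomial.C (4 * μ)) s₀))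
    simp only [curvePoly]
    convert h using 1
    simp only [curveDot]
    ring

/-- The function `E(x)` such that the variation at constant `x` and the variation at constant `z`
of `R dz/z` differ by `d(E(x)/y)`. -/
def exactNum (G : GaugeGroup) (R e : ℂ[X]) : ℂ[X] :=
  match G with
  | .SOodd => R * e
  | .Sp => R * (X * e)

/-- The variations of `R dz/z` at constant `x` and at constant `z` differ by an exact
differential. -/
theorem variation_identity (G : GaugeGroup) {N : ℕ} (μ : ℂ) (u : Fin N → ℂ) {R R' e : ℂ[X]}
    (hR : IsOddPoly R) (hR' : IsOddPoly R') (he : IsEvenPoly e) :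
    2 * curvePoly G μ u * redX G (R' * wNum G (charPoly u) + R * wNum G e)
        - redX G (R * wNum G (charPoly u)) * curveDot G μ (charPoly u) e
      = 2 * curvePoly G μ u * redX G (varNum G (charPoly u) R R' e)
        + 2 * curvePoly G μ u * derivative (exactNum G R e)
        - exactNum G R e * derivative (curvePoly G μ u) := by
  have hq := isEvenPoly_charPoly u
  cases G with
  | SOodd =>
    have h1 := ((hR'.mul_even (hq.wNum .SOodd)).add (hR.mul_even (he.wNum .SOodd))).X_mul_divX
    have h2 := (hR.mul_even (hq.wNum .SOodd)).X_mul_divX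
    have h3 := (isOddPoly_varNum .SOodd hq hR hR' he).X_mul_divX
    -- after multiplication by `x` the quotients `divX` can be expanded
    refine mul_left_cancel₀ (X_ne_zero (R := ℂ)) ?_
    have hl : ∀ a b c d : ℂ[X], X * (a * b - c * d) = a * (X * b) - X * c * d := by
      intros
      ring
    have hr : ∀ a b c d : ℂ[X], X * (a * b + c - d) = a * (X * b) + X * (c - d) := by
      intros
      ring
    simp only [redX]
    rw [hl, hr, h1, h2, h3]
    simp only [varNum, wNum, wConst, curvePoly, curveDot, exactNum, derivative_mul,
      derivative_sub, derivative_pow, derivative_C, derivative_X, map_neg, map_one, map_mul,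
      map_pow, Nat.cast_ofNat, map_ofNat, derivative_ofNat]
    ring
  | Sp =>
    simp only [redX, varNum, wNum, wConst, curvePoly, curveDot, exactNum, derivative_mul,
      derivative_add, derivative_pow, derivative_C, derivative_X, map_mul, Nat.cast_ofNat,
      map_ofNat, derivative_ofNat]
    ring

/-- The velocity of `∑ T_n R_n`, if the moduli and the variables `T` move with velocities `w`
and `t'`. -/
def dSDot (G : GaugeGroup) {N M : ℕ} (μ : ℂ) (u : Fin N → ℂ) (t : Fin M → ℂ) (w : Fin N → ℂ)
    (t' : Fin M → ℂ) : ℂ[X] :=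
  ∑ n : Fin M, (Polynomial.C (t' n) * whithamPoly G μ u (n.val + 1)
    + Polynomial.C (t n) * whithamDot G μ u (n.val + 1) w)

theorem hasPolyDerivAt_dSPoly (G : GaugeGroup) {N : ℕ} (hN : 1 ≤ N) (μ : ℂ) {M : ℕ}
    {u : ℂ → Fin N → ℂ} {w : Fin N → ℂ} {t : ℂ → Fin M → ℂ} {t' : Fin M → ℂ} {s₀ : ℂ}
    (hu : HasDerivAt u w s₀) (ht : HasDerivAt t t' s₀) :
    HasPolyDerivAt (fun s => dSPoly G μ (u s) (t s)) (dSDot G μ (u s₀) (t s₀) w t') s₀ :=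
  hasPolyDerivAt_sum _ fun n => (hasPolyDerivAt_C ((hasDerivAt_pi.1 ht) n)).mul
    (hasPolyDerivAt_whithamPoly G hN μ _ hu)

theorem isOddPoly_dSDot (G : GaugeGroup) {N : ℕ} (hN : 1 ≤ N) (μ : ℂ) {M : ℕ} (u : Fin N → ℂ)
    (t : Fin M → ℂ) (w : Fin N → ℂ) (t' : Fin M → ℂ) : IsOddPoly (dSDot G μ u t w t') :=
  isOddPoly_sum _ fun n _ =>
    ((isOddPoly_whithamPoly G hN μ u (Nat.le_add_left 1 n.val)).C_mul _).add
      ((isOddPoly_whithamDot G hN μ u (Nat.le_add_left 1 n.val) w).C_mul _)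

/-- The numerator of the variation of `dS` at constant `z`. -/
def dSVar (G : GaugeGroup) {N M : ℕ} (μ : ℂ) (u : Fin N → ℂ) (t : Fin M → ℂ) (w : Fin N → ℂ)
    (t' : Fin M → ℂ) : ℂ[X] :=
  varNum G (charPoly u) (dSPoly G μ u t) (dSDot G μ u t w t') (charDot w)

theorem isOddPoly_dSVar (G : GaugeGroup) {N : ℕ} (hN : 1 ≤ N) (μ : ℂ) {M : ℕ} (u : Fin N → ℂ)
    (t : Fin M → ℂ) (w : Fin N → ℂ) (t' : Fin M → ℂ) : IsOddPoly (dSVar G μ u t w t') :=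
  isOddPoly_varNum G (isEvenPoly_charPoly u) (isOddPoly_dSPoly G hN μ u t)
    (isOddPoly_dSDot G hN μ u t w t') (isEvenPoly_charDot w)

theorem dSVar_eq (G : GaugeGroup) {N M : ℕ} (μ : ℂ) (u : Fin N → ℂ) (t : Fin M → ℂ)
    (w : Fin N → ℂ) (t' : Fin M → ℂ) :
    dSVar G μ u t w t' = ∑ n : Fin M, Polynomial.C (t n) * varNum G (charPoly u)
        (whithamPoly G μ u (n.val + 1)) (whithamDot G μ u (n.val + 1) w) (charDot w)
      + dSPoly G μ u t' * wNum G (charPoly u) := by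
  simp only [dSVar, varNum, dSPoly, dSDot, derivative_sum, Finset.mul_sum, Finset.sum_mul,
    ← Finset.sum_add_distrib, ← Finset.sum_sub_distrib, derivative_C_mul]
  refine Finset.sum_congr rfl fun n _ => ?_
  ring

/-- The variation of `dS` at constant `z` is an invariant holomorphic differential plus the
contribution of the moving variables `T`. -/
theorem exists_dSVar_eq (G : GaugeGroup) {N : ℕ} (hN : 1 ≤ N) (μ : ℂ) {M : ℕ} (u : Fin N → ℂ)
    (t : Fin M → ℂ) (w : Fin N → ℂ) (t' : Fin M → ℂ) :
    ∃ b : Fin N → ℂ, polyDiff (redX G (dSVar G μ u t w t')) = invForm G b + dS G μ u t' := by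
  obtain ⟨b, hb⟩ := IsOddPoly.exists_oddPoly (N := N)
    (P := ∑ n : Fin M, Polynomial.C (t n) * varNum G (charPoly u)
        (whithamPoly G μ u (n.val + 1)) (whithamDot G μ u (n.val + 1) w) (charDot w))
    (isOddPoly_sum _ fun n _ => (isOddPoly_varNum G (isEvenPoly_charPoly u)
      (isOddPoly_whithamPoly G hN μ u (Nat.le_add_left 1 n.val))
      (isOddPoly_whithamDot G hN μ u (Nat.le_add_left 1 n.val) w)
      (isEvenPoly_charDot w)).C_mul _) (by
    refine (Nat.lt_iff_le_pred (by lia)).2 (natDegree_sum_le_of_forall_le _ _ fun n _ => ?_)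
    exact (natDegree_C_mul_le _ _).trans ((Nat.lt_iff_le_pred (by lia)).1
      (natDegree_varNum_lt G hN μ u (Nat.le_add_left 1 n.val) w)))
  exact ⟨b, by rw [dSVar_eq, hb, redX_add, polyDiff_add, dS_eq_polyDiff G hN]; rfl⟩

/-- The polynomial `R_1 = x` does not depend on the moduli. -/
theorem whithamDot_one (G : GaugeGroup) {N : ℕ} (hN : 1 ≤ N) (μ : ℂ) (u w : Fin N → ℂ) :
    whithamDot G μ u 1 w = 0 := by
  have hu : HasDerivAt (fun s : ℂ => u + s • w) w 0 := by
    simpa using ((hasDerivAt_id (0 : ℂ)).smul_const w).const_add u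
  have h := hasPolyDerivAt_whithamPoly G hN μ 1 hu
  simp only [whithamPoly_one G hN, zero_smul, add_zero] at h
  ext i
  exact (h.2 i).unique ((hasPolyDerivAt_const X 0).2 i)

/-- At `T = (1, 0, …, 0)`, where `dS = x dz/z`, every invariant holomorphic differential is the
variation of `dS` in exactly one direction in the space of moduli. -/
theorem dSVar_first (G : GaugeGroup) {N : ℕ} (hN : 1 ≤ N) (μ : ℂ) {M : ℕ} (hM : 1 ≤ M)
    (u w : Fin N → ℂ) :
    dSVar G μ u (fun n : Fin M => if n.val = 0 then (1 : ℂ) else 0) w 0 = oddPoly w := by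
  rw [dSVar_eq, Finset.sum_eq_single (⟨0, hM⟩ : Fin M)]
  · simp [dSPoly, whithamPoly_one G hN, whithamDot_one G hN, varNum, oddPoly]
  · intro n _ hn
    rw [if_neg fun h => hn (Fin.ext h), map_zero, zero_mul]
  · simp

/-- The derivative of a period of `dS` is the period of the variation of `dS` at constant `z`. -/
theorem hasDerivAt_periodMap {G : GaugeGroup} {N : ℕ} (hN : 1 ≤ N) {μ : ℂ} {M : ℕ}
    {U : Set (Fin N → ℂ)} (hU : IsOpen U) (A : Fin N → CycleFamily G μ U)
    {u : ℂ → Fin N → ℂ} {w : Fin N → ℂ} {t : ℂ → Fin M → ℂ} {t' : Fin M → ℂ} {s₀ : ℂ}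
    (hu : HasDerivAt u w s₀) (ht : HasDerivAt t t' s₀) (huU : u s₀ ∈ U) (j : Fin N) :
    HasDerivAt (fun s => periodMap A (u s) (t s) j)
      (((A j).at (u s₀)).period (polyDiff (redX G (dSVar G μ (u s₀) (t s₀) w t')))) s₀ := by
  have h := (A j).hasDerivAt_period hU (isC1Family_dSForm G hN μ M) (hu.prodMk ht) huU
    (((hasPolyDerivAt_dSPoly G hN μ hu ht).mul ((hasPolyDerivAt_charPoly hu).wNum G)).redX G)
    (hasPolyDerivAt_curvePoly G μ hu)
  simp only [periodMap, dS_eq_polyDiff G hN]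
  refine h.congr_deriv ?_
  exact (A j).integral_eq_period huU (variation_identity G μ (u s₀)
    (isOddPoly_dSPoly G hN μ _ _) (isOddPoly_dSDot G hN μ _ _ w t') (isEvenPoly_charDot w))

/-! ### Normalized differentials -/

theorem invForm_add (G : GaugeGroup) {N : ℕ} (v w : Fin N → ℂ) :
    invForm G (v + w) = invForm G v + invForm G w := by
  rw [invForm, oddPoly_add, redX_add, polyDiff_add]
  rfl

theorem invForm_smul (G : GaugeGroup) {N : ℕ} (a : ℂ) (w : Fin N → ℂ) :
    invForm G (a • w) = a • invForm G w := by
  rw [invForm, oddPoly_smul, redX_C_mul, polyDiff_C_mul]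
  rfl

/-- The matrix of `A`-periods of the invariant holomorphic differentials. -/
def periodMatrix {G : GaugeGroup} {N : ℕ} {μ : ℂ} {U : Set (Fin N → ℂ)}
    (A : Fin N → CycleFamily G μ U) {u : Fin N → ℂ} (hu : u ∈ U) :
    (Fin N → ℂ) →ₗ[ℂ] (Fin N → ℂ) where
  toFun w j := ((A j).at u).period (invForm G w)
  map_add' v w := by
    funext j
    simp only [Pi.add_apply, invForm, oddPoly_add, redX_add, (A j).period_add hu]
  map_smul' a w := by
    funext j
    simp only [Pi.smul_apply, invForm, oddPoly_smul, redX_C_mul, (A j).period_C_mul,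
      smul_eq_mul, RingHom.id_apply]

theorem periodMatrix_bijective {G : GaugeGroup} {N : ℕ} (hN : 1 ≤ N) {μ : ℂ}
    {U : Set (Fin N → ℂ)} {A B : Fin N → CycleFamily G μ U} {u : Fin N → ℂ} (hu : u ∈ U)
    (hf : Squarefree (curvePoly G μ u))
    (hAB : IsPrymBasis G μ u (fun j => (A j).at u) (fun j => (B j).at u)) :
    Function.Bijective (periodMatrix A hu) := by
  have hinj : Function.Injective (periodMatrix A hu) :=
    (injective_iff_map_eq_zero _).2 fun w hw =>
      eq_zero_of_invForm_periods G hN hu hf hAB fun j => congrFun hw j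
  exact ⟨hinj, LinearMap.injective_iff_surjective.1 hinj⟩

/-- The normalized differentials have the columns of the inverse period matrix as coefficient
vectors. -/
theorem isNormalizedBasis_iff {G : GaugeGroup} {N : ℕ} (hN : 1 ≤ N) {μ : ℂ}
    {U : Set (Fin N → ℂ)} {A : Fin N → CycleFamily G μ U} {u : Fin N → ℂ} (hu : u ∈ U)
    (hf : Squarefree (curvePoly G μ u)) (ω : Fin N → MerDiff) :
    IsNormalizedBasis G μ u (fun j => (A j).at u) ω ↔
      ∃ b : Fin N → Fin N → ℂ, ∀ k, ω k = invForm G (b k) ∧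
        periodMatrix A hu (b k) = Pi.single k 1 := by
  constructor
  · intro h
    choose b hb using fun k => (invariant_iff G hN hf (ω k)).1 ⟨(h k).1, (h k).2.1⟩
    refine ⟨b, fun k => ⟨hb k, ?_⟩⟩
    funext j
    rw [Pi.single_apply, ← (h k).2.2 j, hb k]
    rfl
  · rintro ⟨b, hb⟩ k
    have h := (invariant_iff G hN hf (ω k)).2 ⟨b k, (hb k).1⟩
    refine ⟨h.1, h.2, fun j => ?_⟩
    have := congrFun (hb k).2 j
    rw [Pi.single_apply] at this
    rw [← this, (hb k).1]
    rfl

theorem existsUnique_normalizedBasis {G : GaugeGroup} {N : ℕ} (hN : 1 ≤ N) {μ : ℂ}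
    {U : Set (Fin N → ℂ)} {A B : Fin N → CycleFamily G μ U} {u : Fin N → ℂ} (hu : u ∈ U)
    (hf : Squarefree (curvePoly G μ u))
    (hAB : IsPrymBasis G μ u (fun j => (A j).at u) (fun j => (B j).at u)) :
    ∃! ω : Fin N → MerDiff, IsNormalizedBasis G μ u (fun j => (A j).at u) ω := by
  have hbij := periodMatrix_bijective hN hu hf hAB
  choose b hb using fun k : Fin N => hbij.2 (Pi.single k 1)
  refine ⟨fun k => invForm G (b k), (isNormalizedBasis_iff hN hu hf _).2
    ⟨b, fun k => ⟨rfl, hb k⟩⟩, fun ω hω => ?_⟩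
  obtain ⟨c, hc⟩ := (isNormalizedBasis_iff hN hu hf _).1 hω
  funext k
  rw [(hc k).1, hbij.1 ((hc k).2.trans (hb k).symm)]

/-! ### Inversion of the period map -/

theorem contDiffOn_periodMap {G : GaugeGroup} {N : ℕ} (hN : 1 ≤ N) {μ : ℂ} (M : ℕ)
    {U : Set (Fin N → ℂ)} (hU : IsOpen U) (A : Fin N → CycleFamily G μ U) :
    ContDiffOn ℂ 1 (fun p : (Fin N → ℂ) × (Fin M → ℂ) => (periodMap A p.1 p.2, p.2))
      (U ×ˢ Set.univ) := by
  refine ContDiffOn.prodMk (contDiffOn_pi.2 fun j => ?_) contDiffOn_snd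
  simp only [periodMap, dS_eq_polyDiff G hN]
  exact (A j).contDiffOn_period hU (isC1Family_dSForm G hN μ M)

/-- The derivative of `(u, T) ↦ (a(u, T), T)` is injective at `T = (1, 0, …, 0)`. -/
theorem fderiv_periodMap_injective {G : GaugeGroup} {N : ℕ} (hN : 1 ≤ N) {μ : ℂ} {M : ℕ}
    (hM : 1 ≤ M) {U : Set (Fin N → ℂ)} (hU : IsOpen U) {A B : Fin N → CycleFamily G μ U}
    {u₀ : Fin N → ℂ} (hu₀ : u₀ ∈ U) (hf : Squarefree (curvePoly G μ u₀))
    (hAB : IsPrymBasis G μ u₀ (fun j => (A j).at u₀) (fun j => (B j).at u₀))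
    {D : (Fin N → ℂ) × (Fin M → ℂ) →L[ℂ] (Fin N → ℂ) × (Fin M → ℂ)}
    (hD : HasFDerivAt (fun p : (Fin N → ℂ) × (Fin M → ℂ) => (periodMap A p.1 p.2, p.2)) D
      (u₀, fun n : Fin M => if n.val = 0 then (1 : ℂ) else 0)) :
    Function.Injective D := by
  set t₀ : Fin M → ℂ := fun n => if n.val = 0 then (1 : ℂ) else 0 with ht₀
  refine (injective_iff_map_eq_zero D).2 ?_
  rintro ⟨w, t'⟩ h
  have hu : HasDerivAt (fun s : ℂ => u₀ + s • w) w 0 := by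
    simpa using ((hasDerivAt_id (0 : ℂ)).smul_const w).const_add u₀
  have ht : HasDerivAt (fun s : ℂ => t₀ + s • t') t' 0 := by
    simpa using ((hasDerivAt_id (0 : ℂ)).smul_const t').const_add t₀
  have hD' : HasFDerivAt (fun p : (Fin N → ℂ) × (Fin M → ℂ) => (periodMap A p.1 p.2, p.2)) D
      (u₀ + (0 : ℂ) • w, t₀ + (0 : ℂ) • t') := by
    simpa using hD
  have h1 := hD'.comp_hasDerivAt (0 : ℂ) (hu.prodMk ht)
  rw [h] at h1
  have h2 := hasDerivAt_pi.1 h1.fst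
  have ht'0 : t' = 0 := ht.unique h1.snd
  subst ht'0
  have hw : w = 0 := by
    refine eq_zero_of_invForm_periods G hN hu₀ hf hAB fun j => ?_
    have h3 := (hasDerivAt_periodMap hN hU A hu ht (by simpa using hu₀) j).unique (h2 j)
    simp only [zero_smul, add_zero, ht₀, dSVar_first G hN μ hM] at h3
    exact h3
  rw [hw]
  rfl

/-- The inverse function theorem for the period map. -/
theorem exists_inversePeriodMap {G : GaugeGroup} {N : ℕ} (hN : 1 ≤ N) {μ : ℂ} {M : ℕ}
    (hM : 1 ≤ M) {U : Set (Fin N → ℂ)} (hU : IsOpen U) {A B : Fin N → CycleFamily G μ U}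
    {u₀ : Fin N → ℂ} (hu₀ : u₀ ∈ U) (hf : Squarefree (curvePoly G μ u₀))
    (hAB : IsPrymBasis G μ u₀ (fun j => (A j).at u₀) (fun j => (B j).at u₀)) :
    ∃ (V : Set (Fin N → ℂ)) (S : Set (Fin M → ℂ))
      (Ω : Set ((Fin N → ℂ) × (Fin M → ℂ)))
      (v : (Fin N → ℂ) × (Fin M → ℂ) → Fin N → ℂ),
      IsOpen V ∧ u₀ ∈ V ∧ V ⊆ U ∧
      IsOpen S ∧ (fun n : Fin M => if n.val = 0 then (1 : ℂ) else 0) ∈ S ∧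
      IsInversePeriodMap A Ω v ∧
      (∀ p ∈ Ω, v p ∈ V ∧ p.2 ∈ S) ∧
      ∀ u ∈ V, ∀ t ∈ S, (periodMap A u t, t) ∈ Ω ∧ v (periodMap A u t, t) = u := by
  set t₀ : Fin M → ℂ := fun n => if n.val = 0 then (1 : ℂ) else 0 with ht₀
  set Φ : (Fin N → ℂ) × (Fin M → ℂ) → (Fin N → ℂ) × (Fin M → ℂ) :=
    fun p => (periodMap A p.1 p.2, p.2) with hΦ
  have hUo : IsOpen (U ×ˢ (Set.univ : Set (Fin M → ℂ))) := hU.prod isOpen_univ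
  have hC : ContDiffAt ℂ 1 Φ (u₀, t₀) :=
    (contDiffOn_periodMap hN M hU A).contDiffAt (hUo.mem_nhds ⟨hu₀, trivial⟩)
  have hD := (hC.differentiableAt one_ne_zero).hasFDerivAt
  have hinj := fderiv_periodMap_injective hN hM hU hu₀ hf hAB hD
  let e := (LinearEquiv.ofInjectiveEndo (fderiv ℂ Φ (u₀, t₀)).toLinearMap
    hinj).toContinuousLinearEquiv
  have hD' : HasFDerivAt Φ (e : (Fin N → ℂ) × (Fin M → ℂ) →L[ℂ] (Fin N → ℂ) × (Fin M → ℂ))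
      (u₀, t₀) := by
    refine hD.congr_fderiv ?_
    ext1
    all_goals rfl
  set H := hC.toOpenPartialHomeomorph Φ hD' one_ne_zero with hH
  have hsrc : (u₀, t₀) ∈ H.source := hC.mem_toOpenPartialHomeomorph_source hD' one_ne_zero
  have hinv : ContDiffAt ℂ 1 H.symm (Φ (u₀, t₀)) := hC.to_localInverse hD' one_ne_zero
  obtain ⟨D, hDsub, hDo, hDmem⟩ := eventually_nhds_iff.1 (hinv.eventually (by simp))
  -- the points of the domain of `H` over `U` where the inverse is differentiable
  have hW : (H.source ∩ Φ ⁻¹' D) ∩ U ×ˢ Set.univ ∈ 𝓝 (u₀, t₀) :=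
    inter_mem (inter_mem (H.open_source.mem_nhds hsrc)
      (hC.continuousAt.preimage_mem_nhds (hDo.mem_nhds hDmem))) (hUo.mem_nhds ⟨hu₀, trivial⟩)
  rw [nhds_prod_eq, mem_prod_iff] at hW
  obtain ⟨V₁, hV₁, S₁, hS₁, hVS⟩ := hW
  obtain ⟨V, hVsub, hVo, hVm⟩ := mem_nhds_iff.1 hV₁
  obtain ⟨S, hSsub, hSo, hSm⟩ := mem_nhds_iff.1 hS₁
  have hsub : V ×ˢ S ⊆ (H.source ∩ Φ ⁻¹' D) ∩ U ×ˢ Set.univ :=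
    (Set.prod_mono hVsub hSsub).trans hVS
  have hleft : ∀ p ∈ V ×ˢ S, H.symm (Φ p) = p := fun p hp => H.left_inv (hsub hp).1.1
  refine ⟨V, S, Φ '' (V ×ˢ S), fun p => (H.symm p).1, hVo, hVm, fun u hu =>
    (hsub (show (u, t₀) ∈ V ×ˢ S from ⟨hu, hSm⟩)).2.1, hSo, hSm, ⟨?_, ?_, ?_⟩, ?_, ?_⟩
  · exact H.isOpen_image_of_subset_source (hVo.prod hSo) fun p hp => (hsub hp).1.1
  · rintro _ ⟨p, hp, rfl⟩
    exact (((hDsub _ (hsub hp).1.2).differentiableAt one_ne_zero).fst).differentiableWithinAt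
  · rintro _ ⟨p, hp, rfl⟩
    simp only [hleft p hp]
    exact ⟨(hsub hp).2.1, rfl⟩
  · rintro _ ⟨p, hp, rfl⟩
    simp only [hleft p hp]
    exact hp
  · intro u hu t ht
    exact ⟨⟨(u, t), ⟨hu, ht⟩, rfl⟩, congrArg Prod.fst (hleft (u, t) ⟨hu, ht⟩)⟩

/-! ### The Whitham equations -/

/-- A function of one variable through an inverse period map is strictly differentiable. -/
theorem IsInversePeriodMap.hasStrictDerivAt {G : GaugeGroup} {N M : ℕ} {μ : ℂ}
    {U : Set (Fin N → ℂ)} {A : Fin N → CycleFamily G μ U} {Ω : Set ((Fin N → ℂ) × (Fin M → ℂ))}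
    {v : (Fin N → ℂ) × (Fin M → ℂ) → Fin N → ℂ} (hv : IsInversePeriodMap A Ω v)
    {p : ℂ → (Fin N → ℂ) × (Fin M → ℂ)} (hp : Differentiable ℂ p) {s₀ : ℂ} (hs : p s₀ ∈ Ω) :
    HasStrictDerivAt (fun s => v (p s)) (deriv (fun s => v (p s)) s₀) s₀ := by
  have ho : IsOpen (p ⁻¹' Ω) := hv.1.preimage hp.continuous
  have hd : DifferentiableOn ℂ (fun s => v (p s)) (p ⁻¹' Ω) :=
    hv.2.1.comp hp.differentiableOn fun s hs => hs
  exact (hd.analyticAt (ho.mem_nhds hs)).hasStrictDerivAt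

/-- Along a path `(a(s), T(s))` the variation of `dS` at constant `z` is the sum of `∑ T'_n dΩ̂_n`
and an invariant holomorphic differential, and its `A`-periods are `a'(s)`. -/
theorem IsInversePeriodMap.exists_variation {G : GaugeGroup} {N : ℕ} (hN : 1 ≤ N) {M : ℕ} {μ : ℂ}
    {U : Set (Fin N → ℂ)} (hU : IsOpen U) (hsq : ∀ u ∈ U, Squarefree (curvePoly G μ u))
    {A : Fin N → CycleFamily G μ U} {Ω : Set ((Fin N → ℂ) × (Fin M → ℂ))}
    {v : (Fin N → ℂ) × (Fin M → ℂ) → Fin N → ℂ} (hv : IsInversePeriodMap A Ω v)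
    {a : ℂ → Fin N → ℂ} {t : ℂ → Fin M → ℂ} (had : Differentiable ℂ a) (htd : Differentiable ℂ t)
    {a' : Fin N → ℂ} {t' : Fin M → ℂ} {s₀ : ℂ} (ha : HasDerivAt a a' s₀)
    (ht : HasDerivAt t t' s₀) (hs : (a s₀, t s₀) ∈ Ω) :
    ∃ b : Fin N → ℂ,
      HasConstZDeriv G μ (fun s => v (a s, t s)) (fun s => dSPoly G μ (v (a s, t s)) (t s)) s₀
        (invForm G b + dS G μ (v (a s₀, t s₀)) t') ∧
      ∀ j, ((A j).at (v (a s₀, t s₀))).period (invForm G b)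
        + periodMap A (v (a s₀, t s₀)) t' j = a' j := by
  have hpd : Differentiable ℂ fun s => (a s, t s) := had.prodMk htd
  have hus := hv.hasStrictDerivAt hpd hs
  set w := deriv (fun s => v (a s, t s)) s₀
  have huU : v (a s₀, t s₀) ∈ U := (hv.2.2 _ hs).1
  obtain ⟨b, hb⟩ := exists_dSVar_eq G hN μ (v (a s₀, t s₀)) (t s₀) w t'
  refine ⟨b, ?_, fun j => ?_⟩
  · rw [← hb]
    exact hasConstZDeriv G (mu_ne_zero_of_squarefree hN (hsq _ huU)) hus
      (hasPolyDerivAt_dSPoly G hN μ hus.hasDerivAt ht) (isOddPoly_dSVar G hN μ _ _ w t')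
  · have h1 := hasDerivAt_periodMap hN hU A hus.hasDerivAt ht huU j
    have h2 : (fun s => periodMap A (v (a s, t s)) (t s) j) =ᶠ[𝓝 s₀] fun s => a s j := by
      filter_upwards [(hv.1.preimage hpd.continuous).mem_nhds hs] with s hs
      exact congrFun (hv.2.2 _ hs).2 j
    rw [h1.unique ((hasDerivAt_pi.1 ha j).congr_of_eventuallyEq h2) |>.symm, hb]
    rw [periodMap, dS_eq_polyDiff G hN, invForm, ← (A j).period_add huU, polyDiff_add]

/-! ### Comparison of periods -/

theorem update_eq_add_smul {M : ℕ} (t : Fin M → ℂ) (n : Fin M) (s : ℂ) :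
    Function.update t n s = t + (s - t n) • Pi.single n 1 := by
  funext i
  rcases eq_or_ne i n with rfl | h
  · simp
  · simp [h]

theorem differentiable_update {M : ℕ} (t : Fin M → ℂ) (n : Fin M) :
    Differentiable ℂ (fun s => Function.update t n s) := by
  simp only [update_eq_add_smul]
  fun_prop

theorem hasStrictDerivAt_update {M : ℕ} (t : Fin M → ℂ) (n : Fin M) (s₀ : ℂ) :
    HasStrictDerivAt (fun s => Function.update t n s) (Pi.single n 1) s₀ := by
  simp only [update_eq_add_smul]
  have h1 : HasStrictDerivAt (fun s => s - t n) 1 s₀ := (hasStrictDerivAt_id s₀).sub_const (t n)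
  have h2 : HasStrictDerivAt (fun s => (s - t n) • (Pi.single n 1 : Fin M → ℂ))
      ((1 : ℂ) • Pi.single n 1) s₀ := h1.smul_const (Pi.single n 1)
  rw [one_smul] at h2
  exact h2.const_add t

/-- The `u_j`-derivative of `dΩ̂_n` at constant `z`. -/
theorem exists_hasConstZDeriv_whithamPoly (G : GaugeGroup) {N : ℕ} (hN : 1 ≤ N) {μ : ℂ}
    {u : Fin N → ℂ} (hf : Squarefree (curvePoly G μ u)) {n : ℕ} (hn : 1 ≤ n) (j : Fin N) :
    ∃ ω : MerDiff, IsHolomorphic (curvePoly G μ u) ω ∧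
      IsSigmaInvariant G (curvePoly G μ u) ω ∧
      HasConstZDeriv G μ (fun s => Function.update u j s)
        (fun s => whithamPoly G μ (Function.update u j s) n) (u j) ω := by
  have hu := hasStrictDerivAt_update u j (u j)
  have hodd : IsOddPoly (varNum G (charPoly u) (whithamPoly G μ u n)
      (whithamDot G μ u n (Pi.single j 1)) (charDot (Pi.single j 1))) :=
    isOddPoly_varNum G (isEvenPoly_charPoly u) (isOddPoly_whithamPoly G hN μ u hn)
      (isOddPoly_whithamDot G hN μ u hn _) (isEvenPoly_charDot _)
  obtain ⟨b, hb⟩ := hodd.exists_oddPoly (natDegree_varNum_lt G hN μ u hn _)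
  have hinv := (invariant_iff G hN hf (invForm G b)).2 ⟨b, rfl⟩
  refine ⟨invForm G b, hinv.1, hinv.2, ?_⟩
  have h := hasConstZDeriv G (mu_ne_zero_of_squarefree hN hf) hu
    (hasPolyDerivAt_whithamPoly G hN μ n hu.hasDerivAt) (by
      rw [Function.update_eq_self]
      exact hodd)
  rw [Function.update_eq_self, hb] at h
  exact h

theorem polyDiff_sum {ι : Type*} (s : Finset ι) (c : ι → ℂ) (p : ι → ℂ[X]) :
    polyDiff (∑ i ∈ s, Polynomial.C (c i) * p i) = ∑ i ∈ s, c i • polyDiff (p i) := by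
  classical
  induction s using Finset.induction_on with
  | empty =>
    simp only [Finset.sum_empty, polyDiff, map_zero]
    rfl
  | insert i s hi ih =>
    rw [Finset.sum_insert hi, Finset.sum_insert hi, polyDiff_add, polyDiff_C_mul, ih]

theorem CycleFamily.period_sum {G : GaugeGroup} {N : ℕ} {μ : ℂ} {U : Set (Fin N → ℂ)}
    (A : CycleFamily G μ U) {u : Fin N → ℂ} (hu : u ∈ U) {ι : Type*} (s : Finset ι) (c : ι → ℂ)
    (p : ι → ℂ[X]) : (A.at u).period (∑ i ∈ s, c i • polyDiff (p i))
      = ∑ i ∈ s, c i * (A.at u).period (polyDiff (p i)) := by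
  classical
  rw [← polyDiff_sum]
  induction s using Finset.induction_on with
  | empty => simp [A.period_polyDiff]
  | insert i s hi ih =>
    rw [Finset.sum_insert hi, Finset.sum_insert hi, A.period_add hu, A.period_C_mul, ih]

theorem invForm_sum (G : GaugeGroup) {N : ℕ} (c : Fin N → ℂ) (b : Fin N → Fin N → ℂ) :
    invForm G (∑ k, c k • b k) = ∑ k, c k • invForm G (b k) := by
  induction (Finset.univ : Finset (Fin N)) using Finset.induction_on with
  | empty => simp [invForm, oddPoly_eq, polyDiff, redX]; cases G <;> simp
  | insert i s hi ih =>
    rw [Finset.sum_insert hi, Finset.sum_insert hi, invForm_add, invForm_smul, ih]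

theorem dOmegaHat_eq_dS (G : GaugeGroup) {N M : ℕ} (μ : ℂ) (u : Fin N → ℂ) (n : Fin M) :
    dOmegaHat G μ u (n.val + 1) = dS G μ u (Pi.single n 1) := by
  rw [dS_eq_sum, Finset.sum_eq_single n]
  · simp
  · intro m _ hm
    simp [hm]
  · simp

/-- The normalized differential `dΩ_n` is `dΩ̂_n` minus the invariant holomorphic differential with
the same `A`-periods. -/
theorem dOmega_eq {G : GaugeGroup} {N : ℕ} (hN : 1 ≤ N) {μ : ℂ} {M : ℕ} {U : Set (Fin N → ℂ)}
    {A B : Fin N → CycleFamily G μ U} {u : Fin N → ℂ} (hu : u ∈ U)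
    (hf : Squarefree (curvePoly G μ u))
    (hAB : IsPrymBasis G μ u (fun j => (A j).at u) (fun j => (B j).at u))
    {ω : Fin N → MerDiff} (hω : IsNormalizedBasis G μ u (fun j => (A j).at u) ω) (n : Fin M)
    {b : Fin N → ℂ}
    (hb : ∀ j, ((A j).at u).period (invForm G b) + periodMap A u (Pi.single n (1 : ℂ)) j = 0) :
    dOmega G μ u (fun j => (A j).at u) ω (n.val + 1)
      = invForm G b + dOmegaHat G μ u (n.val + 1) := by
  obtain ⟨c, hc⟩ := (isNormalizedBasis_iff hN hu hf ω).1 hω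
  have hbc : b = ∑ k, (-periodMap A u (Pi.single n (1 : ℂ)) k) • c k := by
    refine (periodMatrix_bijective hN hu hf hAB).1 ?_
    simp only [map_sum, map_smul, (hc _).2]
    funext j
    rw [Finset.sum_apply, Finset.sum_eq_single j]
    · simp only [Pi.smul_apply, Pi.single_eq_same, smul_eq_mul, mul_one]
      exact eq_neg_of_add_eq_zero_left (hb j)
    · intro k _ hk
      simp [hk.symm]
    · simp
  rw [hbc, invForm_sum, dOmega, sub_eq_add_neg, add_comm, ← Finset.sum_neg_distrib]
  congr 1
  refine Finset.sum_congr rfl fun k _ => ?_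
  rw [dOmegaHat_eq_dS, (hc k).1, neg_smul]
  rfl

theorem period_dOmega {G : GaugeGroup} {N : ℕ} (hN : 1 ≤ N) {μ : ℂ} {M : ℕ}
    {U : Set (Fin N → ℂ)} {A B : Fin N → CycleFamily G μ U} {u : Fin N → ℂ} (hu : u ∈ U)
    (hf : Squarefree (curvePoly G μ u))
    (hAB : IsPrymBasis G μ u (fun j => (A j).at u) (fun j => (B j).at u))
    {ω : Fin N → MerDiff} (hω : IsNormalizedBasis G μ u (fun j => (A j).at u) ω) (n : Fin M)
    (j : Fin N) :
    ((A j).at u).period (dOmega G μ u (fun j => (A j).at u) ω (n.val + 1)) = 0 := by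
  obtain ⟨b, hb⟩ := (periodMatrix_bijective hN hu hf hAB).2
    (-periodMap A u (Pi.single n (1 : ℂ)))
  have hb' : ∀ j, ((A j).at u).period (invForm G b)
      + periodMap A u (Pi.single n (1 : ℂ)) j = 0 := fun j => by
    have := congrFun hb j
    rw [Pi.neg_apply] at this
    rw [← neg_add_cancel (periodMap A u (Pi.single n (1 : ℂ)) j), ← this]
    rfl
  rw [dOmega_eq hN hu hf hAB hω n hb', dOmegaHat_eq_dS, ← hb' j, periodMap,
    dS_eq_polyDiff G hN, invForm, ← (A j).period_add hu, polyDiff_add]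

theorem periodMap_eq_sum {G : GaugeGroup} {N : ℕ} (hN : 1 ≤ N) {μ : ℂ} {M : ℕ}
    {U : Set (Fin N → ℂ)} (A : Fin N → CycleFamily G μ U) {u : Fin N → ℂ} (hu : u ∈ U)
    (t : Fin M → ℂ) (j : Fin N) :
    periodMap A u t j = ∑ n : Fin M, t n * ((A j).at u).period (dOmegaHat G μ u (n.val + 1)) := by
  have h : ∀ n : Fin M, dOmegaHat G μ u (n.val + 1)
      = polyDiff (redX G (whithamPoly G μ u (n.val + 1) * wNum G (charPoly u))) := fun n =>
    mulDLogZ_eq_polyDiff G u (isOddPoly_whithamPoly G hN μ u (Nat.le_add_left 1 n.val))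
  simp only [periodMap, dS_eq_sum, h]
  exact (A j).period_sum hu _ t _

/-- The corrections `c_j^{(n)} dω_j` add up to `∑ a_j dω_j`, as `a_j = ∑ T_n c_j^{(n)}`. -/
theorem dS_eq_sum_dOmega {G : GaugeGroup} {N : ℕ} (hN : 1 ≤ N) {μ : ℂ} {M : ℕ}
    {U : Set (Fin N → ℂ)} (A : Fin N → CycleFamily G μ U) {u : Fin N → ℂ} (hu : u ∈ U)
    (t : Fin M → ℂ) (ω : Fin N → MerDiff) :
    dS G μ u t = ∑ n : Fin M, t n • dOmega G μ u (fun j => (A j).at u) ω (n.val + 1)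
      + ∑ j : Fin N, periodMap A u t j • ω j := by
  simp only [dOmega, smul_sub, Finset.sum_sub_distrib, ← dS_eq_sum, Finset.smul_sum, smul_smul,
    periodMap_eq_sum hN A hu, Finset.sum_smul]
  rw [Finset.sum_comm, sub_add_cancel]

end SeibergWitten

end

theorem mainTheorem2 (G : GaugeGroup) (N : ℕ) (hN : 1 ≤ N) (μ : ℂ) :
    -- the polynomials `R_n` are odd, and `R_1 = x`
    (∀ u : Fin N → ℂ, whithamPoly G μ u 1 = X ∧
      ∀ n : ℕ, 1 ≤ n → (whithamPoly G μ u n).comp (-X) = -whithamPoly G μ u n) ∧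
    -- the `u_j`-derivatives of `dΩ̂_n` are holomorphic and `σ'`-invariant
    (∀ u : Fin N → ℂ, Squarefree (curvePoly G μ u) → ∀ n : ℕ, 1 ≤ n → ∀ j : Fin N,
      ∃ ω : MerDiff, IsHolomorphic (curvePoly G μ u) ω ∧
        IsSigmaInvariant G (curvePoly G μ u) ω ∧
        HasConstZDeriv G μ (fun s => Function.update u j s)
          (fun s => whithamPoly G μ (Function.update u j s) n) (u j) ω) ∧
    -- the Whitham deformations
    (∀ U : Set (Fin N → ℂ), IsOpen U → (∀ u ∈ U, Squarefree (curvePoly G μ u)) →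
      ∀ A B : Fin N → CycleFamily G μ U,
      (∀ u ∈ U, IsPrymBasis G μ u (fun j => (A j).at u) (fun j => (B j).at u)) →
      -- the normalized differentials `dω_j` exist and are unique
      (∀ u ∈ U, ∃! ω : Fin N → MerDiff, IsNormalizedBasis G μ u (fun j => (A j).at u) ω) ∧
      ∀ M : ℕ, 1 ≤ M →
        -- the period map is invertible for `T` close to `(1, 0, 0, …)`
        (∀ u₀ ∈ U, ∃ (V : Set (Fin N → ℂ)) (S : Set (Fin M → ℂ))
          (Ω : Set ((Fin N → ℂ) × (Fin M → ℂ)))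
          (v : (Fin N → ℂ) × (Fin M → ℂ) → Fin N → ℂ),
          IsOpen V ∧ u₀ ∈ V ∧ V ⊆ U ∧
          IsOpen S ∧ (fun n : Fin M => if n.val = 0 then (1 : ℂ) else 0) ∈ S ∧
          IsInversePeriodMap A Ω v ∧
          (∀ p ∈ Ω, v p ∈ V ∧ p.2 ∈ S) ∧
          ∀ u ∈ V, ∀ t ∈ S, (periodMap A u t, t) ∈ Ω ∧ v (periodMap A u t, t) = u) ∧
        -- under every inverse period map, `dS` satisfies the Whitham equations
        ∀ (Ω : Set ((Fin N → ℂ) × (Fin M → ℂ)))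
          (v : (Fin N → ℂ) × (Fin M → ℂ) → Fin N → ℂ), IsInversePeriodMap A Ω v →
          ∀ (a : Fin N → ℂ) (t : Fin M → ℂ), (a, t) ∈ Ω → ∀ ω : Fin N → MerDiff,
            IsNormalizedBasis G μ (v (a, t)) (fun j => (A j).at (v (a, t))) ω →
            (∀ (j : Fin N) (n : Fin M), ((A j).at (v (a, t))).period
              (dOmega G μ (v (a, t)) (fun j => (A j).at (v (a, t))) ω (n.val + 1)) = 0) ∧
            dS G μ (v (a, t)) t =
              ∑ n : Fin M, t n •
                dOmega G μ (v (a, t)) (fun j => (A j).at (v (a, t))) ω (n.val + 1) +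
              ∑ j : Fin N, a j • ω j ∧
            (∀ j : Fin N, HasConstZDeriv G μ
              (fun s => v (Function.update a j s, t))
              (fun s => dSPoly G μ (v (Function.update a j s, t)) t) (a j) (ω j)) ∧
            (∀ n : Fin M, HasConstZDeriv G μ
              (fun s => v (a, Function.update t n s))
              (fun s => dSPoly G μ (v (a, Function.update t n s)) (Function.update t n s)) (t n)
              (dOmega G μ (v (a, t)) (fun j => (A j).at (v (a, t))) ω (n.val + 1)))) := by
  refine ⟨fun u => ⟨whithamPoly_one G hN μ u, fun n hn =>
    (isOddPoly_iff _).1 (isOddPoly_whithamPoly G hN μ u hn)⟩, fun u hf n hn j =>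
    exists_hasConstZDeriv_whithamPoly G hN hf hn j, fun U hU hsq A B hAB =>
    ⟨fun u hu => existsUnique_normalizedBasis hN hu (hsq u hu) (hAB u hu), fun M hM =>
    ⟨fun u₀ hu₀ => exists_inversePeriodMap hN hM hU hu₀ (hsq u₀ hu₀) (hAB u₀ hu₀), ?_⟩⟩⟩
  intro Ω v hv a t hat ω hω
  obtain ⟨hu, hper⟩ := hv.2.2 _ hat
  have hf := hsq _ hu
  have hAB := hAB _ hu
  refine ⟨fun j n => period_dOmega hN hu hf hAB hω n j, ?_, fun j => ?_, fun n => ?_⟩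
  · have h := dS_eq_sum_dOmega hN A hu t ω
    simp only [hper] at h
    exact h
  -- the path `a + s e_j`: the variation is holomorphic with periods `e_j`
  · have hmem : (Function.update a j (a j), t) ∈ Ω := by rwa [Function.update_eq_self]
    obtain ⟨b, hb, hbper⟩ := hv.exists_variation hN hU hsq (differentiable_update a j)
      (differentiable_const t) (hasStrictDerivAt_update a j (a j)).hasDerivAt
      (hasDerivAt_const (a j) t) hmem
    simp only [Function.update_eq_self] at hb hbper
    have h0 : dS G μ (v (a, t)) (0 : Fin M → ℂ) = 0 := by simp [dS_eq_sum]
    obtain ⟨c, hc⟩ := (isNormalizedBasis_iff hN hu hf ω).1 hω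
    have hbc : b = c j := by
      refine (periodMatrix_bijective hN hu hf hAB).1 ?_
      rw [(hc j).2]
      funext i
      rw [← hbper i, periodMap_eq_sum hN A hu]
      simp only [Pi.zero_apply, zero_mul, Finset.sum_const_zero, add_zero]
      rfl
    rwa [h0, add_zero, hbc, ← (hc j).1] at hb
  -- the path `T + s e_n`: the variation is `dΩ̂_n` plus a holomorphic part, without periods
  · have hmem : (a, Function.update t n (t n)) ∈ Ω := by rwa [Function.update_eq_self]
    obtain ⟨b, hb, hbper⟩ := hv.exists_variation hN hU hsq (differentiable_const a)
      (differentiable_update t n) (hasDerivAt_const (t n) a)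
      (hasStrictDerivAt_update t n (t n)).hasDerivAt hmem
    simp only [Function.update_eq_self] at hb hbper
    rw [dOmega_eq hN hu hf hAB hω n hbper, dOmegaHat_eq_dS]
    exact hb
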